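/- Let $d\ge 1$ and let $\Omega\subset\mathbb R^d$ be a bounded, connected, open set with Lipschitz boundary. Let $F:\mathbb R^d\to[0,+\infty]$ be convex and lower semicontinuous with $F(0)=0$, and assume that $F$ is $\gamma$-convex for some $\gamma>0$, that is, $F(\eta)\ge F(\xi)+p\cdot(\eta-\xi)+\frac\gamma2|\eta-\xi|^2$ for all $\xi,\eta\in\mathbb R^d$ and $p\in\partial F(\xi)$. Let $\Phi:L^1(\Omega)\to[0,+\infty]$ be one of the following functionals: - (Neumann case) $\Phi(u)=\int_\Omega F(Du)\,dx$ if $u\in W^{1,1}(\Omega)$, and $\Phi(u)=+\infty$ otherwise; - (Dirichlet case) $\Phi(u)=\int_\Omega F(Du)\,dx$ if $u\in W^{1,1}(\Omega)$ and $u-g\in W^{1,1}_0(\Omega)$, and $\Phi(u)=+\infty$ otherwise, where $g\in W^{1,1}(\Omega)$ is given such that $\int_\Omega F(\theta Dg)\,dx<+\infty$ for some $\theta>1$. Let $\partial\Phi(w)\subset L^\infty(\Omega)$ denote the subdifferential of $\Phi$ at $w\in L^1(\Omega)$ and, if it is not empty, let $\|\partial^0\Phi(w)\|_\infty$ be the minimal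 $L^\infty$-norm of its elements. Let $u^0\in L^1(\Omega)$ with $\Phi(u^0)<+\infty$, and let $u\in C^0([0,+\infty);L^1(\Omega))$ be a limit of minimizing movements starting from $u^0$: there are $\tau_k>0$, $\tau_k\to0$, and sequences $(u^n_k)_{n\ge0}$ with $u^0_k=u^0$ and $u^{n+1}_k$ a minimizer over $w\in L^1(\Omega)$ of $\Phi(w)+\frac1{2\tau_k}\|w-u^n_k\|_1^2$, such that, for every $T>0$, $u_k^{\lfloor t/\tau_k\rfloor}\to u(t)$ in $L^1(\Omega)$ uniformly in $t\in[0,T]$. Then: 1. The distributional time derivative $\dot u$ of $u$ in $(0,+\infty)\times\Omega$ belongs to $L^2((t,+\infty);H^1(\Omega))$ for every $t>0$, and $$\gamma\int_t^{+\infty}\|D\dot u(s)\|_2^2\,ds\le\frac{\Phi(u^0)}{t}\qquad\text{for every }t>0 .$$ 2. If in addition $\partial\Phi(u^0)\ne\emptyset$, then $$\gamma\int_0^{+\infty}\|D\dot u(s)\|_2^2\,ds\le\frac12\|\partial^0\Phi(u^0)\|_\infty^2 .$$ 3. If in addition $F$ has full domain (it is finite everywhere) and is of class $C^1$, then for a.e.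 $s>0$ the distributional divergence $\operatorname{div}\nabla F(Du(s))$ is a function on $\Omega$, and $u$ satisfies $$|\operatorname{div}\nabla F(Du)|\le\|\dot u\|_1,\qquad \dot u\,\operatorname{div}\nabla F(Du)=|\dot u|\,\|\dot u\|_1\qquad\text{a.e. in }(0,+\infty)\times\Omega,$$ where $\|\dot u\|_1$ is the function $s\mapsto\int_\Omega|\dot u(s,x)|\,dx$. -/

import Mathlib

open MeasureTheory Set Filter Topology
open scoped ENNReal NNReal ContDiff

noncomputable section

namespace L1Flow

/-- The Euclidean space `ℝᵈ`. -/
abbrev E (d : ℕ) := EuclideanSpace ℝ (Fin d)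

/-- The Banach space `L¹(Ω)`. -/
abbrev L1 {d : ℕ} (Ω : Set (E d)) := Lp ℝ 1 (volume.restrict Ω)

/-- The Banach space `L^∞(Ω)`. -/
abbrev LInf {d : ℕ} (Ω : Set (E d)) := Lp ℝ ⊤ (volume.restrict Ω)

/-- The boundary of `Ω` is Lipschitz: near each boundary point, `Ω` is the strict epigraph, in some
unit direction `ν`, of a Lipschitz function of the variables orthogonal to `ν`. -/
def HasLipschitzBoundary {d : ℕ} (Ω : Set (E d)) : Prop :=
  ∀ x ∈ frontier Ω, ∃ (ν : E d) (ψ : E d → ℝ) (K : ℝ≥0) (r : ℝ),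
    ‖ν‖ = 1 ∧ LipschitzWith K ψ ∧ (∀ (y : E d) (s : ℝ), ψ (y + s • ν) = ψ y) ∧ 0 < r ∧
      ∀ y ∈ Metric.ball x r, (y ∈ Ω ↔ ψ y < inner ℝ y ν)

/-! ### The integrand -/

/-- `p` is a subgradient at `ξ` of the convex function `F : ℝᵈ → [0, +∞]`. -/
def IsSubgradient {d : ℕ} (F : E d → ℝ≥0∞) (ξ p : E d) : Prop :=
  F ξ ≠ ⊤ ∧ ∀ η : E d, (F ξ : EReal) + ((inner ℝ p (η - ξ) : ℝ) : EReal) ≤ (F η : EReal)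

/-- `F` is `γ`-convex: `F η ≥ F ξ + p · (η - ξ) + γ / 2 * |η - ξ|²` for all `ξ`, `η` and all
`p ∈ ∂F(ξ)`. -/
def IsGammaConvex {d : ℕ} (γ : ℝ) (F : E d → ℝ≥0∞) : Prop :=
  ∀ ξ η p : E d, IsSubgradient F ξ p →
    (F ξ : EReal) + ((inner ℝ p (η - ξ) + γ / 2 * ‖η - ξ‖ ^ 2 : ℝ) : EReal) ≤ (F η : EReal)

/-! ### Weak derivatives -/

/-- `φ ∈ C_c^∞(U)`. -/
def IsTestFunction {V : Type*} [NormedAddCommGroup V] [NormedSpace ℝ V] (U : Set V)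
    (φ : V → ℝ) : Prop :=
  ContDiff ℝ ∞ φ ∧ HasCompactSupport φ ∧ tsupport φ ⊆ U

/-- `G` is the weak gradient of `u` in `Ω`. -/
def IsWeakGradient {d : ℕ} (Ω : Set (E d)) (u : E d → ℝ) (G : E d → E d) : Prop :=
  LocallyIntegrableOn u Ω ∧ LocallyIntegrableOn G Ω ∧
    ∀ φ : E d → ℝ, IsTestFunction Ω φ →
      ∫ x in Ω, u x • gradient φ x = - ∫ x in Ω, φ x • G x

/-- `w` is the distributional divergence of the vector field `Z` in `Ω`. -/
def IsWeakDivergence {d : ℕ} (Ω : Set (E d)) (Z : E d → E d) (w : E d → ℝ) : Prop :=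
  LocallyIntegrableOn Z Ω ∧ LocallyIntegrableOn w Ω ∧
    ∀ φ : E d → ℝ, IsTestFunction Ω φ →
      ∫ x in Ω, inner ℝ (Z x) (gradient φ x) = - ∫ x in Ω, w x * φ x

/-- `u ∈ W^{1,1}(Ω)`, with weak gradient `G`. -/
def IsW11Gradient {d : ℕ} (Ω : Set (E d)) (u : E d → ℝ) (G : E d → E d) : Prop :=
  IntegrableOn u Ω ∧ IntegrableOn G Ω ∧ IsWeakGradient Ω u G

/-- `u ∈ W^{1,1}_0(Ω)`, the closure of `C_c^∞(Ω)` in `W^{1,1}(Ω)`. -/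
def MemW11Zero {d : ℕ} (Ω : Set (E d)) (u : E d → ℝ) : Prop :=
  ∃ G : E d → E d, IsW11Gradient Ω u G ∧
    ∃ φ : ℕ → E d → ℝ, (∀ n, IsTestFunction Ω (φ n)) ∧
      Tendsto (fun n => ∫⁻ x in Ω, ‖φ n x - u x‖ₑ) atTop (𝓝 0) ∧
      Tendsto (fun n => ∫⁻ x in Ω, ‖gradient (φ n) x - G x‖ₑ) atTop (𝓝 0)

/-! ### The energies

Since a `γ`-convex integrand is superlinear, the energy is infinite outside `W^{1,1}(Ω)` and has no
singular part. The infimum below runs over the (almost everywhere unique) weak gradients of `u`; it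
is `+∞` if there is none. -/

/-- `Φ(u) = ∫_Ω F(Du)` for `u ∈ W^{1,1}(Ω)`, and `+∞` otherwise (homogeneous Neumann case). -/
def neumannEnergy {d : ℕ} (F : E d → ℝ≥0∞) (Ω : Set (E d)) (u : L1 Ω) : ℝ≥0∞ :=
  ⨅ (G : E d → E d) (_ : IsW11Gradient Ω u G), ∫⁻ x in Ω, F (G x)

/-- `Φ(u) = ∫_Ω F(Du)` for `u ∈ W^{1,1}(Ω)` with `u = g` on `∂Ω`, and `+∞` otherwise
(Dirichlet case). -/
def dirichletEnergy {d : ℕ} (F : E d → ℝ≥0∞) (Ω : Set (E d)) (g : E d → ℝ) (u : L1 Ω) : ℝ≥0∞ :=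
  ⨅ (G : E d → E d) (_ : IsW11Gradient Ω u G ∧ MemW11Zero Ω (fun x => u x - g x)),
    ∫⁻ x in Ω, F (G x)

/-- The function `g ∈ W^{1,1}(Ω)` satisfies `∫_Ω F(t Dg) < +∞` for some `t > 1`. -/
def IsAdmissibleDatum {d : ℕ} (F : E d → ℝ≥0∞) (Ω : Set (E d)) (g : E d → ℝ) : Prop :=
  ∃ G : E d → E d, IsW11Gradient Ω g G ∧ ∃ t : ℝ, 1 < t ∧ ∫⁻ x in Ω, F (t • G x) < ⊤

/-- The subdifferential `∂Φ(u) ⊆ L^∞(Ω)` of a functional on `L¹(Ω)`. -/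
def subdifferential {d : ℕ} {Ω : Set (E d)} (Φ : L1 Ω → ℝ≥0∞) (u : L1 Ω) : Set (LInf Ω) :=
  {q | Φ u ≠ ⊤ ∧ ∀ v : L1 Ω,
    (Φ u : EReal) + ((∫ x in Ω, q x * (v x - u x) : ℝ) : EReal) ≤ (Φ v : EReal)}

/-- The norm `‖∂⁰Φ(u)‖_∞` of the elements of minimal norm of `∂Φ(u)`. -/
def minSubgradientNorm {d : ℕ} {Ω : Set (E d)} (Φ : L1 Ω → ℝ≥0∞) (u : L1 Ω) : ℝ≥0∞ :=
  ⨅ q ∈ subdifferential Φ u, ‖q‖ₑ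

/-! ### Minimizing movements -/

/-- `(U n)` is a discrete flow with time step `τ` starting from `u₀`: `U (n + 1)` minimizes
`Φ(w) + ‖w - U n‖₁² / (2 τ)` among all `w ∈ L¹(Ω)`. -/
def IsDiscreteFlow {d : ℕ} {Ω : Set (E d)} (Φ : L1 Ω → ℝ≥0∞) (u₀ : L1 Ω) (τ : ℝ)
    (U : ℕ → L1 Ω) : Prop :=
  U 0 = u₀ ∧ ∀ (n : ℕ) (w : L1 Ω),
    Φ (U (n + 1)) + ENNReal.ofReal (‖U (n + 1) - U n‖ ^ 2 / (2 * τ)) ≤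
      Φ w + ENNReal.ofReal (‖w - U n‖ ^ 2 / (2 * τ))

/-- `u ∈ C⁰([0, +∞); L¹(Ω))` is a limit of minimizing movements starting from `u₀`: for some time
steps `τ k → 0` and some discrete flows, the piecewise constant interpolants
`t ↦ U k ⌊t / τ k⌋` converge to `u` uniformly on `[0, T]`, for all `T > 0`. -/
def IsLimitFlow {d : ℕ} {Ω : Set (E d)} (Φ : L1 Ω → ℝ≥0∞) (u₀ : L1 Ω) (u : ℝ → L1 Ω) : Prop :=
  ContinuousOn u (Ici 0) ∧
    ∃ (τ : ℕ → ℝ) (U : ℕ → ℕ → L1 Ω), (∀ k, 0 < τ k) ∧ Tendsto τ atTop (𝓝 0) ∧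
      (∀ k, IsDiscreteFlow Φ u₀ (τ k) (U k)) ∧
      ∀ T : ℝ, 0 < T →
        TendstoUniformlyOn (fun k t => U k ⌊t / τ k⌋₊) u atTop (Icc 0 T)

/-! ### Functions of time and space -/

/-- `v` is the distributional time derivative of `u` in `(0, +∞) × Ω`. -/
def IsTimeDerivative {d : ℕ} {Ω : Set (E d)} (u : ℝ → L1 Ω) (v : ℝ × E d → ℝ) : Prop :=
  LocallyIntegrableOn v (Ioi 0 ×ˢ Ω) ∧
    ∀ φ : ℝ × E d → ℝ, IsTestFunction (Ioi 0 ×ˢ Ω) φ →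
      ∫ s in Ioi (0 : ℝ), ∫ x in Ω, u s x * deriv (fun r => φ (r, x)) s =
        - ∫ z in Ioi (0 : ℝ) ×ˢ Ω, v z * φ z

/-- `v ∈ L²((t, +∞); H¹(Ω))`, with spatial weak gradient `Dv`: both are measurable and square
integrable in `(t, +∞) × Ω`, and `Dv(s, ·)` is the weak gradient of `v(s, ·)` for a.e. `s > t`. -/
def MemL2H1 {d : ℕ} (Ω : Set (E d)) (t : ℝ) (v : ℝ × E d → ℝ) (Dv : ℝ × E d → E d) : Prop :=
  MemLp v 2 (volume.restrict (Ioi t ×ˢ Ω)) ∧ MemLp Dv 2 (volume.restrict (Ioi t ×ˢ Ω)) ∧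
    ∀ᵐ s ∂(volume.restrict (Ioi t)),
      IsWeakGradient Ω (fun x => v (s, x)) (fun x => Dv (s, x))

/-- The curve `u` solves `|div ∇F(Du)| ≤ ‖v‖₁` and `v div ∇F(Du) = |v| ‖v‖₁` a.e. in
`(0, +∞) × Ω`, where `v` stands for the time derivative of `u` and the divergence is taken in the
sense of distributions in `Ω`. -/
def SolvesNonlocalEquation {d : ℕ} {Ω : Set (E d)} (f : E d → ℝ) (u : ℝ → L1 Ω)
    (v : ℝ × E d → ℝ) : Prop :=
  ∃ (Du : ℝ × E d → E d) (w : ℝ × E d → ℝ),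
    AEStronglyMeasurable Du (volume.restrict (Ioi 0 ×ˢ Ω)) ∧
    AEStronglyMeasurable w (volume.restrict (Ioi 0 ×ˢ Ω)) ∧
    (∀ᵐ s ∂(volume.restrict (Ioi (0 : ℝ))),
      IsW11Gradient Ω (u s) (fun x => Du (s, x)) ∧
      IsWeakDivergence Ω (fun x => gradient f (Du (s, x))) (fun x => w (s, x))) ∧
    (∀ᵐ z ∂(volume.restrict (Ioi (0 : ℝ) ×ˢ Ω)),
      |w z| ≤ (∫ y in Ω, |v (z.1, y)|) ∧
      v z * w z = |v z| * ∫ y in Ω, |v (z.1, y)|)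

end L1Flow

end

namespace L1Flow

/-! ### Strong convexity of the integrand along segments. -/

section Integrand

variable {d : ℕ} {F : E d → ℝ≥0∞}

/-! Everything is read off the discrete scheme. Minimality of `U (n + 1)` yields a subgradient `l n`
of `Φ` at `U (n + 1)` which is dual to minus the velocity: with `m n = ‖U (n + 1) - U n‖ / τ`, one
has `‖l n‖ ≤ m n` and `l n (U (n + 1) - U n) = -τ (m n)²` (`exists_isSubgrad_of_minimizer`). The
`γ`-convexity of `F` makes the subdifferential monotone with the gain `γ ‖D(w - u)‖²`
(`IsSubgrad.monotone`). Testing the subgradients of two successive steps with the increment gives `½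
(m n)² + γ τ ‖D vel‖² ≤ ½ ‖k‖²` for every subgradient `k` at `U n` (`IsFlowData.half_step`). Taking
`k = l (n - 1)`, the speeds decrease and the squared gradients of the velocities sum up to at most
`½ ‖k‖²`: this is the second estimate. Since the dissipated energy `∑ τ m²` is at most `Φ(u⁰)` and
`m` decreases, `(n + 1) τ (m n)² ≤ Φ(u⁰)` (`IsFlowData.m_sq_le`), and the same sum started at time
`t` gives the first estimate.

To pass to the limit, velocities and their gradients are bounded in a space `L²((0, ∞) × Ω)`
weighted in time, thanks to an `L²` embedding on Lipschitz domains (`exists_embedding_constant`). A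
weak limit along an ultrafilter is a pair `(v, Dv)` (`exists_velocity`); it inherits the bounds by
weak lower semicontinuity, and `v` is the time derivative of `u` by discrete summation by parts.

For the equation, let `M(s)` be the limit of the speeds along the ultrafilter. A weak limit `Q` of
the discrete subgradients is, at almost every time, a subgradient of `Φ` at `u(s)` with `|Q(s)| ≤
M(s)` (`exists_subgradient_field`). The energies converge, so that `Φ(u(s')) + (s' - s) M(s')² ≤
Φ(u(s))` (`dissipation`). At almost every `s` the curve has a right derivative `V = v(s)` in `L¹`,
and `‖V‖₁ ≤ M`, `M² ≤ -∫ Q V ≤ M ‖V‖₁`. Hence `M = ‖V‖₁` and the last inequality is an equality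
almost everywhere in `Ω`, that is `-Q V = |V| ‖V‖₁`. When `F` is finite and `C¹`, the Euler–Lagrange
equation identifies `-Q` with `div ∇F(Du)` (`isWeakDivergence_of_isSubgrad`). -/

lemma exists_proximal_point (hF : LowerSemicontinuous F) {x : E d} (hx : F x ≠ ⊤)
    {l : ℝ} (hl : 0 < l) :
    ∃ y, ∀ z, F y + ENNReal.ofReal (‖y - x‖ ^ 2 / (2 * l)) ≤
      F z + ENNReal.ofReal (‖z - x‖ ^ 2 / (2 * l)) := by
  set g : E d → ℝ≥0∞ := fun z => F z + ENNReal.ofReal (‖z - x‖ ^ 2 / (2 * l)) with hg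
  have hgl : LowerSemicontinuous g := by
    refine hF.add ?_
    exact (ENNReal.continuous_ofReal.comp (by fun_prop)).lowerSemicontinuous
  -- Beyond this radius the quadratic term alone exceeds `F x`, the value of `g` at `x`.
  set R : ℝ := Real.sqrt (2 * l * (F x).toReal) with hR
  obtain ⟨y, hy, hmin⟩ := LowerSemicontinuousOn.exists_isMinOn (s := Metric.closedBall x R)
    ⟨x, Metric.mem_closedBall_self (Real.sqrt_nonneg _)⟩ (isCompact_closedBall x R)
    (hgl.lowerSemicontinuousOn _)
  refine ⟨y, fun z => ?_⟩
  by_cases hz : z ∈ Metric.closedBall x R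
  · exact hmin hz
  · have h1 : g y ≤ g x := hmin (Metric.mem_closedBall_self (Real.sqrt_nonneg _))
    refine h1.trans ?_
    have h2 : g x = F x := by simp [hg]
    rw [h2]
    refine le_trans ?_ le_add_self
    rw [← ENNReal.ofReal_toReal hx]
    refine ENNReal.ofReal_le_ofReal ?_
    rw [Metric.mem_closedBall, not_le, dist_eq_norm] at hz
    have := (Real.sqrt_lt' (lt_of_le_of_lt (Real.sqrt_nonneg _) hz)).1 hz
    rw [le_div_iff₀ (by positivity)]
    linarith

lemma toReal_convex (hF_conv : ConvexOn ℝ≥0 univ F) {ξ η : E d} (hξ : F ξ ≠ ⊤) (hη : F η ≠ ⊤)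
    {t : ℝ} (ht0 : 0 ≤ t) (ht1 : t ≤ 1) :
    F ((1 - t) • ξ + t • η) ≠ ⊤ ∧
      (F ((1 - t) • ξ + t • η)).toReal ≤ (1 - t) * (F ξ).toReal + t * (F η).toReal := by
  lift t to ℝ≥0 using ht0
  have ht1' : t ≤ 1 := by exact_mod_cast ht1
  have h := hF_conv.2 (mem_univ ξ) (mem_univ η) (zero_le (a := 1 - t)) (zero_le (a := t))
    (tsub_add_cancel_of_le ht1')
  have e : ((1 - t : ℝ≥0) : ℝ) = 1 - (t : ℝ) := by simp [NNReal.coe_sub ht1']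
  have h' : F ((1 - (t : ℝ)) • ξ + (t : ℝ) • η) ≤ ((1 - t : ℝ≥0) : ℝ≥0∞) * F ξ + (t : ℝ≥0∞) * F η := by
    rw [← e]; exact h
  have hfin : ((1 - t : ℝ≥0) : ℝ≥0∞) * F ξ + (t : ℝ≥0∞) * F η ≠ ⊤ := by
    finiteness
  refine ⟨ne_top_of_le_ne_top hfin h', ?_⟩
  have h2 := ENNReal.toReal_mono hfin h'
  rw [ENNReal.toReal_add (by finiteness) (by finiteness), ENNReal.toReal_mul,
    ENNReal.toReal_mul, ENNReal.coe_toReal, ENNReal.coe_toReal, e] at h2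
  exact h2

/-- First-order optimality: `y` is compared with the points of the segment from `y` to `η`. After
division by `t`, the quadratic term leaves an error of order `t`, which vanishes as `t → 0`. -/
lemma isSubgradient_proximal_point (hF_conv : ConvexOn ℝ≥0 univ F) {x y : E d} {l : ℝ}
    (hl : 0 < l) (hx : F x ≠ ⊤)
    (hy : ∀ z, F y + ENNReal.ofReal (‖y - x‖ ^ 2 / (2 * l)) ≤
      F z + ENNReal.ofReal (‖z - x‖ ^ 2 / (2 * l))) :
    IsSubgradient F y (l⁻¹ • (x - y)) := by
  have hyt : F y ≠ ⊤ := by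
    have := hy x
    intro h
    simp [h] at this
    exact hx this
  refine ⟨hyt, fun η => ?_⟩
  by_cases hη : F η = ⊤
  · simp [hη]
  have key : ∀ t : ℝ, 0 < t → t ≤ 1 →
      (F y).toReal + inner ℝ (l⁻¹ • (x - y)) (η - y) ≤
        (F η).toReal + t * (‖η - y‖ ^ 2 / (2 * l)) := by
    intro t ht0 ht1
    obtain ⟨h1, h2⟩ := toReal_convex hF_conv hyt hη ht0.le ht1
    have h3 := hy ((1 - t) • y + t • η)
    have h4 := ENNReal.toReal_mono (by finiteness) h3
    rw [ENNReal.toReal_add hyt (by finiteness), ENNReal.toReal_add h1 (by finiteness),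
      ENNReal.toReal_ofReal (by positivity), ENNReal.toReal_ofReal (by positivity)] at h4
    have e1 : (1 - t) • y + t • η - x = (y - x) + t • (η - y) := by module
    rw [e1, norm_add_sq_real, inner_smul_right, norm_smul, mul_pow, Real.norm_eq_abs, sq_abs] at h4
    have e2 : inner ℝ (l⁻¹ • (x - y)) (η - y) = - (l⁻¹ * inner ℝ (y - x) (η - y)) := by
      rw [inner_smul_left, ← neg_sub y x, inner_neg_left]; simp
    rw [e2]
    have h5 : t * (F y).toReal ≤ t * ((F η).toReal + t * (‖η - y‖ ^ 2 / (2 * l)) +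
        l⁻¹ * inner ℝ (y - x) (η - y)) := by
      have e3 : (‖y - x‖ ^ 2 + 2 * (t * inner ℝ (y - x) (η - y)) + t ^ 2 * ‖η - y‖ ^ 2) / (2 * l)
        = ‖y - x‖ ^ 2 / (2 * l) + t * (l⁻¹ * inner ℝ (y - x) (η - y)) +
          t * (t * (‖η - y‖ ^ 2 / (2 * l))) := by
        field_simp
      rw [e3] at h4
      linarith
    have := le_of_mul_le_mul_left h5 ht0
    linarith
  have hlim : (F y).toReal + inner ℝ (l⁻¹ • (x - y)) (η - y) ≤ (F η).toReal := by
    refine le_of_forall_pos_le_add fun ε hε => ?_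
    set c := ‖η - y‖ ^ 2 / (2 * l)
    have hc : 0 ≤ c := by positivity
    have h1 := key (min 1 (ε / (c + 1))) (by positivity) (min_le_left _ _)
    have h2 : min 1 (ε / (c + 1)) * c ≤ ε := by
      calc min 1 (ε / (c + 1)) * c ≤ ε / (c + 1) * (c + 1) := by
            gcongr
            · exact min_le_right _ _
            · linarith
        _ = ε := by field_simp
    linarith
  have e : ∀ a : ℝ≥0∞, a ≠ ⊤ → (a : EReal) = ((a.toReal : ℝ) : EReal) := by
    intro a ha
    exact (EReal.coe_ennreal_toReal ha).symm
  rw [e _ hyt, e _ hη]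
  exact_mod_cast hlim

/-- `γ`-convexity says nothing at points without subgradients, and the intermediate point `x` may be
one of them. The proximal points `y n` of `x` carry subgradients and converge to `x`: the
inequalities based at `y n` are combined there, and lower semicontinuity of `F` at `x` concludes. -/
lemma toReal_strongly_convex (hF_conv : ConvexOn ℝ≥0 univ F) (hF_lsc : LowerSemicontinuous F)
    {γ : ℝ} (hF : IsGammaConvex γ F) {ξ η : E d} (hξ : F ξ ≠ ⊤) (hη : F η ≠ ⊤)
    {t : ℝ} (ht0 : 0 ≤ t) (ht1 : t ≤ 1) :
    (F ((1 - t) • ξ + t • η)).toReal + γ / 2 * (t * (1 - t)) * ‖ξ - η‖ ^ 2 ≤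
      (1 - t) * (F ξ).toReal + t * (F η).toReal := by
  set x := (1 - t) • ξ + t • η with hx
  obtain ⟨hxt, -⟩ := toReal_convex hF_conv hξ hη ht0 ht1
  rw [← hx] at hxt
  choose y hy using fun n : ℕ => exists_proximal_point hF_lsc hxt (l := 1 / ((n : ℝ) + 1)) (by positivity)
  have hyt : ∀ n, F (y n) ≠ ⊤ := fun n =>
    (isSubgradient_proximal_point hF_conv (by positivity) hxt (hy n)).1
  have hreal : ∀ n, ∀ z, F z ≠ ⊤ → (F (y n)).toReal + inner ℝ ((1 / ((n : ℝ) + 1))⁻¹ • (x - y n)) (z - y n)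
      + γ / 2 * ‖z - y n‖ ^ 2 ≤ (F z).toReal := by
    intro n z hz
    have := hF (y n) z _ (isSubgradient_proximal_point hF_conv (by positivity) hxt (hy n))
    rw [← EReal.coe_ennreal_toReal hz, ← EReal.coe_ennreal_toReal (hyt n)] at this
    have h2 : (F (y n)).toReal + (inner ℝ ((1 / ((n : ℝ) + 1))⁻¹ • (x - y n)) (z - y n)
      + γ / 2 * ‖z - y n‖ ^ 2) ≤ (F z).toReal := by exact_mod_cast this
    linarith
  have hcomb : ∀ n, (F (y n)).toReal + γ / 2 * ((1 - t) * ‖ξ - y n‖ ^ 2 + t * ‖η - y n‖ ^ 2) ≤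
      (1 - t) * (F ξ).toReal + t * (F η).toReal := by
    intro n
    have h1 := mul_le_mul_of_nonneg_left (hreal n ξ hξ) (sub_nonneg.2 ht1)
    have h2 := mul_le_mul_of_nonneg_left (hreal n η hη) ht0
    set p := (1 / ((n : ℝ) + 1))⁻¹ • (x - y n) with hp
    -- The linear terms combine to `p · (x - y n)`, which is nonnegative since `p` is a positive
    -- multiple of `x - y n`, and can be dropped.
    have h3 : (1 - t) * inner ℝ p (ξ - y n) + t * inner ℝ p (η - y n) = inner ℝ p (x - y n) := by
      rw [← inner_smul_right, ← inner_smul_right, ← inner_add_right]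
      congr 1
      rw [hx]; module
    have h4 : 0 ≤ inner ℝ p (x - y n) := by
      rw [hp, inner_smul_left]
      exact mul_nonneg (by simp; positivity) real_inner_self_nonneg
    nlinarith
  have hlim : Tendsto y atTop (𝓝 x) := by
    rw [tendsto_iff_norm_sub_tendsto_zero]
    have hb : ∀ n, ‖y n - x‖ ^ 2 ≤ 2 * (F x).toReal * (1 / ((n : ℝ) + 1)) := by
      intro n
      have h1 := le_trans le_add_self (hy n x)
      simp only [sub_self, norm_zero] at h1
      have h2 := ENNReal.toReal_mono (by finiteness) h1
      rw [ENNReal.toReal_ofReal (by positivity)] at h2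
      simp at h2
      rw [div_le_iff₀ (by positivity)] at h2
      calc _ ≤ _ := h2
        _ = _ := by ring
    have hb0 : Tendsto (fun n => ‖y n - x‖ ^ 2) atTop (𝓝 0) := by
      refine squeeze_zero (fun n => by positivity) hb ?_
      simpa using tendsto_one_div_add_atTop_nhds_zero_nat.const_mul (2 * (F x).toReal)
    have := (Real.continuous_sqrt.tendsto 0).comp hb0
    simpa [Function.comp_def, Real.sqrt_sq] using this
  have hlimit : Tendsto (fun n => γ / 2 * ((1 - t) * ‖ξ - y n‖ ^ 2 + t * ‖η - y n‖ ^ 2)) atTop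
      (𝓝 (γ / 2 * ((1 - t) * ‖ξ - x‖ ^ 2 + t * ‖η - x‖ ^ 2))) := by
    have : Continuous fun z => γ / 2 * ((1 - t) * ‖ξ - z‖ ^ 2 + t * ‖η - z‖ ^ 2) := by fun_prop
    exact (this.tendsto x).comp hlim
  have hval : γ / 2 * ((1 - t) * ‖ξ - x‖ ^ 2 + t * ‖η - x‖ ^ 2) =
      γ / 2 * (t * (1 - t)) * ‖ξ - η‖ ^ 2 := by
    have e1 : ξ - x = t • (ξ - η) := by rw [hx]; module
    have e2 : η - x = (-(1 - t)) • (ξ - η) := by rw [hx]; module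
    rw [e1, e2, norm_smul, norm_smul, mul_pow, mul_pow, Real.norm_eq_abs, Real.norm_eq_abs, sq_abs,
      sq_abs]
    ring
  rw [hval] at hlimit
  refine le_of_forall_pos_le_add fun ε hε => ?_
  -- Lower semicontinuity is used at the level `F x - ε`, which `ENNReal.ofReal` would truncate if
  -- it were negative.
  by_cases hpos : (F x).toReal < ε
  · have h0 := le_of_tendsto' hlimit
      (fun n => (show _ ≤ (1 - t) * (F ξ).toReal + t * (F η).toReal by
        linarith [hcomb n, ENNReal.toReal_nonneg (a := F (y n))]))
    linarith
  · have hc : ENNReal.ofReal ((F x).toReal - ε) < F x := by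
      rw [← ENNReal.ofReal_toReal hxt, ENNReal.toReal_ofReal ENNReal.toReal_nonneg]
      exact (ENNReal.ofReal_lt_ofReal_iff (by linarith)).2 (by linarith)
    have hev := hlim.eventually (hF_lsc x _ hc)
    have : γ / 2 * (t * (1 - t)) * ‖ξ - η‖ ^ 2 ≤
        (1 - t) * (F ξ).toReal + t * (F η).toReal - ((F x).toReal - ε) := by
      refine le_of_tendsto hlimit ?_
      filter_upwards [hev] with n hn
      have h1 := ENNReal.toReal_mono (hyt n) hn.le
      rw [ENNReal.toReal_ofReal (by linarith)] at h1
      linarith [hcomb n]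
    linarith

/-- Strong convexity of a `γ`-convex integrand along segments. -/
lemma strongly_convex (hF_conv : ConvexOn ℝ≥0 univ F) (hF_lsc : LowerSemicontinuous F)
    {γ : ℝ} (hγ : 0 < γ) (hF : IsGammaConvex γ F) (ξ η : E d) {t : ℝ} (ht0 : 0 < t) (ht1 : t < 1) :
    F ((1 - t) • ξ + t • η) + ENNReal.ofReal (γ / 2 * (t * (1 - t))) * ‖ξ - η‖ₑ ^ 2 ≤
      ENNReal.ofReal (1 - t) * F ξ + ENNReal.ofReal t * F η := by
  have hs : 0 < 1 - t := by linarith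
  by_cases hξ : F ξ = ⊤
  · rw [hξ, ENNReal.mul_top (by simpa using hs), top_add]; exact le_top
  by_cases hη : F η = ⊤
  · rw [hη, ENNReal.mul_top (by simpa using ht0), add_top]; exact le_top
  have h1 := toReal_strongly_convex hF_conv hF_lsc hF hξ hη ht0.le ht1.le
  obtain ⟨h2, -⟩ := toReal_convex hF_conv hξ hη ht0.le ht1.le
  rw [← ENNReal.ofReal_toReal hξ, ← ENNReal.ofReal_toReal hη, ← ENNReal.ofReal_toReal h2,
    ← ofReal_norm, ← ENNReal.ofReal_pow (norm_nonneg _), ← ENNReal.ofReal_mul (by positivity),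
    ← ENNReal.ofReal_mul hs.le, ← ENNReal.ofReal_mul ht0.le,
    ← ENNReal.ofReal_add (by positivity) (by positivity),
    ← ENNReal.ofReal_add (by positivity) (by positivity)]
  exact ENNReal.ofReal_le_ofReal h1

/-- Since `F ≥ 0 = F 0`, the zero vector is a subgradient at `0`. -/
lemma quadratic_growth (hF_zero : F 0 = 0) {γ : ℝ} (hγ : 0 < γ) (hF : IsGammaConvex γ F) (ξ : E d) :
    ENNReal.ofReal (γ / 2) * ‖ξ‖ₑ ^ 2 ≤ F ξ := by
  have h0 : IsSubgradient F 0 0 := ⟨by simp [hF_zero], fun η => by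
    simpa [hF_zero] using EReal.coe_ennreal_nonneg _⟩
  have := hF 0 ξ 0 h0
  simp only [hF_zero, sub_zero, inner_zero_left, zero_add] at this
  rw [← ofReal_norm, ← ENNReal.ofReal_pow (norm_nonneg _), ← ENNReal.ofReal_mul (by positivity)]
  rw [EReal.coe_ennreal_zero, zero_add] at this
  by_cases hξ : F ξ = ⊤
  · simp [hξ]
  rw [← EReal.coe_ennreal_toReal hξ] at this
  rw [← ENNReal.ofReal_toReal hξ]
  exact ENNReal.ofReal_le_ofReal (by exact_mod_cast this)

end Integrand

/-! ### Test functions and calculus of weak gradients. -/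

section WeakGradient

variable {d : ℕ} {Ω : Set (E d)}

lemma IsTestFunction.continuous {V : Type*} [NormedAddCommGroup V] [NormedSpace ℝ V] {U : Set V}
    {φ : V → ℝ} (h : IsTestFunction U φ) : Continuous φ := h.1.continuous

lemma IsTestFunction.differentiable {V : Type*} [NormedAddCommGroup V] [NormedSpace ℝ V] {U : Set V}
    {φ : V → ℝ} (h : IsTestFunction U φ) : Differentiable ℝ φ :=
  h.1.differentiable (by simp)

lemma IsTestFunction.exists_bound {V : Type*} [NormedAddCommGroup V] [NormedSpace ℝ V] {U : Set V}
    {φ : V → ℝ} (h : IsTestFunction U φ) : ∃ C, ∀ x, ‖φ x‖ ≤ C :=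
  h.2.1.exists_bound_of_continuous h.continuous

lemma continuous_gradient_of_contDiff {φ : E d → ℝ} (h : ContDiff ℝ 1 φ) :
    Continuous (gradient φ) :=
  (InnerProductSpace.toDual ℝ (E d)).symm.continuous.comp (h.continuous_fderiv (by simp))

lemma IsTestFunction.continuous_gradient {φ : E d → ℝ} (h : IsTestFunction Ω φ) :
    Continuous (gradient φ) := continuous_gradient_of_contDiff (h.1.of_le (by simp))

lemma support_gradient_subset (φ : E d → ℝ) : Function.support (gradient φ) ⊆ tsupport φ := by
  intro x hx
  apply support_fderiv_subset ℝ (f := φ)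
  rw [Function.mem_support] at hx ⊢
  intro h; apply hx
  simp [gradient, h]

lemma IsTestFunction.hasCompactSupport_gradient {φ : E d → ℝ} (h : IsTestFunction Ω φ) :
    HasCompactSupport (gradient φ) :=
  h.2.1.mono' (support_gradient_subset φ)

lemma IsTestFunction.exists_bound_gradient {φ : E d → ℝ} (h : IsTestFunction Ω φ) :
    ∃ C, ∀ x, ‖gradient φ x‖ ≤ C :=
  h.hasCompactSupport_gradient.exists_bound_of_continuous h.continuous_gradient

lemma IsTestFunction.add {V : Type*} [NormedAddCommGroup V] [NormedSpace ℝ V] {U : Set V}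
    {φ ψ : V → ℝ} (h : IsTestFunction U φ) (h' : IsTestFunction U ψ) :
    IsTestFunction U (fun x => φ x + ψ x) :=
  ⟨h.1.add h'.1, h.2.1.add h'.2.1, (tsupport_add φ ψ).trans (union_subset h.2.2 h'.2.2)⟩

lemma IsTestFunction.const_mul {V : Type*} [NormedAddCommGroup V] [NormedSpace ℝ V] {U : Set V}
    {φ : V → ℝ} (h : IsTestFunction U φ) (c : ℝ) :
    IsTestFunction U (fun x => c * φ x) :=
  ⟨contDiff_const.mul h.1, h.2.1.mul_left, (tsupport_mul_subset_right).trans h.2.2⟩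

lemma isTestFunction_zero {V : Type*} [NormedAddCommGroup V] [NormedSpace ℝ V] (U : Set V) :
    IsTestFunction U (fun _ => 0) :=
  ⟨contDiff_const, HasCompactSupport.zero, by simp [tsupport]⟩

lemma gradient_add' {φ ψ : E d → ℝ} (h : Differentiable ℝ φ) (h' : Differentiable ℝ ψ) (x : E d) :
    gradient (fun x => φ x + ψ x) x = gradient φ x + gradient ψ x := by
  simp only [gradient]
  rw [fderiv_fun_add (h x) (h' x), map_add]

lemma gradient_const_mul' {φ : E d → ℝ} (h : Differentiable ℝ φ) (c : ℝ) (x : E d) :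
    gradient (fun x => c * φ x) x = c • gradient φ x := by
  simp only [gradient]
  rw [fderiv_const_mul (h x), map_smul]

lemma inner_gradient (φ : E d → ℝ) (x h : E d) : inner ℝ (gradient φ x) h = fderiv ℝ φ x h := by
  simp [gradient]

lemma IsTestFunction.integrable_smul_gradient {φ : E d → ℝ} (h : IsTestFunction Ω φ) {u : E d → ℝ}
    (hu : IntegrableOn u Ω) : IntegrableOn (fun x => u x • gradient φ x) Ω := by
  obtain ⟨C, hC⟩ := h.exists_bound_gradient
  exact Integrable.smul_bdd hu C h.continuous_gradient.aestronglyMeasurable (ae_of_all _ hC)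

lemma IsTestFunction.integrable_smul {V : Type*} [NormedAddCommGroup V] [NormedSpace ℝ V] {φ : E d → ℝ}
    (h : IsTestFunction Ω φ) {G : E d → V}
    (hG : IntegrableOn G Ω) : IntegrableOn (fun x => φ x • G x) Ω := by
  obtain ⟨C, hC⟩ := h.exists_bound
  exact Integrable.bdd_smul hG C h.continuous.aestronglyMeasurable (ae_of_all _ hC)

lemma isW11Gradient_iff {u : E d → ℝ} {G : E d → E d} :
    IsW11Gradient Ω u G ↔ IntegrableOn u Ω ∧ IntegrableOn G Ω ∧
      ∀ φ : E d → ℝ, IsTestFunction Ω φ →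
      ∫ x in Ω, u x • gradient φ x = - ∫ x in Ω, φ x • G x :=
  ⟨fun h => ⟨h.1, h.2.1, h.2.2.2.2⟩, fun h =>
    ⟨h.1, h.2.1, h.1.locallyIntegrableOn, h.2.1.locallyIntegrableOn, h.2.2⟩⟩

lemma IsW11Gradient.congr {u u' : E d → ℝ} {G G' : E d → E d} (h : IsW11Gradient Ω u G)
    (hu : u =ᵐ[volume.restrict Ω] u') (hG : G =ᵐ[volume.restrict Ω] G') :
    IsW11Gradient Ω u' G' := by
  rw [isW11Gradient_iff] at h ⊢
  refine ⟨h.1.congr hu, h.2.1.congr hG, fun φ hφ => ?_⟩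
  have e1 : ∫ x in Ω, u' x • gradient φ x = ∫ x in Ω, u x • gradient φ x :=
    integral_congr_ae (by filter_upwards [hu] with x hx; rw [hx])
  have e2 : ∫ x in Ω, φ x • G' x = ∫ x in Ω, φ x • G x :=
    integral_congr_ae (by filter_upwards [hG] with x hx; rw [hx])
  rw [e1, e2, h.2.2 φ hφ]

lemma IsW11Gradient.add {u v : E d → ℝ} {G H : E d → E d} (h : IsW11Gradient Ω u G)
    (h' : IsW11Gradient Ω v H) : IsW11Gradient Ω (fun x => u x + v x) (fun x => G x + H x) := by
  rw [isW11Gradient_iff] at h h' ⊢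
  refine ⟨h.1.add h'.1, h.2.1.add h'.2.1, fun φ hφ => ?_⟩
  simp only [add_smul, smul_add]
  rw [integral_add (hφ.integrable_smul_gradient h.1) (hφ.integrable_smul_gradient h'.1),
    integral_add (hφ.integrable_smul h.2.1) (hφ.integrable_smul h'.2.1), h.2.2 φ hφ, h'.2.2 φ hφ,
    neg_add]

lemma IsW11Gradient.const_smul {u : E d → ℝ} {G : E d → E d} (h : IsW11Gradient Ω u G) (c : ℝ) :
    IsW11Gradient Ω (fun x => c * u x) (fun x => c • G x) := by
  rw [isW11Gradient_iff] at h ⊢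
  refine ⟨h.1.const_mul c, h.2.1.smul c, fun φ hφ => ?_⟩
  simp only [mul_smul, smul_comm _ c]
  rw [integral_smul, integral_smul, h.2.2 φ hφ, smul_neg]

lemma IsW11Gradient.sub {u v : E d → ℝ} {G H : E d → E d} (h : IsW11Gradient Ω u G)
    (h' : IsW11Gradient Ω v H) : IsW11Gradient Ω (fun x => u x - v x) (fun x => G x - H x) := by
  have := h.add (h'.const_smul (-1))
  simpa [sub_eq_add_neg] using this

lemma isW11Gradient_zero : IsW11Gradient Ω (fun _ => 0) (fun _ => 0) := by
  rw [isW11Gradient_iff]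
  exact ⟨integrable_zero _ _ _, integrable_zero _ _ _, by simp⟩

/-- The difference of the gradients integrates to zero against all test functions, so it vanishes by
the fundamental lemma of the calculus of variations. -/
lemma IsW11Gradient.unique (hΩ : IsOpen Ω) {u : E d → ℝ} {G G' : E d → E d}
    (h : IsW11Gradient Ω u G) (h' : IsW11Gradient Ω u G') : G =ᵐ[volume.restrict Ω] G' := by
  rw [isW11Gradient_iff] at h h'
  have hint := h.2.1.sub h'.2.1
  have := hΩ.ae_eq_zero_of_integral_contDiff_smul_eq_zero (μ := volume) (f := fun x => G x - G' x)
    hint.locallyIntegrableOn ?_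
  · rw [EventuallyEq, ae_restrict_iff' hΩ.measurableSet]
    filter_upwards [this] with x hx hxΩ
    exact sub_eq_zero.1 (hx hxΩ)
  · intro φ h1 h2 h3
    have hφ : IsTestFunction Ω φ := ⟨h1, h2, h3⟩
    rw [← setIntegral_eq_integral_of_forall_compl_eq_zero (s := Ω)]
    · simp only [smul_sub]
      rw [integral_sub (hφ.integrable_smul h.2.1) (hφ.integrable_smul h'.2.1)]
      have := (h.2.2 φ hφ).symm.trans (h'.2.2 φ hφ)
      rw [neg_inj.1 this, sub_self]
    · intro x hx
      have : φ x = 0 := image_eq_zero_of_notMem_tsupport fun h => hx (h3 h)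
      simp [this]

/-- The graph of the weak gradient is closed in `L¹ × L¹`. -/
lemma IsW11Gradient.of_tendsto {u : E d → ℝ} {G : E d → E d} {un : ℕ → E d → ℝ}
    {Gn : ℕ → E d → E d} (h : ∀ n, IsW11Gradient Ω (un n) (Gn n))
    (hu : IntegrableOn u Ω) (hG : IntegrableOn G Ω)
    (hun : Tendsto (fun n => ∫⁻ x in Ω, ‖un n x - u x‖ₑ) atTop (𝓝 0))
    (hGn : Tendsto (fun n => ∫⁻ x in Ω, ‖Gn n x - G x‖ₑ) atTop (𝓝 0)) :
    IsW11Gradient Ω u G := by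
  simp only [isW11Gradient_iff] at h ⊢
  refine ⟨hu, hG, fun φ hφ => ?_⟩
  have bound : ∀ (a b : ℕ → ℝ≥0∞) (C : ℝ), Tendsto b atTop (𝓝 0) →
      (∀ n, a n ≤ ENNReal.ofReal C * b n) → Tendsto a atTop (𝓝 0) := by
    intro a b C hb hab
    refine tendsto_of_tendsto_of_tendsto_of_le_of_le tendsto_const_nhds ?_ (fun _ => zero_le) hab
    simpa using ENNReal.Tendsto.const_mul hb (Or.inr ENNReal.ofReal_ne_top)
  have t1 : Tendsto (fun n => ∫ x in Ω, un n x • gradient φ x) atTop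
      (𝓝 (∫ x in Ω, u x • gradient φ x)) := by
    obtain ⟨C, hC⟩ := hφ.exists_bound_gradient
    refine tendsto_integral_of_L1 _ (hφ.integrable_smul_gradient hu).aestronglyMeasurable
      (Eventually.of_forall fun n => hφ.integrable_smul_gradient (h n).1) ?_
    refine bound _ _ C hun fun n => ?_
    rw [← lintegral_const_mul' _ _ ENNReal.ofReal_ne_top]
    refine lintegral_mono fun x => ?_
    rw [← sub_smul, enorm_smul, mul_comm]
    gcongr
    rw [← ofReal_norm]
    exact ENNReal.ofReal_le_ofReal (hC x)
  have t2 : Tendsto (fun n => ∫ x in Ω, φ x • Gn n x) atTop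
      (𝓝 (∫ x in Ω, φ x • G x)) := by
    obtain ⟨C, hC⟩ := hφ.exists_bound
    refine tendsto_integral_of_L1 _ (hφ.integrable_smul hG).aestronglyMeasurable
      (Eventually.of_forall fun n => hφ.integrable_smul (h n).2.1) ?_
    refine bound _ _ C hGn fun n => ?_
    rw [← lintegral_const_mul' _ _ ENNReal.ofReal_ne_top]
    refine lintegral_mono fun x => ?_
    rw [← smul_sub, enorm_smul]
    gcongr
    rw [← ofReal_norm]
    exact ENNReal.ofReal_le_ofReal (hC x)
  refine tendsto_nhds_unique t1 ?_
  simp only [fun n => (h n).2.2 φ hφ]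
  exact t2.neg

lemma IsTestFunction.isW11Gradient {φ : E d → ℝ} (hφ : IsTestFunction Ω φ) :
    IsW11Gradient Ω φ (gradient φ) := by
  rw [isW11Gradient_iff]
  refine ⟨(hφ.continuous.integrable_of_hasCompactSupport hφ.2.1).integrableOn,
    (hφ.continuous_gradient.integrable_of_hasCompactSupport
      hφ.hasCompactSupport_gradient).integrableOn, fun ψ hψ => ?_⟩
  have out : ∀ {χ : E d → ℝ}, IsTestFunction Ω χ → ∀ x ∉ Ω, χ x = 0 := fun hχ x hx =>
    image_eq_zero_of_notMem_tsupport fun h => hx (hχ.2.2 h)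
  rw [setIntegral_eq_integral_of_forall_compl_eq_zero (fun x hx => by simp [out hφ x hx]),
    setIntegral_eq_integral_of_forall_compl_eq_zero (fun x hx => by simp [out hψ x hx])]
  have i1 : Integrable (fun x => φ x • gradient ψ x) :=
    (hφ.continuous.smul hψ.continuous_gradient).integrable_of_hasCompactSupport
      hφ.2.1.smul_right
  have i2 : Integrable (fun x => ψ x • gradient φ x) :=
    (hψ.continuous.smul hφ.continuous_gradient).integrable_of_hasCompactSupport
      hψ.2.1.smul_right
  refine ext_inner_right ℝ fun h => ?_
  rw [inner_neg_left, real_inner_comm, real_inner_comm h, ← integral_inner i1, ← integral_inner i2]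
  have e : ∀ χ : E d → ℝ, ∀ x, inner ℝ h (gradient χ x) = fderiv ℝ χ x h := fun χ x => by
    rw [real_inner_comm, inner_gradient]
  simp only [inner_smul_right, e]
  have := integral_mul_fderiv_eq_neg_fderiv_mul_of_integrable (μ := (volume : Measure (E d)))
    (f := φ) (g := ψ) (v := h) ?_ ?_ ?_ (fun x _ => hφ.differentiable x) (fun x _ => hψ.differentiable x)
  · rw [this]; congr 1; exact integral_congr_ae (ae_of_all _ fun x => mul_comm _ _)
  · have := i2.inner_const (𝕜 := ℝ) h
    simpa [inner_smul_left, inner_gradient, mul_comm] using this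
  · have := i1.inner_const (𝕜 := ℝ) h
    simpa [inner_smul_left, inner_gradient, mul_comm] using this
  · exact (hφ.continuous.mul hψ.continuous).integrable_of_hasCompactSupport hφ.2.1.mul_right

end WeakGradient

/-! ### The space of functions with zero trace is linear and closed. -/

section ZeroTrace

variable {d : ℕ} {Ω : Set (E d)}

lemma MemW11Zero.congr {u v : E d → ℝ} (h : MemW11Zero Ω u) (huv : u =ᵐ[volume.restrict Ω] v) :
    MemW11Zero Ω v := by
  obtain ⟨G, hG, φ, hφ, h1, h2⟩ := h
  refine ⟨G, hG.congr huv (EventuallyEq.refl _ _), φ, hφ, ?_, h2⟩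
  refine h1.congr fun n => lintegral_congr_ae ?_
  filter_upwards [huv] with x hx
  rw [hx]

lemma tendsto_lintegral_enorm_of_le {α V : Type*} [MeasurableSpace α] {μ : Measure α}
    [SeminormedAddCommGroup V] {f : ℕ → α → V} {g h : ℕ → α → ℝ≥0∞}
    (hg : Tendsto (fun n => ∫⁻ x, g n x ∂μ) atTop (𝓝 0))
    (hh : Tendsto (fun n => ∫⁻ x, h n x ∂μ) atTop (𝓝 0)) (hgm : ∀ n, AEMeasurable (g n) μ)
    (hle : ∀ n x, ‖f n x‖ₑ ≤ g n x + h n x) :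
    Tendsto (fun n => ∫⁻ x, ‖f n x‖ₑ ∂μ) atTop (𝓝 0) := by
  refine tendsto_of_tendsto_of_tendsto_of_le_of_le tendsto_const_nhds (by simpa using hg.add hh)
    (fun _ => zero_le) fun n => ?_
  rw [← lintegral_add_left' (hgm n)]
  exact lintegral_mono (hle n)

lemma MemW11Zero.add {u v : E d → ℝ} (hu : MemW11Zero Ω u) (hv : MemW11Zero Ω v) :
    MemW11Zero Ω (fun x => u x + v x) := by
  obtain ⟨G, hG, φ, hφ, h1, h2⟩ := hu
  obtain ⟨H, hH, ψ, hψ, h3, h4⟩ := hv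
  refine ⟨_, hG.add hH, fun n x => φ n x + ψ n x, fun n => (hφ n).add (hψ n), ?_, ?_⟩
  · refine tendsto_lintegral_enorm_of_le h1 h3 (fun n => ?_) fun n x => ?_
    · exact ((hφ n).continuous.aestronglyMeasurable.sub hG.1.aestronglyMeasurable).enorm
    · rw [add_sub_add_comm]; exact enorm_add_le _ _
  · refine tendsto_lintegral_enorm_of_le h2 h4 (fun n => ?_) fun n x => ?_
    · exact ((hφ n).continuous_gradient.aestronglyMeasurable.sub hG.2.1.aestronglyMeasurable).enorm
    · rw [gradient_add' (hφ n).differentiable (hψ n).differentiable, add_sub_add_comm]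
      exact enorm_add_le _ _

lemma MemW11Zero.const_mul {u : E d → ℝ} (hu : MemW11Zero Ω u) (c : ℝ) :
    MemW11Zero Ω (fun x => c * u x) := by
  obtain ⟨G, hG, φ, hφ, h1, h2⟩ := hu
  refine ⟨_, hG.const_smul c, fun n x => c * φ n x, fun n => (hφ n).const_mul c, ?_, ?_⟩
  · have : Tendsto (fun n => ‖c‖ₑ * ∫⁻ x in Ω, ‖φ n x - u x‖ₑ) atTop (𝓝 0) := by
      simpa using ENNReal.Tendsto.const_mul h1 (Or.inr (by simp))
    refine this.congr fun n => ?_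
    rw [← lintegral_const_mul' _ _ (by simp)]
    simp [← mul_sub, enorm_mul]
  · have : Tendsto (fun n => ‖c‖ₑ * ∫⁻ x in Ω, ‖gradient (φ n) x - G x‖ₑ) atTop (𝓝 0) := by
      simpa using ENNReal.Tendsto.const_mul h2 (Or.inr (by simp))
    refine this.congr fun n => ?_
    rw [← lintegral_const_mul' _ _ (by simp)]
    refine lintegral_congr fun x => ?_
    rw [gradient_const_mul' (hφ n).differentiable, ← smul_sub, enorm_smul]

lemma IsTestFunction.memW11Zero {φ : E d → ℝ} (hφ : IsTestFunction Ω φ) : MemW11Zero Ω φ :=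
  ⟨_, hφ.isW11Gradient, fun _ => φ, fun _ => hφ, by simp, by simp⟩

/-- Diagonal argument: `un n` is replaced by a test function at distance less than `1 / (n + 1)`.
The gradient hidden in `MemW11Zero` is identified with `Gn n` by uniqueness of weak gradients. -/
lemma MemW11Zero.of_tendsto (hΩ : IsOpen Ω) {u : E d → ℝ} {G : E d → E d} {un : ℕ → E d → ℝ}
    {Gn : ℕ → E d → E d} (h0 : ∀ n, MemW11Zero Ω (un n))
    (h : ∀ n, IsW11Gradient Ω (un n) (Gn n)) (hG : IsW11Gradient Ω u G)
    (hun : Tendsto (fun n => ∫⁻ x in Ω, ‖un n x - u x‖ₑ) atTop (𝓝 0))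
    (hGn : Tendsto (fun n => ∫⁻ x in Ω, ‖Gn n x - G x‖ₑ) atTop (𝓝 0)) :
    MemW11Zero Ω u := by
  have key : ∀ n : ℕ, ∃ φ, IsTestFunction Ω φ ∧
      ∫⁻ x in Ω, ‖φ x - un n x‖ₑ < ((n : ℝ≥0∞) + 1)⁻¹ ∧
      ∫⁻ x in Ω, ‖gradient φ x - Gn n x‖ₑ < ((n : ℝ≥0∞) + 1)⁻¹ := by
    intro n
    obtain ⟨H, hH, φ, hφ, h1, h2⟩ := h0 n
    have hpos : (0 : ℝ≥0∞) < ((n : ℝ≥0∞) + 1)⁻¹ := by simp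
    obtain ⟨m, hm1, hm2⟩ := ((h1.eventually (gt_mem_nhds hpos)).and
      (h2.eventually (gt_mem_nhds hpos))).exists
    refine ⟨φ m, hφ m, hm1, ?_⟩
    refine lt_of_le_of_lt (le_of_eq (lintegral_congr_ae ?_)) hm2
    filter_upwards [(h n).unique hΩ hH] with x hx
    rw [hx]
  choose φ hφ h1 h2 using key
  have hlim : Tendsto (fun n : ℕ => ((n : ℝ≥0∞) + 1)⁻¹) atTop (𝓝 0) := by
    have := (tendsto_add_atTop_iff_nat 1).2 ENNReal.tendsto_inv_nat_nhds_zero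
    simpa using this
  have sq : ∀ {a : ℕ → ℝ≥0∞}, (∀ n, a n < ((n : ℝ≥0∞) + 1)⁻¹) → Tendsto a atTop (𝓝 0) :=
    fun ha => tendsto_of_tendsto_of_tendsto_of_le_of_le tendsto_const_nhds hlim
      (fun _ => zero_le) fun n => (ha n).le
  refine ⟨G, hG, φ, hφ, ?_, ?_⟩
  · refine tendsto_lintegral_enorm_of_le (sq h1) hun (fun n => ?_) fun n x => ?_
    · exact ((hφ n).continuous.aestronglyMeasurable.sub (h n).1.aestronglyMeasurable).enorm
    · rw [← sub_add_sub_cancel]; exact enorm_add_le _ _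
  · refine tendsto_lintegral_enorm_of_le (sq h2) hGn (fun n => ?_) fun n x => ?_
    · exact ((hφ n).continuous_gradient.aestronglyMeasurable.sub (h n).2.1.aestronglyMeasurable).enorm
    · rw [← sub_add_sub_cancel]; exact enorm_add_le _ _

end ZeroTrace

/-! ### Energies with an affine constraint -/

section Energy

variable {d : ℕ} {Ω : Set (E d)} {F : E d → ℝ≥0∞} {𝒜 : Set (L1 Ω)}

/-- The functional `u ↦ ∫_Ω F(Du)` on the functions `u ∈ W^{1,1}(Ω)` which belong to `𝒜`. -/
noncomputable def constrainedEnergy (F : E d → ℝ≥0∞) (𝒜 : Set (L1 Ω)) (u : L1 Ω) : ℝ≥0∞ :=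
  ⨅ (G : E d → E d) (_ : IsW11Gradient Ω u G ∧ u ∈ 𝒜), ∫⁻ x in Ω, F (G x)

/-- A convex constraint, closed in `W^{1,1}(Ω)` and invariant under the addition of test functions,
which is satisfied by a function `g` with `∫_Ω F(θ Dg) < ∞` for some `θ > 1`. -/
structure IsAdmissibleConstraint (F : E d → ℝ≥0∞) (𝒜 : Set (L1 Ω)) : Prop where
  convex : Convex ℝ 𝒜
  closed : ∀ (un : ℕ → L1 Ω) (Gn : ℕ → E d → E d) (u : L1 Ω) (G : E d → E d),
    (∀ n, un n ∈ 𝒜) → (∀ n, IsW11Gradient Ω (un n) (Gn n)) → IsW11Gradient Ω u G →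
    Tendsto un atTop (𝓝 u) → Tendsto (fun n => ∫⁻ x in Ω, ‖Gn n x - G x‖ₑ) atTop (𝓝 0) → u ∈ 𝒜
  datum : ∃ (g : E d → ℝ) (G : E d → E d), IsW11Gradient Ω g G ∧
    (∃ t : ℝ, 1 < t ∧ ∫⁻ x in Ω, F (t • G x) < ⊤) ∧
    ∀ (φ : E d → ℝ) (w : L1 Ω), IsTestFunction Ω φ →
      w =ᵐ[volume.restrict Ω] (fun x => g x + φ x) → w ∈ 𝒜

lemma neumannEnergy_eq : neumannEnergy F Ω = constrainedEnergy F (univ : Set (L1 Ω)) := by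
  ext u; simp [neumannEnergy, constrainedEnergy]

lemma dirichletEnergy_eq (g : E d → ℝ) : dirichletEnergy F Ω g =
    constrainedEnergy F {u : L1 Ω | MemW11Zero Ω (fun x => u x - g x)} := rfl

lemma isAdmissibleConstraint_univ (hF_zero : F 0 = 0) :
    IsAdmissibleConstraint F (univ : Set (L1 Ω)) where
  convex := convex_univ
  closed := by simp
  datum := ⟨fun _ => 0, fun _ => 0, isW11Gradient_zero, ⟨2, by norm_num, by simp [hF_zero]⟩, by simp⟩

lemma lintegral_enorm_sub_eq (u v : L1 Ω) : ∫⁻ x in Ω, ‖u x - v x‖ₑ = ‖u - v‖ₑ := by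
  rw [Lp.enorm_def, eLpNorm_one_eq_lintegral_enorm]
  refine lintegral_congr_ae ?_
  filter_upwards [Lp.coeFn_sub u v] with x hx
  rw [hx, Pi.sub_apply]

lemma tendsto_lintegral_enorm_sub {un : ℕ → L1 Ω} {u : L1 Ω} (h : Tendsto un atTop (𝓝 u)) :
    Tendsto (fun n => ∫⁻ x in Ω, ‖un n x - u x‖ₑ) atTop (𝓝 0) := by
  simp only [lintegral_enorm_sub_eq]
  simpa [edist_eq_enorm_sub] using tendsto_iff_edist_tendsto_0.1 h

lemma isAdmissibleConstraint_dirichlet (hΩ : IsOpen Ω) {g : E d → ℝ}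
    (hg : IsAdmissibleDatum F Ω g) :
    IsAdmissibleConstraint F {u : L1 Ω | MemW11Zero Ω (fun x => u x - g x)} where
  convex := by
    intro u hu v hv a b ha hb hab
    refine ((MemW11Zero.const_mul hu a).add (MemW11Zero.const_mul hv b)).congr ?_
    filter_upwards [Lp.coeFn_add (a • u) (b • v), Lp.coeFn_smul a u, Lp.coeFn_smul b v]
      with x h1 h2 h3
    rw [h1, Pi.add_apply, h2, h3, Pi.smul_apply, Pi.smul_apply, smul_eq_mul, smul_eq_mul]
    linear_combination (- g x) * hab
  closed := by
    obtain ⟨Gg, hGg, -⟩ := hg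
    intro un Gn u G h1 h2 h3 h4 h5
    refine MemW11Zero.of_tendsto hΩ h1 (fun n => (h2 n).sub hGg) (h3.sub hGg) ?_ ?_
    · simpa using tendsto_lintegral_enorm_sub h4
    · simpa using h5
  datum := by
    obtain ⟨Gg, hGg, ht⟩ := hg
    refine ⟨g, Gg, hGg, ht, fun φ w hφ hw => hφ.memW11Zero.congr ?_⟩
    filter_upwards [hw] with x hx
    rw [hx]; ring

end Energy

/-! ### Strong convexity and lower semicontinuity of the energies. -/

section StrongEnergy

variable {d : ℕ} {Ω : Set (E d)} {F : E d → ℝ≥0∞} {𝒜 : Set (L1 Ω)}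

/-- The Hilbert space `L²(Ω; ℝᵈ)`. -/
noncomputable abbrev L2V (Ω : Set (E d)) := Lp (E d) 2 (volume.restrict Ω)

/-- `u ∈ W^{1,1}(Ω)` has the square integrable weak gradient `G`. -/
def HasGrad (u : L1 Ω) (G : L2V Ω) : Prop := IsW11Gradient Ω u G

lemma HasGrad.add {u v : L1 Ω} {G H : L2V Ω} (h : HasGrad u G) (h' : HasGrad v H) :
    HasGrad (u + v) (G + H) :=
  (IsW11Gradient.add h h').congr (Lp.coeFn_add u v).symm (Lp.coeFn_add G H).symm

lemma HasGrad.smul {u : L1 Ω} {G : L2V Ω} (h : HasGrad u G) (c : ℝ) :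
    HasGrad (c • u) (c • G) :=
  (IsW11Gradient.const_smul h c).congr (Lp.coeFn_smul c u).symm (Lp.coeFn_smul c G).symm

lemma HasGrad.sub {u v : L1 Ω} {G H : L2V Ω} (h : HasGrad u G) (h' : HasGrad v H) :
    HasGrad (u - v) (G - H) :=
  (IsW11Gradient.sub h h').congr (Lp.coeFn_sub u v).symm (Lp.coeFn_sub G H).symm

open Classical in
/-- The weak gradient of `u` if it exists and is square integrable, and `0` otherwise. -/
noncomputable def grad (u : L1 Ω) : L2V Ω := if h : ∃ G, HasGrad u G then h.choose else 0

lemma HasGrad.hasGrad {u : L1 Ω} {G : L2V Ω} (h : HasGrad u G) : HasGrad u (grad u) := by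
  have h' : ∃ G, HasGrad u G := ⟨G, h⟩
  rw [grad, dif_pos h']
  exact h'.choose_spec

lemma enorm_sq_eq_lintegral {α V : Type*} [MeasurableSpace α] {μ : Measure α}
    [NormedAddCommGroup V] (f : Lp V 2 μ) : ‖f‖ₑ ^ 2 = ∫⁻ x, ‖f x‖ₑ ^ 2 ∂μ := by
  rw [Lp.enorm_def, eLpNorm_eq_lintegral_rpow_enorm_toReal (by norm_num) (by norm_num),
    ← ENNReal.rpow_natCast, ← ENNReal.rpow_mul]
  norm_num

lemma lintegral_enorm_le_mul_enorm {V : Type*} [NormedAddCommGroup V]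
    [IsFiniteMeasure (volume.restrict Ω)] {f : E d → V} (g : Lp V 2 (volume.restrict Ω))
    (h : f =ᵐ[volume.restrict Ω] g) :
    ∫⁻ x in Ω, ‖f x‖ₑ ≤ ‖g‖ₑ * (volume Ω) ^ (1 / 2 : ℝ) := by
  rw [← eLpNorm_one_eq_lintegral_enorm, eLpNorm_congr_ae h, Lp.enorm_def]
  have := eLpNorm_le_eLpNorm_mul_rpow_measure_univ (p := 1) (q := 2) (by norm_num)
    (Lp.aestronglyMeasurable g)
  refine this.trans (le_of_eq ?_)
  simp only [Measure.restrict_apply_univ]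
  norm_num

lemma integrableOn_of_Lp {V : Type*} [NormedAddCommGroup V] [IsFiniteMeasure (volume.restrict Ω)]
    (G : Lp V 2 (volume.restrict Ω)) : IntegrableOn G Ω :=
  (Lp.memLp G).integrable (by norm_num)

/-- On a set of finite measure, convergence of the gradients in `L²` implies convergence in `L¹`,
where the graph of the weak gradient is closed. The `L¹` convergence is recorded because the
closedness of a constraint is phrased with it. -/
lemma HasGrad.of_tendsto [IsFiniteMeasure (volume.restrict Ω)] {un : ℕ → L1 Ω} {Gn : ℕ → L2V Ω}
    {u : L1 Ω} {G : L2V Ω} (h : ∀ n, HasGrad (un n) (Gn n)) (hu : Tendsto un atTop (𝓝 u))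
    (hG : Tendsto Gn atTop (𝓝 G)) :
    HasGrad u G ∧ Tendsto (fun n => ∫⁻ x in Ω, ‖Gn n x - G x‖ₑ) atTop (𝓝 0) := by
  have hGn : Tendsto (fun n => ∫⁻ x in Ω, ‖Gn n x - G x‖ₑ) atTop (𝓝 0) := by
    have h0 : Tendsto (fun n => ‖Gn n - G‖ₑ * (volume Ω) ^ (1 / 2 : ℝ)) atTop (𝓝 0) := by
      have h1 : Tendsto (fun n => ‖Gn n - G‖ₑ) atTop (𝓝 0) := by
        simpa [edist_eq_enorm_sub] using tendsto_iff_edist_tendsto_0.1 hG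
      have h2 : (volume Ω) ^ (1 / 2 : ℝ) ≠ ⊤ := by
        refine ENNReal.rpow_ne_top_of_nonneg (by norm_num) ?_
        have := measure_lt_top (volume.restrict Ω) univ
        rw [Measure.restrict_apply_univ] at this
        exact this.ne
      simpa using ENNReal.Tendsto.mul_const h1 (Or.inr h2)
    refine tendsto_of_tendsto_of_tendsto_of_le_of_le tendsto_const_nhds h0
      (fun _ => zero_le) fun n => ?_
    exact lintegral_enorm_le_mul_enorm _ (Lp.coeFn_sub _ _).symm
  exact ⟨IsW11Gradient.of_tendsto h (L1.integrable_coeFn u) (integrableOn_of_Lp G)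
    (tendsto_lintegral_enorm_sub hu) hGn, hGn⟩

/-- The properties of the energies used in the study of the `L¹` gradient flow: convexity with a
quadratic gain in the gradient, lower semicontinuity and quadratic growth. -/
structure IsStrongEnergy (γ : ℝ) (Φ : L1 Ω → ℝ≥0∞) : Prop where
  hasGrad : ∀ u, Φ u < ⊤ → HasGrad u (grad u)
  convex : ∀ u v, Φ u < ⊤ → Φ v < ⊤ → ∀ t : ℝ, 0 < t → t < 1 →
    Φ ((1 - t) • u + t • v) < ⊤ ∧
    (Φ ((1 - t) • u + t • v)).toReal + γ / 2 * (t * (1 - t)) * ‖grad u - grad v‖ ^ 2 ≤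
      (1 - t) * (Φ u).toReal + t * (Φ v).toReal
  closed : ∀ (un : ℕ → L1 Ω) (u : L1 Ω) (c : ℝ≥0∞), c < ⊤ → Tendsto un atTop (𝓝 u) →
    (∀ n, Φ (un n) ≤ c) → Φ u ≤ c
  growth : ∀ u, Φ u < ⊤ → γ / 2 * ‖grad u‖ ^ 2 ≤ (Φ u).toReal

lemma constrainedEnergy_eq (hΩ : IsOpen Ω) {u : L1 Ω} {G : E d → E d} (hG : IsW11Gradient Ω u G)
    (hu : u ∈ 𝒜) : constrainedEnergy F 𝒜 u = ∫⁻ x in Ω, F (G x) := by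
  refine le_antisymm (iInf₂_le_of_le G ⟨hG, hu⟩ le_rfl) (le_iInf₂ fun H hH => ?_)
  refine le_of_eq (lintegral_congr_ae ?_)
  filter_upwards [hG.unique hΩ hH.1] with x hx
  rw [hx]

/-- Quadratic growth of `F` forces the gradient of a function of finite energy to be square
integrable, so that the chosen gradient `grad u` computes the energy. -/
lemma constrainedEnergy_lt_top (hΩ : IsOpen Ω) (hF_zero : F 0 = 0) {γ : ℝ} (hγ : 0 < γ)
    (hF : IsGammaConvex γ F) {u : L1 Ω} (hu : constrainedEnergy F 𝒜 u < ⊤) :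
    HasGrad u (grad u) ∧ u ∈ 𝒜 ∧ constrainedEnergy F 𝒜 u = ∫⁻ x in Ω, F (grad u x) := by
  have hu' := hu
  rw [constrainedEnergy, iInf_lt_iff] at hu'
  obtain ⟨G, hG⟩ := hu'
  rw [iInf_lt_iff] at hG
  obtain ⟨⟨hG, hA⟩, hfin⟩ := hG
  have hmem : MemLp G 2 (volume.restrict Ω) := by
    refine ⟨hG.2.1.aestronglyMeasurable, ?_⟩
    rw [eLpNorm_lt_top_iff_lintegral_rpow_enorm_lt_top (by norm_num) (by norm_num)]
    have h1 : ENNReal.ofReal (γ / 2) * ∫⁻ x in Ω, ‖G x‖ₑ ^ 2 < ⊤ := by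
      rw [← lintegral_const_mul' _ _ ENNReal.ofReal_ne_top]
      exact lt_of_le_of_lt (lintegral_mono fun x => quadratic_growth hF_zero hγ hF _) hfin
    have h2 := ENNReal.lt_top_of_mul_ne_top_right h1.ne (by simpa using hγ)
    simpa using h2
  have h1 : HasGrad u (hmem.toLp G) :=
    hG.congr (EventuallyEq.refl _ _) hmem.coeFn_toLp.symm
  exact ⟨h1.hasGrad, hA, constrainedEnergy_eq hΩ h1.hasGrad hA⟩

lemma constrainedEnergy_convex (hΩ : IsOpen Ω) (hF_zero : F 0 = 0)
    (hF_conv : ConvexOn ℝ≥0 univ F) (hF_lsc : LowerSemicontinuous F)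
    {γ : ℝ} (hγ : 0 < γ) (hF : IsGammaConvex γ F) (hA : Convex ℝ 𝒜) {u v : L1 Ω}
    (hu : constrainedEnergy F 𝒜 u < ⊤) (hv : constrainedEnergy F 𝒜 v < ⊤) {t : ℝ} (ht0 : 0 < t)
    (ht1 : t < 1) :
    constrainedEnergy F 𝒜 ((1 - t) • u + t • v) +
        ENNReal.ofReal (γ / 2 * (t * (1 - t))) * ‖grad u - grad v‖ₑ ^ 2 ≤
      ENNReal.ofReal (1 - t) * constrainedEnergy F 𝒜 u +
        ENNReal.ofReal t * constrainedEnergy F 𝒜 v := by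
  obtain ⟨gu, Au, eu⟩ := constrainedEnergy_lt_top hΩ hF_zero hγ hF hu
  obtain ⟨gv, Av, ev⟩ := constrainedEnergy_lt_top hΩ hF_zero hγ hF hv
  have hFm := hF_lsc.measurable
  have hm : ∀ G : L2V Ω, AEMeasurable (fun x => F (G x)) (volume.restrict Ω) := fun G =>
    hFm.comp_aemeasurable (Lp.aestronglyMeasurable G).aemeasurable
  rw [eu, ev, constrainedEnergy_eq hΩ ((gu.smul (1 - t)).add (gv.smul t))
    (hA Au Av (by linarith) ht0.le (by ring)), enorm_sq_eq_lintegral,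
    ← lintegral_const_mul' _ _ ENNReal.ofReal_ne_top,
    ← lintegral_const_mul' _ _ ENNReal.ofReal_ne_top,
    ← lintegral_const_mul' _ _ ENNReal.ofReal_ne_top, ← lintegral_add_left' (hm _),
    ← lintegral_add_left' ((hm _).const_mul _)]
  refine lintegral_mono_ae ?_
  filter_upwards [Lp.coeFn_add ((1 - t) • grad u) (t • grad v), Lp.coeFn_smul (1 - t) (grad u),
    Lp.coeFn_smul t (grad v), Lp.coeFn_sub (grad u) (grad v)] with x h1 h2 h3 h4
  rw [h1, h4, Pi.add_apply, h2, h3]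
  exact strongly_convex hF_conv hF_lsc hγ hF _ _ ht0 ht1

lemma constrainedEnergy_convex_toReal (hΩ : IsOpen Ω) (hF_zero : F 0 = 0)
    (hF_conv : ConvexOn ℝ≥0 univ F) (hF_lsc : LowerSemicontinuous F)
    {γ : ℝ} (hγ : 0 < γ) (hF : IsGammaConvex γ F) (hA : Convex ℝ 𝒜) {u v : L1 Ω}
    (hu : constrainedEnergy F 𝒜 u < ⊤) (hv : constrainedEnergy F 𝒜 v < ⊤) {t : ℝ} (ht0 : 0 < t)
    (ht1 : t < 1) :
    constrainedEnergy F 𝒜 ((1 - t) • u + t • v) < ⊤ ∧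
    (constrainedEnergy F 𝒜 ((1 - t) • u + t • v)).toReal +
        γ / 2 * (t * (1 - t)) * ‖grad u - grad v‖ ^ 2 ≤
      (1 - t) * (constrainedEnergy F 𝒜 u).toReal + t * (constrainedEnergy F 𝒜 v).toReal := by
  have h := constrainedEnergy_convex hΩ hF_zero hF_conv hF_lsc hγ hF hA hu hv ht0 ht1
  have hs : 0 < 1 - t := by linarith
  have hr : ENNReal.ofReal (1 - t) * constrainedEnergy F 𝒜 u +
        ENNReal.ofReal t * constrainedEnergy F 𝒜 v ≠ ⊤ := by
    have := hu.ne; have := hv.ne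
    finiteness
  have hl := (le_self_add.trans h).trans_lt hr.lt_top
  refine ⟨hl, ?_⟩
  have h2 := ENNReal.toReal_mono hr h
  rw [ENNReal.toReal_add hl.ne (by finiteness), ENNReal.toReal_add (by have := hu.ne; finiteness)
    (by have := hv.ne; finiteness), ENNReal.toReal_mul, ENNReal.toReal_mul, ENNReal.toReal_mul,
    ENNReal.toReal_ofReal hs.le, ENNReal.toReal_ofReal ht0.le, ENNReal.toReal_ofReal (by positivity),
    ENNReal.toReal_pow, toReal_enorm] at h2
  exact h2

/-- Only `un → u` in `L¹` is known, so strong convergence of gradients has to be produced. Almost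
minimizers `w n` of the energy in the convex hulls of the tails of `un` still converge to `u`, and
strong convexity makes their gradients a Cauchy sequence in `L²`. The closed graph, the closed
constraint and Fatou's lemma then apply to `w n`. -/
lemma constrainedEnergy_closed [IsFiniteMeasure (volume.restrict Ω)] (hΩ : IsOpen Ω)
    (hF_zero : F 0 = 0)
    (hF_conv : ConvexOn ℝ≥0 univ F) (hF_lsc : LowerSemicontinuous F)
    {γ : ℝ} (hγ : 0 < γ) (hF : IsGammaConvex γ F) (hA : IsAdmissibleConstraint F 𝒜)
    {un : ℕ → L1 Ω} {u : L1 Ω} {c : ℝ≥0∞} (hc : c < ⊤) (hu : Tendsto un atTop (𝓝 u))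
    (hun : ∀ n, constrainedEnergy F 𝒜 (un n) ≤ c) : constrainedEnergy F 𝒜 u ≤ c := by
  set Φ := constrainedEnergy F 𝒜 with hΦ
  have hconv : ∀ u v, Φ u < ⊤ → Φ v < ⊤ → ∀ t : ℝ, 0 < t → t < 1 → _ := fun u v hu hv t h0 h1 =>
    constrainedEnergy_convex_toReal hΩ hF_zero hF_conv hF_lsc hγ hF hA.convex hu hv h0 h1
  set A : ℕ → Set (L1 Ω) := fun n => convexHull ℝ (un '' Ici n) with hAdef
  have hsub : Convex ℝ {w | Φ w ≤ c} := by
    rw [convex_iff_forall_pos]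
    intro v hv w hw a b ha hb hab
    have e : a = 1 - b := by linarith
    subst e
    obtain ⟨h1, h2⟩ := hconv v w (lt_of_le_of_lt hv hc) (lt_of_le_of_lt hw hc) b hb (by linarith)
    have h3 := ENNReal.toReal_mono hc.ne hv
    have h4 := ENNReal.toReal_mono hc.ne hw
    refine (ENNReal.toReal_le_toReal h1.ne hc.ne).1 ?_
    have : 0 ≤ γ / 2 * (b * (1 - b)) * ‖grad v - grad w‖ ^ 2 := by positivity
    nlinarith
  have hAc : ∀ n, ∀ w ∈ A n, Φ w ≤ c := fun n w hw => by
    refine convexHull_min ?_ hsub hw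
    rintro _ ⟨m, -, rfl⟩
    exact hun m
  have hAne : ∀ n, (A n).Nonempty := fun n =>
    ⟨un n, subset_convexHull ℝ _ ⟨n, self_mem_Ici, rfl⟩⟩
  have hAmono : ∀ {n m}, n ≤ m → A m ⊆ A n := fun h =>
    convexHull_mono (image_mono (Ici_subset_Ici.2 h))
  set I : ℕ → ℝ := fun n => sInf ((fun w => (Φ w).toReal) '' A n) with hI
  have hbdd : ∀ n, BddBelow ((fun w => (Φ w).toReal) '' A n) := fun n =>
    ⟨0, by rintro _ ⟨w, -, rfl⟩; exact ENNReal.toReal_nonneg⟩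
  have hIle : ∀ n, ∀ w ∈ A n, I n ≤ (Φ w).toReal := fun n w hw => csInf_le (hbdd n) ⟨w, hw, rfl⟩
  have hImono : Monotone I := fun n m h =>
    csInf_le_csInf (hbdd n) ((hAne m).image _) (image_mono (hAmono h))
  have hIc : ∀ n, I n ≤ c.toReal := fun n => by
    obtain ⟨w, hw⟩ := hAne n
    exact (hIle n w hw).trans (ENNReal.toReal_mono hc.ne (hAc n w hw))
  have hw : ∀ n : ℕ, ∃ w ∈ A n, (Φ w).toReal < I n + 1 / ((n : ℝ) + 1) := fun n => by
    have : I n < I n + 1 / ((n : ℝ) + 1) := by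
      have : 0 < 1 / ((n : ℝ) + 1) := by positivity
      linarith
    obtain ⟨_, ⟨w, hw, rfl⟩, h⟩ := exists_lt_of_csInf_lt ((hAne n).image _) this
    exact ⟨w, hw, h⟩
  choose w hwA hwI using hw
  have hwfin : ∀ n, Φ (w n) < ⊤ := fun n => lt_of_le_of_lt (hAc n _ (hwA n)) hc
  have hwlim : Tendsto w atTop (𝓝 u) := by
    rw [Metric.tendsto_atTop] at hu ⊢
    intro ε hε
    obtain ⟨N, hN⟩ := hu ε hε
    refine ⟨N, fun n hn => ?_⟩
    have : A n ⊆ Metric.ball u ε := by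
      refine convexHull_min ?_ (convex_ball u ε)
      rintro _ ⟨m, hm, rfl⟩
      exact hN m (le_trans hn hm)
    exact this (hwA n)
  have hIlim := tendsto_atTop_ciSup hImono ⟨c.toReal, by rintro _ ⟨n, rfl⟩; exact hIc n⟩
  set L := ⨆ n, I n
  have hcauchy : CauchySeq fun n => grad (w n) := by
    -- The midpoint of `w n` and `w m` stays in the hull `A n`, so its energy is at least `I n`; the
    -- quadratic gain at `t = 1/2`, with factor `γ / 8`, is thus bounded by the defects of
    -- minimality.
    have hest : ∀ n m, n ≤ m → ‖grad (w n) - grad (w m)‖ ^ 2 ≤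
        8 / γ * ((L - I n) + 1 / ((n : ℝ) + 1)) := by
      intro n m hnm
      obtain ⟨h1, h2⟩ := hconv _ _ (hwfin n) (hwfin m) (1 / 2) (by norm_num) (by norm_num)
      have h3 := hIle n ((1 - 1 / 2 : ℝ) • w n + (1 / 2 : ℝ) • w m)
        (convex_convexHull ℝ _ (hwA n) (hAmono hnm (hwA m)) (by norm_num) (by norm_num)
          (by norm_num))
      have h4 := hwI n
      have h5 := hwI m
      have h6 : I m ≤ L := le_ciSup (f := I)
        ⟨c.toReal, by rintro _ ⟨n, rfl⟩; exact hIc n⟩ m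
      have h7 : 1 / ((m : ℝ) + 1) ≤ 1 / ((n : ℝ) + 1) := by gcongr
      have h8 : γ / 8 * ‖grad (w n) - grad (w m)‖ ^ 2 ≤ (L - I n) + 1 / ((n : ℝ) + 1) := by
        linarith [hImono hnm]
      calc ‖grad (w n) - grad (w m)‖ ^ 2 = 8 / γ * (γ / 8 * ‖grad (w n) - grad (w m)‖ ^ 2) := by
            field_simp
        _ ≤ _ := by gcongr
    have hb : Tendsto (fun n : ℕ => Real.sqrt (8 / γ * ((L - I n) + 1 / ((n : ℝ) + 1)))) atTop
        (𝓝 0) := by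
      have h1 : Tendsto (fun n : ℕ => 8 / γ * ((L - I n) + 1 / ((n : ℝ) + 1))) atTop (𝓝 0) := by
        simpa using ((tendsto_const_nhds (x := L).sub hIlim).add
          tendsto_one_div_add_atTop_nhds_zero_nat).const_mul (8 / γ)
      simpa [Function.comp_def] using (Real.continuous_sqrt.tendsto 0).comp h1
    refine Metric.cauchySeq_iff'.2 fun ε hε => ?_
    obtain ⟨N, hN⟩ := (hb.eventually (gt_mem_nhds hε)).exists
    refine ⟨N, fun n hn => ?_⟩
    rw [dist_comm, dist_eq_norm]
    exact lt_of_le_of_lt (Real.le_sqrt_of_sq_le (hest N n hn)) hN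
  obtain ⟨G, hG⟩ := cauchySeq_tendsto_of_complete hcauchy
  have hgr := fun n => constrainedEnergy_lt_top hΩ hF_zero hγ hF (hwfin n)
  obtain ⟨hGu, hGlim⟩ := HasGrad.of_tendsto (fun n => (hgr n).1) hwlim hG
  have hu𝒜 : u ∈ 𝒜 := hA.closed w (fun n => grad (w n)) u G (fun n => (hgr n).2.1)
    (fun n => (hgr n).1) hGu hwlim hGlim
  rw [hΦ, constrainedEnergy_eq hΩ hGu hu𝒜]
  obtain ⟨ns, hns, hae⟩ := (tendstoInMeasure_of_tendsto_Lp hG).exists_seq_tendsto_ae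
  calc ∫⁻ x in Ω, F (G x) ≤ ∫⁻ x in Ω, liminf (fun n => F (grad (w (ns n)) x)) atTop := by
        refine lintegral_mono_ae ?_
        filter_upwards [hae] with x hx
        exact (hF_lsc.le_liminf (G x)).trans (hx.liminf_le_liminf_comp)
    _ ≤ liminf (fun n => ∫⁻ x in Ω, F (grad (w (ns n)) x)) atTop :=
        lintegral_liminf_le' fun n =>
          hF_lsc.measurable.comp_aemeasurable (Lp.aestronglyMeasurable _).aemeasurable
    _ ≤ c := by
        refine liminf_le_of_le (by isBoundedDefault) fun b hb => ?_
        obtain ⟨n, hn⟩ := hb.exists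
        refine hn.trans ?_
        rw [← (hgr (ns n)).2.2]
        exact hAc _ _ (hwA _)

lemma isStrongEnergy_constrainedEnergy [IsFiniteMeasure (volume.restrict Ω)] (hΩ : IsOpen Ω)
    (hF_zero : F 0 = 0)
    (hF_conv : ConvexOn ℝ≥0 univ F) (hF_lsc : LowerSemicontinuous F)
    {γ : ℝ} (hγ : 0 < γ) (hF : IsGammaConvex γ F) (hA : IsAdmissibleConstraint F 𝒜) :
    IsStrongEnergy γ (constrainedEnergy F 𝒜) where
  hasGrad u hu := (constrainedEnergy_lt_top hΩ hF_zero hγ hF hu).1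
  convex u v hu hv t h0 h1 :=
    constrainedEnergy_convex_toReal hΩ hF_zero hF_conv hF_lsc hγ hF hA.convex hu hv h0 h1
  closed un u c hc hu hun :=
    constrainedEnergy_closed hΩ hF_zero hF_conv hF_lsc hγ hF hA hc hu hun
  growth u hu := by
    have h1 : ENNReal.ofReal (γ / 2) * ‖grad u‖ₑ ^ 2 ≤ constrainedEnergy F 𝒜 u := by
      rw [(constrainedEnergy_lt_top hΩ hF_zero hγ hF hu).2.2, enorm_sq_eq_lintegral,
        ← lintegral_const_mul' _ _ ENNReal.ofReal_ne_top]
      exact lintegral_mono fun x => quadratic_growth hF_zero hγ hF _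
    have h2 := ENNReal.toReal_mono hu.ne h1
    rwa [ENNReal.toReal_mul, ENNReal.toReal_ofReal (by positivity), ENNReal.toReal_pow,
      toReal_enorm] at h2

end StrongEnergy

/-! ### Subgradients and the optimality condition of one minimization step. -/

section Subgradient

variable {X : Type*} [NormedAddCommGroup X] [NormedSpace ℝ X]

/-- The continuous linear form `l` is a subgradient of `Φ` at `u`. -/
def IsSubgrad (Φ : X → ℝ≥0∞) (u : X) (l : StrongDual ℝ X) : Prop :=
  Φ u < ⊤ ∧ ∀ w, Φ w < ⊤ → (Φ u).toReal + l (w - u) ≤ (Φ w).toReal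

/-- The optimality condition for one step of the minimizing movement scheme. -/
lemma exists_isSubgrad_of_minimizer {Φ : X → ℝ≥0∞}
    (hconv : ∀ u v, Φ u < ⊤ → Φ v < ⊤ → ∀ t : ℝ, 0 < t → t < 1 →
      Φ ((1 - t) • u + t • v) < ⊤ ∧
      (Φ ((1 - t) • u + t • v)).toReal ≤ (1 - t) * (Φ u).toReal + t * (Φ v).toReal)
    {τ : ℝ} (hτ : 0 < τ) {U V : X} (hU : Φ U < ⊤)
    (hmin : ∀ w, Φ U + ENNReal.ofReal (‖U - V‖ ^ 2 / (2 * τ)) ≤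
      Φ w + ENNReal.ofReal (‖w - V‖ ^ 2 / (2 * τ))) :
    ∃ l : StrongDual ℝ X, IsSubgrad Φ U l ∧ ‖l‖ ≤ ‖U - V‖ / τ ∧
      l (U - V) = -(‖U - V‖ ^ 2 / τ) := by
  set c : ℝ := (Φ U).toReal + ‖U - V‖ ^ 2 / (2 * τ) with hc
  have hcw : ∀ w, Φ w < ⊤ → c ≤ (Φ w).toReal + ‖w - V‖ ^ 2 / (2 * τ) := fun w hw => by
    have h := ENNReal.toReal_mono (by have := hw.ne; finiteness) (hmin w)
    rwa [ENNReal.toReal_add hU.ne (by finiteness), ENNReal.toReal_add hw.ne (by finiteness),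
      ENNReal.toReal_ofReal (by positivity), ENNReal.toReal_ofReal (by positivity)] at h
  -- Minimality says that the epigraph `t` of `Φ` lies above the graph of the concave function `w ↦
  -- c - ‖w - V‖² / (2 τ)`. The strict hypograph `s` of the latter is open, so the two convex sets
  -- can be separated; `Φ` needs no continuity.
  set s : Set (X × ℝ) := {p | p.2 + ‖p.1 - V‖ ^ 2 / (2 * τ) < c} with hs
  set t : Set (X × ℝ) := {p | Φ p.1 < ⊤ ∧ (Φ p.1).toReal ≤ p.2} with ht
  have hnormconv : ConvexOn ℝ univ fun p : X × ℝ => p.2 + ‖p.1 - V‖ ^ 2 / (2 * τ) := by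
    have h1 : ConvexOn ℝ univ fun p : X × ℝ => ‖p.1 - V‖ ^ 2 := by
      refine ConvexOn.pow (f := fun p : X × ℝ => ‖p.1 - V‖) ?_ (fun _ _ => norm_nonneg _) 2
      have := (convexOn_norm (convex_univ (𝕜 := ℝ) (E := X))).translate_left (-V)
      have h2 := this.comp_linearMap (LinearMap.fst ℝ X ℝ)
      simpa [Function.comp_def, sub_eq_add_neg] using h2
    have h3 : ConvexOn ℝ univ fun p : X × ℝ => p.2 :=
      (LinearMap.snd ℝ X ℝ).convexOn convex_univ
    refine h3.add ?_
    have := h1.smul (c := (2 * τ)⁻¹) (by positivity)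
    simpa [div_eq_inv_mul] using this
  have hsc : Convex ℝ s := by
    have := hnormconv.convex_lt c
    simpa [hs] using this
  have hso : IsOpen s := by
    refine isOpen_lt ?_ continuous_const
    fun_prop
  have htc : Convex ℝ t := by
    rw [convex_iff_forall_pos]
    rintro ⟨v, r⟩ ⟨hv, hvr⟩ ⟨w, r'⟩ ⟨hw, hwr⟩ a b ha hb hab
    have e : a = 1 - b := by linarith
    subst e
    obtain ⟨h1, h2⟩ := hconv v w hv hw b hb (by linarith)
    refine ⟨h1, h2.trans ?_⟩
    simp only [Prod.smul_mk, Prod.mk_add_mk, smul_eq_mul]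
    have := mul_le_mul_of_nonneg_left hvr ha.le
    have := mul_le_mul_of_nonneg_left hwr hb.le
    simp only at *
    linarith
  have hdisj : Disjoint s t := by
    rw [Set.disjoint_left]
    rintro ⟨w, r⟩ h1 ⟨h2, h3⟩
    have := hcw w h2
    simp only [hs, mem_ofPred_eq] at h1 h3
    linarith
  obtain ⟨f, k, hfs, hft⟩ := geometric_hahn_banach_open hsc hso htc hdisj
  set β := f (0, 1) with hβ
  have hf : ∀ w r, f (w, r) = f (w, 0) + r * β := fun w r => by
    have : ((w, r) : X × ℝ) = (w, 0) + r • (0, 1) := by simp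
    rw [this, map_add, map_smul, smul_eq_mul]
  -- The separating hyperplane is not vertical: `s` and `t` contain points on the same vertical line
  -- above `U`.
  have hβpos : 0 < β := by
    have h1 := hfs (U, (Φ U).toReal - 1) (by simp [hs, hc])
    have h2 := hft (U, (Φ U).toReal) ⟨hU, le_rfl⟩
    rw [hf] at h1 h2
    nlinarith
  have h1 : ∀ w, f (w, 0) + (c - ‖w - V‖ ^ 2 / (2 * τ)) * β ≤ k := fun w => by
    refine le_of_forall_pos_lt_add fun ε hε => ?_
    have := hfs (w, c - ‖w - V‖ ^ 2 / (2 * τ) - ε / β) (by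
      simp only [hs, mem_ofPred_eq]
      have : 0 < ε / β := by positivity
      linarith)
    rw [hf] at this
    have e : ε / β * β = ε := by field_simp
    nlinarith
  have h2 : ∀ w, Φ w < ⊤ → k ≤ f (w, 0) + (Φ w).toReal * β := fun w hw => by
    have := hft (w, (Φ w).toReal) ⟨hw, le_rfl⟩
    rwa [hf] at this
  have hk : k = f (U, 0) + (Φ U).toReal * β := by
    refine le_antisymm (h2 U hU) ?_
    have := h1 U
    rwa [hc, add_sub_cancel_right] at this
  set l : StrongDual ℝ X := -(β⁻¹ • f.comp (ContinuousLinearMap.inl ℝ X ℝ)) with hl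
  have hlw : ∀ w, f (w, 0) = -(β * l w) := fun w => by
    simp [hl]; field_simp
  have hsub : IsSubgrad Φ U l := by
    refine ⟨hU, fun w hw => ?_⟩
    have := h2 w hw
    rw [hk, hlw, hlw] at this
    rw [map_sub]
    have h3 : β * ((Φ U).toReal + (l w - l U)) ≤ β * (Φ w).toReal := by linarith
    exact le_of_mul_le_mul_left h3 hβpos
  set δ := U - V with hδ
  -- The other side of the separation: `-l` is a subgradient at `δ` of `z ↦ ‖z‖² / (2 τ)`.
  have hquad : ∀ z, ‖δ‖ ^ 2 - ‖z‖ ^ 2 ≤ 2 * τ * l (z - δ) := fun z => by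
    have := h1 (V + z)
    rw [hk, hlw, hlw, hc, add_sub_cancel_left] at this
    have e : z - δ = (V + z) - U := by rw [hδ]; abel
    rw [e, map_sub]
    have h3 : β * (‖δ‖ ^ 2 / (2 * τ) - ‖z‖ ^ 2 / (2 * τ)) ≤ β * (l (V + z) - l U) := by linarith
    have h4 := le_of_mul_le_mul_left h3 hβpos
    rw [← sub_div, div_le_iff₀ (by positivity)] at h4
    linarith
  have hlδ : τ * l δ = - ‖δ‖ ^ 2 := by
    -- With `z = (1 + e) δ`, a quadratic polynomial in `e` is nonnegative and has no constant term;
    -- its linear coefficient must vanish.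
    have h3 : ∀ e : ℝ, 0 ≤ ‖δ‖ ^ 2 * (e * e) + (2 * (‖δ‖ ^ 2 + τ * l δ)) * e + 0 := fun e => by
      have := hquad ((1 + e) • δ)
      have e1 : (1 + e) • δ - δ = e • δ := by module
      rw [e1, map_smul, norm_smul, mul_pow, Real.norm_eq_abs, sq_abs, smul_eq_mul] at this
      nlinarith
    have := discrim_le_zero h3
    rw [discrim] at this
    have h4 : (‖δ‖ ^ 2 + τ * l δ) ^ 2 ≤ 0 := by nlinarith
    have := pow_eq_zero_iff (two_ne_zero) |>.1 (le_antisymm h4 (sq_nonneg _))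
    linarith
  refine ⟨l, hsub, ?_, ?_⟩
  · refine ContinuousLinearMap.opNorm_le_bound _ (by positivity) fun y => ?_
    -- With `z = e y` and the value of `l δ` just found, the sign of the discriminant is exactly the
    -- bound on `|l y|`.
    have h3 : ∀ e : ℝ, 0 ≤ ‖y‖ ^ 2 * (e * e) + (2 * τ * l y) * e + ‖δ‖ ^ 2 := fun e => by
      have := hquad (e • y)
      rw [map_sub, map_smul, norm_smul, mul_pow, Real.norm_eq_abs, sq_abs, smul_eq_mul] at this
      nlinarith
    have := discrim_le_zero h3
    rw [discrim] at this
    have h4 : (τ * l y) ^ 2 ≤ (‖δ‖ * ‖y‖) ^ 2 := by nlinarith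
    rw [div_mul_eq_mul_div, le_div_iff₀ hτ, Real.norm_eq_abs, mul_comm]
    have h6 := abs_le_of_sq_le_sq' h4 (by positivity)
    calc τ * |l y| = |τ * l y| := by rw [abs_mul, abs_of_pos hτ]
      _ ≤ _ := abs_le.2 h6
  · field_simp
    linarith

end Subgradient

/-! ### Duality between integrable and essentially bounded functions. -/

section Dual

variable {α : Type*} [MeasurableSpace α] {μ : Measure α}

/-- The continuous linear form on `L¹` defined by an essentially bounded function. -/
noncomputable def pairing (q : Lp ℝ ⊤ μ) : StrongDual ℝ (Lp ℝ 1 μ) :=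
  (ContinuousLinearMap.mul ℝ ℝ).lpPairing μ ⊤ 1 q

lemma pairing_apply (q : Lp ℝ ⊤ μ) (w : Lp ℝ 1 μ) : pairing q w = ∫ x, q x * w x ∂μ := by
  rw [pairing, ContinuousLinearMap.lpPairing_eq_integral]
  rfl

lemma ae_norm_le_norm_top (q : Lp ℝ ⊤ μ) : ∀ᵐ x ∂μ, ‖q x‖ ≤ ‖q‖ := by
  filter_upwards [ae_le_eLpNormEssSup (f := q) (μ := μ)] with x hx
  rw [Lp.norm_def, eLpNorm_exponent_top, ← toReal_enorm]
  refine ENNReal.toReal_mono ?_ hx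
  rw [← eLpNorm_exponent_top]
  exact (Lp.memLp q).2.ne

lemma norm_pairing_le (q : Lp ℝ ⊤ μ) : ‖pairing q‖ ≤ ‖q‖ := by
  refine ContinuousLinearMap.opNorm_le_bound _ (norm_nonneg _) fun w => ?_
  rw [pairing_apply, L1.norm_eq_integral_norm, ← integral_const_mul]
  refine norm_integral_le_of_norm_le ((L1.integrable_coeFn w).norm.const_mul _) ?_
  filter_upwards [ae_norm_le_norm_top q] with x hx
  rw [norm_mul]
  gcongr

lemma integrable_mul_of_top (q : Lp ℝ ⊤ μ) {w : α → ℝ} (hw : Integrable w μ) :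
    Integrable (fun x => q x * w x) μ :=
  Integrable.bdd_mul hw (Lp.aestronglyMeasurable q) (ae_norm_le_norm_top q)

/-- Every continuous linear form on `L¹` of a finite measure is given by a bounded function. -/
lemma exists_pairing_eq [IsFiniteMeasure μ] (l : StrongDual ℝ (Lp ℝ 1 μ)) :
    ∃ q : Lp ℝ ⊤ μ, pairing q = l ∧ ‖q‖ ≤ ‖l‖ := by
  have hm : ∀ f : Lp ℝ 2 μ, MemLp f 1 μ := fun f => (Lp.memLp f).mono_exponent (by norm_num)
  set C : ℝ := (μ univ ^ (1 / 2 : ℝ)).toReal with hC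
  have hCt : μ univ ^ (1 / 2 : ℝ) ≠ ⊤ :=
    ENNReal.rpow_ne_top_of_nonneg (by norm_num) (measure_ne_top _ _)
  -- For a finite measure `L²` embeds continuously in `L¹`, so that `l` restricts to a form on a
  -- Hilbert space and the Riesz theorem provides its density `q2`.
  let ι₀ : Lp ℝ 2 μ →ₗ[ℝ] Lp ℝ 1 μ :=
    { toFun := fun f => (hm f).toLp f
      map_add' := fun f g => by
        rw [← MemLp.toLp_add]
        exact MemLp.toLp_congr _ _ (Lp.coeFn_add f g)
      map_smul' := fun c f => by
        rw [RingHom.id_apply, ← MemLp.toLp_const_smul]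
        exact MemLp.toLp_congr _ _ (Lp.coeFn_smul c f) }
  have hι : ∀ f, ‖ι₀ f‖ ≤ C * ‖f‖ := fun f => by
    change ‖(hm f).toLp f‖ ≤ _
    rw [Lp.norm_toLp, Lp.norm_def, mul_comm, hC, ← ENNReal.toReal_mul]
    refine ENNReal.toReal_mono (ENNReal.mul_ne_top (Lp.memLp f).2.ne hCt) ?_
    have := eLpNorm_le_eLpNorm_mul_rpow_measure_univ (p := 1) (q := 2) (by norm_num)
      (Lp.aestronglyMeasurable f)
    refine this.trans (le_of_eq ?_)
    norm_num
  set ι := ι₀.mkContinuous C hι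
  set q2 : Lp ℝ 2 μ := (InnerProductSpace.toDual ℝ _).symm (l.comp ι) with hq2
  have hq : ∀ f : Lp ℝ 2 μ, l ((hm f).toLp f) = ∫ x, q2 x * f x ∂μ := fun f => by
    have : inner ℝ q2 f = l (ι f) := InnerProductSpace.toDual_symm_apply
    rw [L2.inner_def] at this
    change l (ι f) = _
    rw [← this]
    refine integral_congr_ae (ae_of_all _ fun x => ?_)
    simp [mul_comm]
  have hind : ∀ A, ∀ hA : MeasurableSet A, l (indicatorConstLp 1 hA (measure_ne_top μ A) 1)
      = ∫ x in A, q2 x ∂μ := fun A hA => by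
    have h1 := hq (indicatorConstLp 2 hA (measure_ne_top μ A) 1)
    have h2 : (hm (indicatorConstLp 2 hA (measure_ne_top μ A) 1)).toLp _ =
        indicatorConstLp 1 hA (measure_ne_top μ A) (1 : ℝ) := by
      refine Lp.ext ((MemLp.coeFn_toLp _).trans ?_)
      exact indicatorConstLp_coeFn.trans indicatorConstLp_coeFn.symm
    rw [h2] at h1
    rw [h1, ← integral_indicator hA]
    refine integral_congr_ae ?_
    filter_upwards [indicatorConstLp_coeFn (p := 2) (hs := hA) (hμs := measure_ne_top μ A)
      (c := (1 : ℝ))] with x hx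
    rw [hx]
    by_cases hxA : x ∈ A <;> simp [hxA]
  -- Indicator functions bound the averages of `q2` over all measurable sets by `‖l‖`, hence `|q2| ≤
  -- ‖l‖` almost everywhere.
  have hbd : ∀ A, MeasurableSet A → |∫ x in A, q2 x ∂μ| ≤ ‖l‖ * μ.real A := fun A hA => by
    rw [← hind A hA]
    refine (l.le_opNorm _).trans (le_of_eq ?_)
    rw [norm_indicatorConstLp (by norm_num) (by norm_num)]
    simp
  have hint : Integrable q2 μ := (hm q2).integrable le_rfl
  have hae : ∀ᵐ x ∂μ, ‖q2 x‖ ≤ ‖l‖ := by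
    have h1 : ∀ᵐ x ∂μ, q2 x ≤ ‖l‖ := by
      refine ae_le_of_forall_setIntegral_le hint (integrable_const _) fun A hA _ => ?_
      rw [setIntegral_const, smul_eq_mul, mul_comm]
      exact (le_abs_self _).trans (hbd A hA)
    have h2 : ∀ᵐ x ∂μ, -‖l‖ ≤ q2 x := by
      refine ae_le_of_forall_setIntegral_le (integrable_const _) hint fun A hA _ => ?_
      rw [setIntegral_const, smul_eq_mul, mul_comm, neg_mul]
      exact neg_le_of_abs_le (hbd A hA)
    filter_upwards [h1, h2] with x h1 h2
    exact abs_le.2 ⟨h2, h1⟩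
  have hmem : MemLp q2 ⊤ μ := memLp_top_of_bound (Lp.aestronglyMeasurable q2) _ hae
  refine ⟨hmem.toLp q2, ?_, ?_⟩
  · ext w
    refine Lp.induction (by norm_num) (motive := fun w => pairing (hmem.toLp q2) w = l w) ?_ ?_ ?_ w
    · intro c A hA hμA
      have e : (Lp.simpleFunc.indicatorConst 1 hA hμA.ne c : Lp ℝ 1 μ) =
          c • indicatorConstLp 1 hA hμA.ne 1 := by
        rw [Lp.simpleFunc.coe_indicatorConst]
        refine Lp.ext ?_
        filter_upwards [indicatorConstLp_coeFn (p := 1) (hs := hA) (hμs := hμA.ne) (c := c),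
          Lp.coeFn_smul c (indicatorConstLp 1 hA hμA.ne (1 : ℝ)),
          indicatorConstLp_coeFn (p := 1) (hs := hA) (hμs := hμA.ne) (c := (1 : ℝ))] with x h1 h2 h3
        rw [h1, h2, Pi.smul_apply, h3]
        by_cases hxA : x ∈ A <;> simp [hxA]
      rw [e, map_smul, map_smul, hind A hA, pairing_apply, ← integral_indicator hA]
      congr 1
      refine integral_congr_ae ?_
      filter_upwards [indicatorConstLp_coeFn (p := 1) (hs := hA) (hμs := measure_ne_top μ A)
        (c := (1 : ℝ)), hmem.coeFn_toLp] with x hx hx'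
      rw [hx, hx']
      by_cases hxA : x ∈ A <;> simp [hxA]
    · intro f g hf hg _ h1 h2
      rw [map_add, map_add, h1, h2]
    · exact isClosed_eq (pairing _).continuous l.continuous
  · rw [Lp.norm_toLp]
    refine ENNReal.toReal_le_of_le_ofReal (norm_nonneg _) ?_
    rw [eLpNorm_exponent_top]
    exact eLpNormEssSup_le_of_ae_bound hae

end Dual

/-! ### Estimates for the discrete flows. -/

section Discrete

variable {d : ℕ} {Ω : Set (E d)} {γ : ℝ} {Φ : L1 Ω → ℝ≥0∞}

/-- Comparing `u` with `(1 - t) u + t w` and dividing by `t` leaves the convexity gain with the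
factor `1 - t`, which tends to `1` as `t → 0`. -/
lemma IsSubgrad.strong (hΦ : IsStrongEnergy γ Φ) {u w : L1 Ω} {l : StrongDual ℝ (L1 Ω)}
    (h : IsSubgrad Φ u l) (hw : Φ w < ⊤) :
    (Φ u).toReal + l (w - u) + γ / 2 * ‖grad w - grad u‖ ^ 2 ≤ (Φ w).toReal := by
  set D := γ / 2 * ‖grad w - grad u‖ ^ 2 with hD
  have key : ∀ t : ℝ, 0 < t → t < 1 →
      (Φ u).toReal + l (w - u) + (1 - t) * D ≤ (Φ w).toReal := fun t h0 h1 => by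
    obtain ⟨h2, h3⟩ := hΦ.convex u w h.1 hw t h0 h1
    have h4 := h.2 _ h2
    have e : (1 - t) • u + t • w - u = t • (w - u) := by module
    rw [e, map_smul, smul_eq_mul] at h4
    rw [norm_sub_rev] at h3
    have h5 : t * ((Φ u).toReal + l (w - u) + (1 - t) * D) ≤ t * (Φ w).toReal := by
      rw [hD]; linarith
    exact le_of_mul_le_mul_left h5 h0
  have hlim : Tendsto (fun t : ℝ => (Φ u).toReal + l (w - u) + (1 - t) * D) (𝓝[>] 0)
      (𝓝 ((Φ u).toReal + l (w - u) + (1 - 0) * D)) := by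
    refine Tendsto.mono_left ?_ nhdsWithin_le_nhds
    exact (Continuous.tendsto (by fun_prop) _)
  have := le_of_tendsto hlim (by
    filter_upwards [Ioo_mem_nhdsGT (zero_lt_one (α := ℝ))] with t ht
    exact key t ht.1 ht.2)
  linarith

/-- Sum of the two strengthened subgradient inequalities. This coercive monotonicity is what
controls the gradients of increments, both along the scheme and in the limit. -/
lemma IsSubgrad.monotone (hΦ : IsStrongEnergy γ Φ) {u w : L1 Ω} {l k : StrongDual ℝ (L1 Ω)}
    (h : IsSubgrad Φ u l) (h' : IsSubgrad Φ w k) :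
    γ * ‖grad w - grad u‖ ^ 2 ≤ k (w - u) - l (w - u) := by
  have h1 := h.strong hΦ h'.1
  have h2 := h'.strong hΦ h.1
  rw [norm_sub_rev, ← neg_sub w u, map_neg] at h2
  linarith

/-- A discrete flow with finite energy, together with the subgradients given by the optimality
conditions and the velocities `m n = ‖U (n + 1) - U n‖ / τ`. -/
structure IsFlowData (Φ : L1 Ω → ℝ≥0∞) (τ : ℝ) (U : ℕ → L1 Ω) (l : ℕ → StrongDual ℝ (L1 Ω))
    (m : ℕ → ℝ) : Prop where
  pos : 0 < τ
  fin : ∀ n, Φ (U n) < ⊤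
  sub : ∀ n, IsSubgrad Φ (U (n + 1)) (l n)
  speed : ∀ n, ‖U (n + 1) - U n‖ = τ * m n
  bound : ∀ n, ‖l n‖ ≤ m n
  dissip : ∀ n, l n (U (n + 1) - U n) = -(τ * m n ^ 2)

lemma IsDiscreteFlow.exists_isFlowData (hΦ : IsStrongEnergy γ Φ) (hγ : 0 ≤ γ) {u₀ : L1 Ω}
    (hu₀ : Φ u₀ < ⊤)
    {τ : ℝ} (hτ : 0 < τ) {U : ℕ → L1 Ω} (h : IsDiscreteFlow Φ u₀ τ U) :
    ∃ l m, IsFlowData Φ τ U l m := by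
  have hfin : ∀ n, Φ (U n) < ⊤ := fun n => by
    induction n with
    | zero => rw [h.1]; exact hu₀
    | succ n ih =>
      have := h.2 n (U n)
      simp only [sub_self, norm_zero] at this
      refine lt_of_le_of_lt (le_self_add.trans this) ?_
      have := ih.ne
      finiteness
  have hconv : ∀ u v, Φ u < ⊤ → Φ v < ⊤ → ∀ t : ℝ, 0 < t → t < 1 →
      Φ ((1 - t) • u + t • v) < ⊤ ∧
      (Φ ((1 - t) • u + t • v)).toReal ≤ (1 - t) * (Φ u).toReal + t * (Φ v).toReal := by
    intro u v hu hv t h0 h1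
    obtain ⟨h2, h3⟩ := hΦ.convex u v hu hv t h0 h1
    refine ⟨h2, ?_⟩
    have : 0 ≤ γ / 2 * (t * (1 - t)) * ‖grad u - grad v‖ ^ 2 := by
      have : 0 ≤ 1 - t := by linarith
      positivity
    linarith
  choose l hl1 hl2 hl3 using fun n =>
    exists_isSubgrad_of_minimizer hconv hτ (hfin (n + 1)) (h.2 n)
  refine ⟨l, fun n => ‖U (n + 1) - U n‖ / τ, hτ, hfin, hl1, fun n => ?_, hl2, fun n => ?_⟩
  · field_simp
  · rw [hl3]; field_simp

namespace IsFlowData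

variable {τ : ℝ} {U : ℕ → L1 Ω} {l : ℕ → StrongDual ℝ (L1 Ω)} {m : ℕ → ℝ}

lemma m_nonneg (h : IsFlowData Φ τ U l m) (n : ℕ) : 0 ≤ m n :=
  (norm_nonneg _).trans (h.bound n)

/-- The subgradient inequality at `U (n + 1)`, evaluated at `U n`, gives twice the dissipation `τ m²
/ 2` that minimality alone provides. -/
lemma energy_step (h : IsFlowData Φ τ U l m) (hΦ : IsStrongEnergy γ Φ) (n : ℕ) :
    (Φ (U (n + 1))).toReal + τ * m n ^ 2 + γ / 2 * ‖grad (U (n + 1)) - grad (U n)‖ ^ 2 ≤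
      (Φ (U n)).toReal := by
  have := (h.sub n).strong hΦ (h.fin n)
  rw [← neg_sub (U (n + 1)), map_neg, h.dissip, norm_sub_rev] at this
  linarith

/-- Coercive monotonicity between `k` at `U n` and `l n` at `U (n + 1)`: the pairing of `l n` with
the increment is explicit, and that of `k` is at most `‖k‖` times the length `τ m n`. -/
lemma first_step (h : IsFlowData Φ τ U l m) (hΦ : IsStrongEnergy γ Φ) {n : ℕ}
    {k : StrongDual ℝ (L1 Ω)} (hk : IsSubgrad Φ (U n) k) :
    τ * m n ^ 2 + γ * ‖grad (U (n + 1)) - grad (U n)‖ ^ 2 ≤ τ * m n * ‖k‖ := by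
  have h1 := hk.monotone hΦ (h.sub n)
  rw [h.dissip] at h1
  have h2 := k.le_opNorm (U (n + 1) - U n)
  rw [h.speed, Real.norm_eq_abs] at h2
  have := neg_abs_le (k (U (n + 1) - U n))
  linarith

/-- One step decreases `‖l n‖²` by the squared norm of the gradient of the velocity. -/
lemma half_step (h : IsFlowData Φ τ U l m) (hΦ : IsStrongEnergy γ Φ) {n : ℕ}
    {k : StrongDual ℝ (L1 Ω)} (hk : IsSubgrad Φ (U n) k) :
    1 / 2 * m n ^ 2 + γ * (τ * ‖τ⁻¹ • (grad (U (n + 1)) - grad (U n))‖ ^ 2) ≤ 1 / 2 * ‖k‖ ^ 2 := by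
  have h1 := h.first_step hΦ hk
  have hτ := h.pos
  rw [norm_smul, mul_pow, Real.norm_eq_abs, sq_abs]
  have h2 : m n ^ 2 + γ * (τ * (τ⁻¹ ^ 2 * ‖grad (U (n + 1)) - grad (U n)‖ ^ 2)) ≤ m n * ‖k‖ := by
    have e : γ * (τ * (τ⁻¹ ^ 2 * ‖grad (U (n + 1)) - grad (U n)‖ ^ 2)) =
      (γ * ‖grad (U (n + 1)) - grad (U n)‖ ^ 2) / τ := by field_simp
    rw [e, ← le_sub_iff_add_le', div_le_iff₀ hτ]
    linarith
  nlinarith [sq_nonneg (m n - ‖k‖)]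

lemma m_succ_le (h : IsFlowData Φ τ U l m) (hΦ : IsStrongEnergy γ Φ) (hγ : 0 ≤ γ) (n : ℕ) :
    m (n + 1) ≤ m n := by
  have h1 := h.half_step hΦ (h.sub n)
  have h2 := h.bound n
  have h3 := h.pos
  have : 0 ≤ γ * (τ * ‖τ⁻¹ • (grad (U (n + 1 + 1)) - grad (U (n + 1)))‖ ^ 2) := by positivity
  refine le_trans ?_ h2
  exact le_of_sq_le_sq (by linarith) (norm_nonneg _)

lemma antitone (h : IsFlowData Φ τ U l m) (hΦ : IsStrongEnergy γ Φ) (hγ : 0 ≤ γ) : Antitone m :=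
  antitone_nat_of_succ_le (h.m_succ_le hΦ hγ)

lemma energy_sum (h : IsFlowData Φ τ U l m) (hΦ : IsStrongEnergy γ Φ) (hγ : 0 ≤ γ) (n k : ℕ) :
    (Φ (U (n + k))).toReal + ∑ i ∈ Finset.range k, τ * m (n + i) ^ 2 ≤ (Φ (U n)).toReal := by
  induction k with
  | zero => simp
  | succ k ih =>
    have h1 := h.energy_step hΦ (n + k)
    rw [Finset.sum_range_succ]
    have : 0 ≤ γ / 2 * ‖grad (U (n + k + 1)) - grad (U (n + k))‖ ^ 2 := by positivity
    rw [← add_assoc n k 1]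
    linarith

lemma energy_antitone (h : IsFlowData Φ τ U l m) (hΦ : IsStrongEnergy γ Φ) (hγ : 0 ≤ γ) :
    Antitone fun n => (Φ (U n)).toReal := by
  refine antitone_nat_of_succ_le fun n => ?_
  have h1 := h.energy_step hΦ n
  have h2 := h.pos
  have : 0 ≤ γ / 2 * ‖grad (U (n + 1)) - grad (U n)‖ ^ 2 := by positivity
  have : 0 ≤ τ * m n ^ 2 := by positivity
  linarith

/-- The speeds decrease, so `τ (m n)²` is the smallest of the first `n + 1` terms of the
dissipation, whose sum is at most the initial energy. -/
lemma m_sq_le (h : IsFlowData Φ τ U l m) (hΦ : IsStrongEnergy γ Φ) (hγ : 0 ≤ γ) (n : ℕ) :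
    ((n : ℝ) + 1) * τ * m n ^ 2 ≤ (Φ (U 0)).toReal := by
  have h1 := h.energy_sum hΦ hγ 0 (n + 1)
  have h2 : ∑ i ∈ Finset.range (n + 1), τ * m n ^ 2 ≤
      ∑ i ∈ Finset.range (n + 1), τ * m (0 + i) ^ 2 := by
    refine Finset.sum_le_sum fun i hi => ?_
    have := h.antitone hΦ hγ (show 0 + i ≤ n by have := Finset.mem_range.1 hi; omega)
    have := h.pos
    have := h.m_nonneg n
    gcongr
  simp only [Finset.sum_const, Finset.card_range, nsmul_eq_mul] at h2
  push_cast at h2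
  have := ENNReal.toReal_nonneg (a := Φ (U (0 + (n + 1))))
  linarith

/-- The total squared gradient of the velocity, from the step `n` on. -/
lemma tail_sum (h : IsFlowData Φ τ U l m) (hΦ : IsStrongEnergy γ Φ) {n : ℕ}
    {k : StrongDual ℝ (L1 Ω)} (hk : IsSubgrad Φ (U n) k) (N : ℕ) :
    1 / 2 * m (n + N) ^ 2 + ∑ i ∈ Finset.range (N + 1),
      γ * (τ * ‖τ⁻¹ • (grad (U (n + i + 1)) - grad (U (n + i)))‖ ^ 2) ≤ 1 / 2 * ‖k‖ ^ 2 := by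
  induction N with
  | zero => simpa using h.half_step hΦ hk
  | succ N ih =>
    rw [Finset.sum_range_succ]
    have h1 := h.half_step hΦ (h.sub (n + N))
    have h2 : ‖l (n + N)‖ ^ 2 ≤ m (n + N) ^ 2 := by
      have := h.bound (n + N); gcongr
    rw [← add_assoc n N 1]
    linarith

lemma tail_sum_le_norm (h : IsFlowData Φ τ U l m) (hΦ : IsStrongEnergy γ Φ) {n : ℕ}
    {k : StrongDual ℝ (L1 Ω)} (hk : IsSubgrad Φ (U n) k) (N : ℕ) :
    ∑ i ∈ Finset.range N,
      γ * (τ * ‖τ⁻¹ • (grad (U (n + i + 1)) - grad (U (n + i)))‖ ^ 2) ≤ 1 / 2 * ‖k‖ ^ 2 := by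
  cases N with
  | zero => simp
  | succ N =>
    have := h.tail_sum hΦ hk N
    have : 0 ≤ 1 / 2 * m (n + N) ^ 2 := by positivity
    linarith

lemma tail_sum_succ (h : IsFlowData Φ τ U l m) (hΦ : IsStrongEnergy γ Φ) (hγ : 0 ≤ γ) (n N : ℕ) :
    ∑ i ∈ Finset.range N,
      γ * (τ * ‖τ⁻¹ • (grad (U (n + 1 + i + 1)) - grad (U (n + 1 + i)))‖ ^ 2) ≤
        (Φ (U 0)).toReal / (2 * ((n + 1) * τ)) := by
  refine (h.tail_sum_le_norm hΦ (h.sub n) N).trans ?_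
  have h1 := h.m_sq_le hΦ hγ n
  have h2 : ‖l n‖ ^ 2 ≤ m n ^ 2 := by
    have := h.bound n; gcongr
  have h3 := h.pos
  rw [le_div_iff₀ (by positivity)]
  have h4 : 0 ≤ ((n : ℝ) + 1) * τ := by positivity
  have := mul_le_mul_of_nonneg_left h2 h4
  linarith

/-- Without a subgradient at `U 0`, the first increment is bounded by the energy it dissipates,
which costs `2 Φ / τ`; the later ones cost at most `Φ / τ`. -/
lemma tail_sum_zero (h : IsFlowData Φ τ U l m) (hΦ : IsStrongEnergy γ Φ) (hγ : 0 ≤ γ) (N : ℕ) :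
    ∑ i ∈ Finset.range N, γ * (τ * ‖τ⁻¹ • (grad (U (i + 1)) - grad (U i))‖ ^ 2) ≤
        3 * (Φ (U 0)).toReal / τ := by
  have hΦ0 := ENNReal.toReal_nonneg (a := Φ (U 0))
  have hτ := h.pos
  cases N with
  | zero => simp; positivity
  | succ N =>
    rw [Finset.sum_range_succ']
    have h1 := h.tail_sum_succ hΦ hγ 0 N
    have h2 : γ * (τ * ‖τ⁻¹ • (grad (U (0 + 1)) - grad (U 0))‖ ^ 2) ≤ 2 * (Φ (U 0)).toReal / τ := by
      rw [norm_smul, mul_pow, Real.norm_eq_abs, sq_abs, le_div_iff₀ hτ]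
      have h3 := h.energy_step hΦ 0
      have h4 : 0 ≤ τ * m 0 ^ 2 := by positivity
      have h5 := ENNReal.toReal_nonneg (a := Φ (U (0 + 1)))
      calc γ * (τ * (τ⁻¹ ^ 2 * ‖grad (U (0 + 1)) - grad (U 0)‖ ^ 2)) * τ
          = 2 * (γ / 2 * ‖grad (U (0 + 1)) - grad (U 0)‖ ^ 2) := by field_simp
        _ ≤ _ := by linarith
    have h3 : (Φ (U 0)).toReal / (2 * (((0 : ℕ) + 1 : ℝ) * τ)) ≤ (Φ (U 0)).toReal / τ := by
      refine div_le_div_of_nonneg_left hΦ0 hτ ?_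
      push_cast; linarith
    have e : ∀ i, 0 + 1 + i = i + 1 := fun i => by omega
    simp only [e] at h1
    have h4 : 3 * (Φ (U 0)).toReal / τ = 2 * (Φ (U 0)).toReal / τ + (Φ (U 0)).toReal / τ := by ring
    rw [h4]
    linarith

end IsFlowData

end Discrete

/-! ### Weak difference quotients. -/

section Sobolev

variable {d : ℕ} {Ω : Set (E d)}

lemma integral_mul_le_sqrt {α : Type*} [MeasurableSpace α] {μ : Measure α} {f g : α → ℝ}
    (hf : MemLp f 2 μ) (hg : MemLp g 2 μ) :
    ∫ x, |f x| * |g x| ∂μ ≤ √(∫ x, f x ^ 2 ∂μ) * √(∫ x, g x ^ 2 ∂μ) := by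
  have := integral_mul_norm_le_Lp_mul_Lq (μ := μ) (f := f) (g := g) (p := 2) (q := 2)
    Real.HolderConjugate.two_two (by simpa using hf) (by simpa using hg)
  simpa [Real.sqrt_eq_rpow] using this

/-- A function whose pairing with test functions is bounded in `L²` is square integrable. -/
lemma lintegral_sq_le_of_forall_test {A : Set (E d)} (hA : IsOpen A) {k : E d → ℝ}
    (hk : IntegrableOn k A) {C : ℝ} (hC : 0 ≤ C)
    (h : ∀ φ : E d → ℝ, IsTestFunction A φ → |∫ x in A, k x * φ x| ≤ C * √(∫ x in A, φ x ^ 2)) :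
    ∫⁻ x in A, ‖k x‖ₑ ^ 2 ≤ ENNReal.ofReal C ^ 2 := by
  have hint : ∀ φ : E d → ℝ, IsTestFunction A φ → IntegrableOn (fun x => k x * φ x) A :=
    fun φ hφ => by simpa [mul_comm] using hφ.integrable_smul hk
  have hmem : ∀ φ : E d → ℝ, IsTestFunction A φ → MemLp φ 2 (volume.restrict A) := fun φ hφ =>
    (hφ.continuous.memLp_of_hasCompactSupport hφ.2.1).restrict A
  -- The pairing with `k` is a bounded form on the classes of test functions in `L²`. A
  -- norm-preserving Hahn–Banach extension and the Riesz theorem give `k'` in `L²`, equal to `k` by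
  -- the fundamental lemma; density of test functions is not needed.
  let p : Submodule ℝ (Lp ℝ 2 (volume.restrict A)) :=
    { carrier := {f | ∃ φ, IsTestFunction A φ ∧ f =ᵐ[volume.restrict A] φ}
      add_mem' := by
        rintro f g ⟨φ, hφ, hf⟩ ⟨ψ, hψ, hg⟩
        refine ⟨_, hφ.add hψ, ?_⟩
        filter_upwards [Lp.coeFn_add f g, hf, hg] with x h1 h2 h3
        rw [h1, Pi.add_apply, h2, h3]
      zero_mem' := ⟨_, isTestFunction_zero A, Lp.coeFn_zero _ _ _⟩
      smul_mem' := by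
        rintro c f ⟨φ, hφ, hf⟩
        refine ⟨_, hφ.const_mul c, ?_⟩
        filter_upwards [Lp.coeFn_smul c f, hf] with x h1 h2
        rw [h1, Pi.smul_apply, h2, smul_eq_mul] }
  have hpint : ∀ f : p, IntegrableOn (fun x => k x * (f : Lp ℝ 2 (volume.restrict A)) x) A := by
    rintro ⟨f, φ, hφ, hf⟩
    refine (hint φ hφ).congr ?_
    filter_upwards [hf] with x hx
    rw [hx]
  let L₀ : p →ₗ[ℝ] ℝ :=
    { toFun := fun f => ∫ x in A, k x * (f : Lp ℝ 2 (volume.restrict A)) x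
      map_add' := fun f g => by
        rw [← integral_add (hpint f) (hpint g)]
        refine integral_congr_ae ?_
        filter_upwards [Lp.coeFn_add (f : Lp ℝ 2 (volume.restrict A)) g] with x hx
        rw [Submodule.coe_add, hx, Pi.add_apply, mul_add]
      map_smul' := fun c f => by
        rw [RingHom.id_apply, smul_eq_mul, ← integral_const_mul]
        refine integral_congr_ae ?_
        filter_upwards [Lp.coeFn_smul c (f : Lp ℝ 2 (volume.restrict A))] with x hx
        rw [Submodule.coe_smul, hx, Pi.smul_apply, smul_eq_mul]; ring }
  have hL₀ : ∀ f : p, ‖L₀ f‖ ≤ C * ‖f‖ := by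
    rintro ⟨f, φ, hφ, hf⟩
    have e1 : L₀ ⟨f, φ, hφ, hf⟩ = ∫ x in A, k x * φ x :=
      integral_congr_ae (by filter_upwards [hf] with x hx; simp only [hx])
    have e2 : ‖f‖ = √(∫ x in A, φ x ^ 2) := by
      rw [eq_comm, Real.sqrt_eq_iff_mul_self_eq (integral_nonneg fun _ => sq_nonneg _) (norm_nonneg _), ← pow_two,
        ← real_inner_self_eq_norm_sq, L2.inner_def]
      refine integral_congr_ae ?_
      filter_upwards [hf] with x hx
      simp [hx, pow_two]
    rw [e1, Submodule.coe_norm, e2]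
    exact h φ hφ
  obtain ⟨g, hg, hgn⟩ := exists_extension_norm_eq p (L₀.mkContinuous C hL₀)
  set k' := (InnerProductSpace.toDual ℝ (Lp ℝ 2 (volume.restrict A))).symm g with hk'
  have hk'n : ‖k'‖ ≤ C := by
    rw [hk', LinearIsometryEquiv.norm_map, hgn]
    exact L₀.mkContinuous_norm_le hC hL₀
  have hae : k =ᵐ[volume.restrict A] k' := by
    have hloc : LocallyIntegrableOn k' A := by
      refine (locallyIntegrableOn_iff hA.isLocallyClosed).2 fun K hK hKc => ?_
      have : MemLp k' 2 (volume.restrict K) := (Lp.memLp k').mono_measure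
        (Measure.restrict_mono hK le_rfl)
      have : IsFiniteMeasure (volume.restrict K) := ⟨by simpa using hKc.measure_lt_top⟩
      exact ‹MemLp k' 2 (volume.restrict K)›.integrable (by norm_num)
    have := hA.ae_eq_zero_of_integral_contDiff_smul_eq_zero (μ := volume)
      (f := fun x => k x - k' x) (hk.locallyIntegrableOn.sub hloc) ?_
    · rw [EventuallyEq, ae_restrict_iff' hA.measurableSet]
      filter_upwards [this] with x hx hxA
      exact sub_eq_zero.1 (hx hxA)
    intro φ h1 h2 h3
    have hφ : IsTestFunction A φ := ⟨h1, h2, h3⟩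
    rw [← setIntegral_eq_integral_of_forall_compl_eq_zero (s := A)]
    · have e1 : inner ℝ k' ((hmem φ hφ).toLp φ) = g ((hmem φ hφ).toLp φ) :=
        InnerProductSpace.toDual_symm_apply
      have e2 := hg ⟨(hmem φ hφ).toLp φ, φ, hφ, (hmem φ hφ).coeFn_toLp⟩
      change g ((hmem φ hφ).toLp φ) = ∫ x in A, k x * ((hmem φ hφ).toLp φ) x at e2
      have e3 : ∫ x in A, k x * ((hmem φ hφ).toLp φ) x = ∫ x in A, k x * φ x :=
        integral_congr_ae (by filter_upwards [(hmem φ hφ).coeFn_toLp] with x hx; simp only [hx])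
      have e4 : ∫ x in A, inner ℝ (k' x) (((hmem φ hφ).toLp φ) x) = ∫ x in A, k' x * φ x :=
        integral_congr_ae (by
          filter_upwards [(hmem φ hφ).coeFn_toLp] with x hx; simp [hx, mul_comm])
      rw [L2.inner_def, e4, e2, e3] at e1
      have e5 : IntegrableOn (fun x => k' x * φ x) A := (Lp.memLp k').integrable_mul (hmem φ hφ)
      have e6 : ∫ x in A, φ x • (k x - k' x) = ∫ x in A, (k x * φ x - k' x * φ x) :=
        integral_congr_ae (ae_of_all _ fun x => by simp only [smul_eq_mul]; ring)
      rw [e6, integral_sub (hint φ hφ) e5, e1, sub_self]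
    · intro x hx
      have : φ x = 0 := image_eq_zero_of_notMem_tsupport fun h => hx (h3 h)
      simp [this]
  have e : ∫⁻ x in A, ‖k x‖ₑ ^ 2 = ‖k'‖ₑ ^ 2 := by
    rw [enorm_sq_eq_lintegral]
    refine lintegral_congr_ae ?_
    filter_upwards [hae] with x hx
    rw [hx]
  rw [e, ← ofReal_norm]
  gcongr

lemma IsTestFunction.comp_sub_const {A B : Set (E d)} {φ : E d → ℝ} (hφ : IsTestFunction A φ) (a : E d)
    (h : ∀ y ∈ A, y + a ∈ B) : IsTestFunction B (fun x => φ (x - a)) := by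
  refine ⟨hφ.1.comp (contDiff_id.sub contDiff_const), ?_, ?_⟩
  · exact hφ.2.1.comp_homeomorph (Homeomorph.subRight a)
  · intro x hx
    have h1 : tsupport (fun x => φ (x - a)) = (Homeomorph.subRight a) ⁻¹' tsupport φ :=
      tsupport_comp_eq_preimage φ (Homeomorph.subRight a)
    rw [h1] at hx
    have := h _ (hφ.2.2 hx)
    simpa using this

lemma gradient_comp_sub_const (φ : E d → ℝ) (a x : E d) :
    gradient (fun x => φ (x - a)) x = gradient φ (x - a) := by
  simp only [gradient]
  rw [fderiv_comp_sub]

/-- Difference quotients of a Sobolev function, in weak form. -/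
lemma abs_integral_translate_sub_le {A : Set (E d)} {h : E d}
    (hAΩ : ∀ y ∈ A, ∀ s ∈ Icc (0 : ℝ) 1, y + s • h ∈ Ω) {w : E d → ℝ} {G : E d → E d}
    (hw : IsW11Gradient Ω w G) (hG : MemLp G 2 (volume.restrict Ω)) {φ : E d → ℝ}
    (hφ : IsTestFunction A φ) :
    |∫ y in A, (w (y + h) - w y) * φ y| ≤
      ‖h‖ * √(∫ x in Ω, ‖G x‖ ^ 2) * √(∫ x in A, φ x ^ 2) := by
  set C : ℝ := ‖h‖ * √(∫ x in Ω, ‖G x‖ ^ 2) * √(∫ x in A, φ x ^ 2) with hC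
  have hw' := (isW11Gradient_iff.1 hw).2.2
  have htest : ∀ s ∈ Icc (0 : ℝ) 1, IsTestFunction Ω (fun x => φ (x - s • h)) := fun s hs =>
    hφ.comp_sub_const _ fun y hy => hAΩ y hy s hs
  have hφA : ∀ y ∉ A, φ y = 0 := fun y hy =>
    image_eq_zero_of_notMem_tsupport fun hh => hy (hφ.2.2 hh)
  -- The translation is moved onto the smooth factor. The derivative of `I` is then, by definition
  -- of the weak gradient, a pairing of `G` with a translate of `φ`, and the mean value inequality
  -- bounds `I 1 - I 0`.
  set I : ℝ → ℝ := fun s => ∫ x in Ω, w x * φ (x - s • h) with hI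
  set I' : ℝ → ℝ := fun s => ∫ x in Ω, w x * fderiv ℝ φ (x - s • h) (-h) with hI'
  have hcf : Continuous (fderiv ℝ φ) := hφ.1.continuous_fderiv (by simp)
  obtain ⟨B, hB⟩ := hφ.exists_bound
  obtain ⟨B', hB'⟩ := (hφ.2.1.fderiv (𝕜 := ℝ)).exists_bound_of_continuous hcf
  have hder : ∀ s, HasDerivAt I (I' s) s := fun s => by
    refine (hasDerivAt_integral_of_dominated_loc_of_deriv_le (μ := volume.restrict Ω)
      (F := fun s x => w x * φ (x - s • h)) (F' := fun s x => w x * fderiv ℝ φ (x - s • h) (-h))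
      (bound := fun x => ‖w x‖ * (B' * ‖h‖)) (s := univ) univ_mem ?_ ?_ ?_ ?_ ?_ ?_).2
    · exact Eventually.of_forall fun s => hw.1.aestronglyMeasurable.mul
        (hφ.continuous.comp (by fun_prop)).aestronglyMeasurable
    · refine Integrable.mul_bdd (c := B) hw.1 (hφ.continuous.comp (by fun_prop)).aestronglyMeasurable
        (ae_of_all _ fun x => hB _)
    · exact hw.1.aestronglyMeasurable.mul
        (((hcf.comp (by fun_prop : Continuous fun x : E d => x - s • h)).clm_apply
          continuous_const).aestronglyMeasurable)
    · refine ae_of_all _ fun x s _ => ?_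
      rw [norm_mul]
      gcongr
      refine (ContinuousLinearMap.le_opNorm _ _).trans ?_
      rw [norm_neg]
      gcongr
      exact hB' _
    · exact hw.1.norm.mul_const _
    · refine ae_of_all _ fun x s _ => ?_
      have h1 : HasDerivAt (fun s : ℝ => x - s • h) (-h) s := by
        simpa using ((hasDerivAt_id s).smul_const h).const_sub x
      exact ((hφ.differentiable _).hasFDerivAt.comp_hasDerivAt s h1).const_mul (w x)
  have hbound : ∀ s ∈ Icc (0 : ℝ) 1, ‖I' s‖ ≤ C := fun s hs => by
    have hφs := htest s hs
    have e1 : I' s = inner ℝ (∫ x in Ω, φ (x - s • h) • G x) h := by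
      have := hw' _ hφs
      rw [eq_neg_iff_add_eq_zero, add_comm, ← eq_neg_iff_add_eq_zero] at this
      rw [this, inner_neg_left, real_inner_comm, ← integral_inner (hφs.integrable_smul_gradient hw.1),
        hI', ← integral_neg]
      refine integral_congr_ae (ae_of_all _ fun x => ?_)
      simp only [inner_smul_right, gradient_comp_sub_const, map_neg]
      rw [real_inner_comm, inner_gradient]; ring
    have hφ2 : MemLp (fun x => φ (x - s • h)) 2 (volume.restrict Ω) :=
      (hφs.continuous.memLp_of_hasCompactSupport hφs.2.1).restrict Ω
    rw [e1]
    calc ‖inner ℝ (∫ x in Ω, φ (x - s • h) • G x) h‖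
        ≤ ‖∫ x in Ω, φ (x - s • h) • G x‖ * ‖h‖ := norm_inner_le_norm _ _
      _ ≤ (∫ x in Ω, |φ (x - s • h)| * |‖G x‖|) * ‖h‖ := by
          gcongr
          refine (norm_integral_le_integral_norm _).trans (le_of_eq ?_)
          refine integral_congr_ae (ae_of_all _ fun x => ?_)
          simp [norm_smul]
      _ ≤ (√(∫ x in Ω, φ (x - s • h) ^ 2) * √(∫ x in Ω, ‖G x‖ ^ 2)) * ‖h‖ := by
          gcongr
          exact integral_mul_le_sqrt hφ2 hG.norm
      _ ≤ (√(∫ x in A, φ x ^ 2) * √(∫ x in Ω, ‖G x‖ ^ 2)) * ‖h‖ := by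
          gcongr
          have e2 : ∫ x in A, φ x ^ 2 = ∫ x, φ x ^ 2 :=
            setIntegral_eq_integral_of_forall_compl_eq_zero fun x hx => by simp [hφA x hx]
          have e3 : ∫ x, φ x ^ 2 = ∫ x, φ (x - s • h) ^ 2 :=
            (integral_sub_right_eq_self (fun x => φ x ^ 2) (s • h)).symm
          rw [e2, e3]
          refine setIntegral_le_integral ?_ (ae_of_all _ fun x => sq_nonneg _)
          have h3 : MemLp (fun x => φ (x - s • h)) 2 volume :=
            hφs.continuous.memLp_of_hasCompactSupport hφs.2.1
          exact h3.integrable_sq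
      _ = C := by rw [hC]; ring
  have hmv := norm_image_sub_le_of_norm_deriv_le_segment_01' (f := I) (f' := I') (C := C)
    (fun s _ => (hder s).hasDerivWithinAt) (fun s hs => hbound s ⟨hs.1, hs.2.le⟩)
  have e1 : I 1 = ∫ y in A, w (y + h) * φ y := by
    have h1 := htest 1 (by simp)
    rw [hI]
    simp only [one_smul] at h1 ⊢
    rw [setIntegral_eq_integral_of_forall_compl_eq_zero (fun x hx => by
        have : φ (x - h) = 0 := image_eq_zero_of_notMem_tsupport (f := fun x => φ (x - h))
          fun hh => hx (h1.2.2 hh)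
        simp [this]),
      setIntegral_eq_integral_of_forall_compl_eq_zero (fun x hx => by simp [hφA x hx]),
      ← integral_add_right_eq_self _ h]
    simp
  have hAsub : A ⊆ Ω := fun y hy => by simpa using hAΩ y hy 0 (by simp)
  have e0 : I 0 = ∫ y in A, w y * φ y := by
    rw [hI]
    simp only [zero_smul, sub_zero]
    rw [setIntegral_eq_integral_of_forall_compl_eq_zero (s := A) (fun x hx => by simp [hφA x hx]),
      setIntegral_eq_integral_of_forall_compl_eq_zero (fun x hx => by
        simp [hφA x (fun hh => hx (hAsub hh))])]
  have i0 : IntegrableOn (fun y => w y * φ y) A :=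
    Integrable.mul_bdd (c := B) (hw.1.mono_set hAsub) hφ.continuous.aestronglyMeasurable
      (ae_of_all _ hB)
  have i1 : IntegrableOn (fun y => w (y + h) * φ y) A := by
    have h1 : IntegrableOn (fun x => w x * φ (x - h)) Ω :=
      Integrable.mul_bdd (c := B) hw.1 (hφ.continuous.comp (by fun_prop)).aestronglyMeasurable
        (ae_of_all _ fun x => hB _)
    have h2 : IntegrableOn (fun y => w (y + h) * φ y) ((fun y => y + h) ⁻¹' Ω) := by
      have := (measurePreserving_add_right (volume : Measure (E d)) h).integrableOn_comp_preimage
        (Homeomorph.addRight h).measurableEmbedding (f := fun x => w x * φ (x - h)) (s := Ω)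
      simpa [Function.comp_def] using this.2 h1
    exact h2.mono_set fun y hy => by simpa using hAΩ y hy 1 (by simp)
  have e2 : ∫ y in A, (w (y + h) - w y) * φ y = I 1 - I 0 := by
    rw [e0, e1, ← integral_sub i1 i0]
    simp only [sub_mul]
  rw [e2]
  exact hmv

end Sobolev

/-! ### Square integrability on bounded Lipschitz domains. -/

section Embedding

variable {d : ℕ} {Ω : Set (E d)}

lemma integral_norm_sq_eq (G : L2V Ω) : ∫ x in Ω, ‖G x‖ ^ 2 = ‖G‖ ^ 2 := by
  rw [← real_inner_self_eq_norm_sq, L2.inner_def]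
  simp

/-- Difference quotients of a Sobolev function. -/
lemma lintegral_translate_sub_le {A : Set (E d)} (hA : IsOpen A) {h : E d}
    (hAΩ : ∀ y ∈ A, ∀ s ∈ Icc (0 : ℝ) 1, y + s • h ∈ Ω) {w : L1 Ω} {G : L2V Ω}
    (hw : HasGrad w G) :
    ∫⁻ y in A, ‖w (y + h) - w y‖ₑ ^ 2 ≤ ENNReal.ofReal (‖h‖ * ‖G‖) ^ 2 := by
  have hAsub : A ⊆ Ω := fun y hy => by simpa using hAΩ y hy 0 (by simp)
  refine lintegral_sq_le_of_forall_test hA ?_ (by positivity) fun φ hφ => ?_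
  · refine Integrable.sub ?_ (hw.1.mono_set hAsub)
    have h2 : IntegrableOn (fun y => w (y + h)) ((fun y => y + h) ⁻¹' Ω) := by
      have := (measurePreserving_add_right (volume : Measure (E d)) h).integrableOn_comp_preimage
        (Homeomorph.addRight h).measurableEmbedding (f := w) (s := Ω)
      exact this.2 hw.1
    exact h2.mono_set fun y hy => by simpa using hAΩ y hy 1 (by simp)
  · have := abs_integral_translate_sub_le hAΩ hw (Lp.memLp G) hφ
    rwa [integral_norm_sq_eq, Real.sqrt_sq (norm_nonneg _)] at this

lemma sq_lintegral_le {α : Type*} [MeasurableSpace α] {μ : Measure α} {f : α → ℝ≥0∞}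
    (hf : AEMeasurable f μ) : (∫⁻ x, f x ∂μ) ^ 2 ≤ μ univ * ∫⁻ x, f x ^ 2 ∂μ := by
  have := ENNReal.lintegral_mul_le_Lp_mul_Lq μ Real.HolderConjugate.two_two hf
    (aemeasurable_const (b := (1 : ℝ≥0∞)))
  have h2 := pow_le_pow_left' this 2
  simp only [Pi.mul_apply, mul_one, ENNReal.one_rpow, lintegral_const, one_mul, mul_pow] at h2
  refine h2.trans (le_of_eq ?_)
  rw [← ENNReal.rpow_natCast, ← ENNReal.rpow_natCast, ← ENNReal.rpow_mul, ← ENNReal.rpow_mul,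
    mul_comm]
  norm_num

lemma ennreal_add_sq_le (a b : ℝ≥0∞) : (a + b) ^ 2 ≤ 2 * a ^ 2 + 2 * b ^ 2 := by
  have := ENNReal.rpow_add_le_mul_rpow_add_rpow a b (p := 2) (by norm_num)
  norm_num at this
  simpa [mul_add] using this

/-- The `L²` estimate on a part `A` of `Ω` from which a ball of directions stays in `Ω`. -/
lemma lintegral_sq_le_local {A : Set (E d)} (hA : IsOpen A) {h₀ : E d} {ε : ℝ} (hε : 0 < ε)
    (hAΩ : ∀ y ∈ A, ∀ h ∈ Metric.ball h₀ ε, ∀ s ∈ Icc (0 : ℝ) 1, y + s • h ∈ Ω)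
    (hAfin : volume A ≠ ⊤) :
    ∃ C : ℝ≥0∞, C ≠ ⊤ ∧ ∀ (w : L1 Ω) (G : L2V Ω), HasGrad w G →
      ∫⁻ x in A, ‖w x‖ₑ ^ 2 ≤ C * (‖G‖ₑ ^ 2 + ‖w‖ₑ ^ 2) := by
  set B := Metric.ball h₀ ε with hB
  set R : ℝ≥0∞ := ENNReal.ofReal (‖h₀‖ + ε) with hR
  have hb0 : volume B ≠ 0 := (Metric.measure_ball_pos volume h₀ hε).ne'
  have hbt : volume B ≠ ⊤ := measure_ball_lt_top.ne
  set b := volume B with hb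
  refine ⟨(b ^ 2)⁻¹ * (2 * b * b * R ^ 2 + 2 * volume A), ?_, fun w G hw => ?_⟩
  · have : b ^ 2 ≠ 0 := by simpa using hb0
    finiteness
  have hwm : Measurable w := (Lp.stronglyMeasurable w).measurable
  have hWe : ∫⁻ x in Ω, ‖w x‖ₑ = ‖w‖ₑ := by
    rw [Lp.enorm_def, eLpNorm_one_eq_lintegral_enorm]
  have hm2 : Measurable fun p : E d × E d => ‖w (p.1 + p.2) - w p.1‖ₑ :=
    ((hwm.comp (measurable_fst.add measurable_snd)).sub (hwm.comp measurable_fst)).enorm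
  -- Averaging `w y = -(w (y + h) - w y) + w (y + h)` over the ball of directions: the second term
  -- contributes at most `‖w‖₁` because `y + h` stays in `Ω`, and the first is squared by
  -- Cauchy–Schwarz, to be integrated in `y` for fixed `h`.
  have hpt : ∀ y ∈ A, b ^ 2 * ‖w y‖ₑ ^ 2 ≤
      2 * b * (∫⁻ h in B, ‖w (y + h) - w y‖ₑ ^ 2) + 2 * ‖w‖ₑ ^ 2 := fun y hy => by
    have h1 : b * ‖w y‖ₑ ≤ (∫⁻ h in B, ‖w (y + h) - w y‖ₑ) + ‖w‖ₑ := by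
      calc b * ‖w y‖ₑ = ∫⁻ h in B, ‖w y‖ₑ := by rw [setLIntegral_const, mul_comm]
        _ ≤ ∫⁻ h in B, (‖w (y + h) - w y‖ₑ + ‖w (y + h)‖ₑ) := by
            refine lintegral_mono fun h => ?_
            have : w y = -(w (y + h) - w y) + w (y + h) := by ring
            conv_lhs => rw [this]
            refine (enorm_add_le _ _).trans ?_
            rw [enorm_neg]
        _ = (∫⁻ h in B, ‖w (y + h) - w y‖ₑ) + ∫⁻ h in B, ‖w (y + h)‖ₑ :=
            lintegral_add_left (hm2.comp measurable_prodMk_left) _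
        _ ≤ _ := by
            gcongr
            rw [← hWe]
            calc ∫⁻ h in B, ‖w (y + h)‖ₑ ≤ ∫⁻ h in (fun h => y + h) ⁻¹' Ω, ‖w (y + h)‖ₑ := by
                  refine lintegral_mono_set fun h hh => ?_
                  simpa using hAΩ y hy h hh 1 (by simp)
              _ = ∫⁻ x in Ω, ‖w x‖ₑ :=
                  (measurePreserving_add_left (volume : Measure (E d)) y).setLIntegral_comp_preimage_emb
                    (Homeomorph.addLeft y).measurableEmbedding (fun x => ‖w x‖ₑ) Ω
    calc b ^ 2 * ‖w y‖ₑ ^ 2 = (b * ‖w y‖ₑ) ^ 2 := by ring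
      _ ≤ ((∫⁻ h in B, ‖w (y + h) - w y‖ₑ) + ‖w‖ₑ) ^ 2 := by gcongr
      _ ≤ 2 * (∫⁻ h in B, ‖w (y + h) - w y‖ₑ) ^ 2 + 2 * ‖w‖ₑ ^ 2 := ennreal_add_sq_le _ _
      _ ≤ 2 * (b * ∫⁻ h in B, ‖w (y + h) - w y‖ₑ ^ 2) + 2 * ‖w‖ₑ ^ 2 := by
          gcongr
          refine (sq_lintegral_le ((hm2.comp measurable_prodMk_left).aemeasurable)).trans ?_
          rw [Measure.restrict_apply_univ]
          exact le_rfl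
      _ = _ := by rw [mul_assoc]
  have hmain : b ^ 2 * ∫⁻ y in A, ‖w y‖ₑ ^ 2 ≤
      (2 * b * b * R ^ 2 + 2 * volume A) * (‖G‖ₑ ^ 2 + ‖w‖ₑ ^ 2) := by
    have hm3 : Measurable fun y => ∫⁻ h in B, ‖w (y + h) - w y‖ₑ ^ 2 :=
      (hm2.pow_const 2).lintegral_prod_right'
    calc b ^ 2 * ∫⁻ y in A, ‖w y‖ₑ ^ 2 = ∫⁻ y in A, b ^ 2 * ‖w y‖ₑ ^ 2 :=
          (lintegral_const_mul' _ _ (by finiteness)).symm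
      _ ≤ ∫⁻ y in A, (2 * b * (∫⁻ h in B, ‖w (y + h) - w y‖ₑ ^ 2) + 2 * ‖w‖ₑ ^ 2) :=
          setLIntegral_mono' hA.measurableSet hpt
      _ = 2 * b * (∫⁻ y in A, ∫⁻ h in B, ‖w (y + h) - w y‖ₑ ^ 2) + 2 * ‖w‖ₑ ^ 2 * volume A := by
          rw [lintegral_add_left (hm3.const_mul _), lintegral_const_mul _ hm3, setLIntegral_const]
      _ = 2 * b * (∫⁻ h in B, ∫⁻ y in A, ‖w (y + h) - w y‖ₑ ^ 2) + 2 * ‖w‖ₑ ^ 2 * volume A := by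
          rw [lintegral_lintegral_swap ((hm2.pow_const 2).aemeasurable)]
      _ ≤ 2 * b * (∫⁻ h in B, R ^ 2 * ‖G‖ₑ ^ 2) + 2 * ‖w‖ₑ ^ 2 * volume A := by
          gcongr 2 * b * ?_ + _
          refine setLIntegral_mono' measurableSet_ball fun h hh => ?_
          refine (lintegral_translate_sub_le hA (fun y hy => hAΩ y hy h hh) hw).trans ?_
          rw [ENNReal.ofReal_mul (norm_nonneg _), mul_pow, ofReal_norm G]
          gcongr
          have h3 : ‖h - h₀‖ < ε := mem_ball_iff_norm.1 hh
          have := norm_le_norm_add_norm_sub' h h₀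
          exact ENNReal.ofReal_le_ofReal (by linarith)
      _ = 2 * b * b * R ^ 2 * ‖G‖ₑ ^ 2 + 2 * volume A * ‖w‖ₑ ^ 2 := by
          rw [setLIntegral_const]; ring
      _ ≤ _ := by
          rw [add_mul]
          gcongr
          · exact le_self_add
          · exact le_add_self
  calc ∫⁻ x in A, ‖w x‖ₑ ^ 2 = (b ^ 2)⁻¹ * (b ^ 2 * ∫⁻ y in A, ‖w y‖ₑ ^ 2) := by
        rw [← mul_assoc, ENNReal.inv_mul_cancel (by simpa using hb0) (by finiteness), one_mul]
    _ ≤ _ := by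
        rw [mul_assoc]
        gcongr

/-- At a boundary point, a displacement `s ((r / 4) ν + e)` raises the coordinate along `ν` by `s r
/ 4`, whereas `e` changes this coordinate and the graph function together by at most `s (K + 1)
‖e‖`. For small `e` the point remains above the graph. -/
lemma HasLipschitzBoundary.exists_directions (hΩ : IsOpen Ω) (h : HasLipschitzBoundary Ω) {x : E d}
    (hx : x ∈ closure Ω) :
    ∃ (r : ℝ) (h₀ : E d) (ε : ℝ), 0 < r ∧ 0 < ε ∧
      ∀ y ∈ Ω ∩ Metric.ball x r, ∀ h ∈ Metric.ball h₀ ε, ∀ s ∈ Icc (0 : ℝ) 1, y + s • h ∈ Ω := by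
  by_cases hxΩ : x ∈ Ω
  · obtain ⟨r, hr, hsub⟩ := Metric.isOpen_iff.1 hΩ x hxΩ
    refine ⟨r / 2, 0, r / 2, by positivity, by positivity, fun y hy h hh s hs => hsub ?_⟩
    have h1 : ‖y - x‖ < r / 2 := mem_ball_iff_norm.1 hy.2
    have h2 : ‖h‖ < r / 2 := by simpa [mem_ball_iff_norm] using hh
    rw [mem_ball_iff_norm]
    calc ‖y + s • h - x‖ = ‖(y - x) + s • h‖ := by congr 1; abel
      _ ≤ ‖y - x‖ + ‖s • h‖ := norm_add_le _ _
      _ ≤ ‖y - x‖ + 1 * ‖h‖ := by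
          rw [norm_smul, Real.norm_eq_abs, abs_of_nonneg hs.1]; gcongr; exact hs.2
      _ < r := by linarith
  · obtain ⟨ν, ψ, K, r, hν, hψ, hinv, hr, hepi⟩ := h x ⟨hx, by rwa [hΩ.interior_eq]⟩
    have hK : (0 : ℝ) ≤ K := K.2
    -- The first two constants and `‖e‖ < r / 4` keep the displaced points in the ball of radius `r`
    -- where `Ω` is an epigraph; the third ensures `(K + 1) ‖e‖ < r / 4`.
    refine ⟨r / 4, (r / 4) • ν, r / 4 / (K + 1), by positivity, by positivity,
      fun y hy h hh s hs => ?_⟩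
    set e := h - (r / 4) • ν with he
    have h1 : ‖y - x‖ < r / 4 := mem_ball_iff_norm.1 hy.2
    have h2 : ‖e‖ < r / 4 / (K + 1) := mem_ball_iff_norm.1 hh
    have h3 : ‖e‖ * (K + 1) < r / 4 := by rwa [lt_div_iff₀ (by positivity)] at h2
    have h3' : ‖e‖ < r / 4 := by nlinarith [norm_nonneg e]
    have hh : h = e + (r / 4) • ν := by rw [he]; abel
    have hball : y + s • h ∈ Metric.ball x r := by
      rw [mem_ball_iff_norm]
      calc ‖y + s • h - x‖ = ‖(y - x) + s • h‖ := by congr 1; abel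
        _ ≤ ‖y - x‖ + ‖s • h‖ := norm_add_le _ _
        _ ≤ ‖y - x‖ + 1 * ‖h‖ := by
            rw [norm_smul, Real.norm_eq_abs, abs_of_nonneg hs.1]; gcongr; exact hs.2
        _ ≤ ‖y - x‖ + 1 * (‖e‖ + r / 4) := by
            gcongr
            rw [hh]
            refine (norm_add_le _ _).trans ?_
            rw [norm_smul, hν, Real.norm_eq_abs, abs_of_nonneg (by positivity), mul_one]
        _ < r := by linarith
    rw [hepi _ hball]
    have hy2 : y ∈ Metric.ball x r := Metric.ball_subset_ball (by linarith) hy.2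
    have h4 := (hepi y hy2).1 hy.1
    have e1 : y + s • h = (y + s • e) + (s * (r / 4)) • ν := by rw [hh]; module
    rw [e1, hinv]
    have h5 : ψ (y + s • e) ≤ ψ y + K * (s * ‖e‖) := by
      have := hψ.dist_le_mul (y + s • e) y
      rw [Real.dist_eq, dist_eq_norm, add_sub_cancel_left, norm_smul, Real.norm_eq_abs,
        abs_of_nonneg hs.1] at this
      linarith [le_abs_self (ψ (y + s • e) - ψ y)]
    have h6 : -(s * ‖e‖) ≤ inner ℝ (s • e) ν := by
      have := abs_real_inner_le_norm (s • e) ν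
      rw [hν, mul_one, norm_smul, Real.norm_eq_abs, abs_of_nonneg hs.1] at this
      exact neg_le_of_abs_le this
    rw [inner_add_left, inner_add_left, real_inner_smul_left ν, real_inner_self_eq_norm_sq, hν]
    simp only [one_pow, mul_one]
    have h7 := mul_le_mul_of_nonneg_left h3.le hs.1
    linarith

/-- On a bounded Lipschitz domain, functions of `W^{1,1}` with square integrable gradient are
square integrable. -/
lemma exists_embedding_constant (hΩ : IsOpen Ω) (hb : Bornology.IsBounded Ω)
    (h : HasLipschitzBoundary Ω) :
    ∃ C : ℝ≥0∞, C ≠ ⊤ ∧ ∀ (w : L1 Ω) (G : L2V Ω), HasGrad w G →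
      ∫⁻ x in Ω, ‖w x‖ₑ ^ 2 ≤ C * (‖G‖ₑ ^ 2 + ‖w‖ₑ ^ 2) := by
  choose! r h₀ ε hr hε hdir using fun x (hx : x ∈ closure Ω) => h.exists_directions hΩ hx
  have hloc : ∀ x ∈ closure Ω, ∃ C : ℝ≥0∞, C ≠ ⊤ ∧ ∀ (w : L1 Ω) (G : L2V Ω), HasGrad w G →
      ∫⁻ x in Ω ∩ Metric.ball x (r x), ‖w x‖ₑ ^ 2 ≤ C * (‖G‖ₑ ^ 2 + ‖w‖ₑ ^ 2) := fun x hx =>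
    lintegral_sq_le_local (hΩ.inter Metric.isOpen_ball) (hε x hx) (hdir x hx)
      ((measure_mono inter_subset_left).trans_lt hb.measure_lt_top).ne
  choose! C hC hCw using hloc
  obtain ⟨t, ht, hcov⟩ := hb.isCompact_closure.elim_nhds_subcover (fun x => Metric.ball x (r x))
    fun x hx => Metric.ball_mem_nhds x (hr x hx)
  refine ⟨∑ x ∈ t, C x, by simpa [ENNReal.sum_eq_top] using fun x hx => hC x (ht x hx),
    fun w G hw => ?_⟩
  calc ∫⁻ x in Ω, ‖w x‖ₑ ^ 2 ≤ ∫⁻ x in ⋃ y ∈ t, Ω ∩ Metric.ball y (r y), ‖w x‖ₑ ^ 2 := by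
        refine lintegral_mono_set fun x hx => ?_
        have := hcov (subset_closure hx)
        simp only [mem_iUnion] at this ⊢
        obtain ⟨y, hy, hxy⟩ := this
        exact ⟨y, hy, hx, hxy⟩
    _ ≤ ∑ y ∈ t, ∫⁻ x in Ω ∩ Metric.ball y (r y), ‖w x‖ₑ ^ 2 := by
        classical
        clear hcov ht
        induction t using Finset.induction_on with
        | empty => simp
        | insert a t ha ih =>
          rw [Finset.set_biUnion_insert, Finset.sum_insert ha]
          refine (lintegral_union_le _ _ _).trans ?_
          gcongr
    _ ≤ ∑ y ∈ t, C y * (‖G‖ₑ ^ 2 + ‖w‖ₑ ^ 2) :=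
        Finset.sum_le_sum fun y hy => hCw y (ht y hy) w G hw
    _ = _ := (Finset.sum_mul _ _ _).symm

end Embedding

/-! ### The Euler–Lagrange equation of a subgradient. -/

section EulerLagrange

variable {d : ℕ} {Ω : Set (E d)} {F : E d → ℝ≥0∞} {𝒜 : Set (L1 Ω)}

lemma toReal_convexOn (hF_conv : ConvexOn ℝ≥0 univ F) (hfin : ∀ ξ, F ξ ≠ ⊤) :
    ConvexOn ℝ univ fun ξ => (F ξ).toReal := by
  refine ⟨convex_univ, fun x _ y _ a b ha hb hab => ?_⟩
  have e : a = 1 - b := by linarith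
  subst e
  exact (toReal_convex hF_conv (hfin x) (hfin y) hb (by linarith)).2

lemma tendsto_quotient_inner_gradient {f : E d → ℝ} (hd : Differentiable ℝ f) (a b : E d)
    {ε : ℕ → ℝ} (h0 : ∀ n, ε n ≠ 0) (hε : Tendsto ε atTop (𝓝 0)) :
    Tendsto (fun n => (f (a + ε n • (b - a)) - f a) / ε n) atTop
      (𝓝 (inner ℝ (gradient f a) (b - a))) := by
  have h1 : HasDerivAt (fun s : ℝ => f (a + s • (b - a))) (fderiv ℝ f a (b - a)) 0 := by
    have h2 : HasDerivAt (fun s : ℝ => a + s • (b - a)) (b - a) 0 := by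
      simpa using ((hasDerivAt_id (0 : ℝ)).smul_const (b - a)).const_add a
    have h3 : HasFDerivAt f (fderiv ℝ f a) (a + (0 : ℝ) • (b - a)) := by
      simpa using (hd a).hasFDerivAt
    exact h3.comp_hasDerivAt (0 : ℝ) h2
  rw [hasDerivAt_iff_tendsto_slope] at h1
  rw [inner_gradient]
  have h2 : Tendsto ε atTop (𝓝[≠] 0) :=
    tendsto_nhdsWithin_iff.2 ⟨hε, Eventually.of_forall h0⟩
  have := h1.comp h2
  refine this.congr fun n => ?_
  simp [slope_def_field]

/-- One-sided differentiation of a convex energy along the segment from `Du` to an admissible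
gradient. -/
lemma integrable_inner_gradient {α : Type*} [MeasurableSpace α] {μ : Measure α} {f : E d → ℝ}
    (hf : ConvexOn ℝ univ f) (hC1 : ContDiff ℝ 1 f) {a b : α → E d}
    (ha : AEStronglyMeasurable a μ) (hb : AEStronglyMeasurable b μ)
    (hfa : Integrable (fun x => f (a x)) μ) (hfb : Integrable (fun x => f (b x)) μ) {c : ℝ}
    (h0 : ∀ ε : ℝ, 0 < ε → ε < 1 → Integrable (fun x => f (a x + ε • (b x - a x))) μ ∧
      ε * c ≤ ∫ x, f (a x + ε • (b x - a x)) ∂μ - ∫ x, f (a x) ∂μ) :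
    Integrable (fun x => inner ℝ (gradient f (a x)) (b x - a x)) μ ∧
      c ≤ ∫ x, inner ℝ (gradient f (a x)) (b x - a x) ∂μ := by
  have hd : Differentiable ℝ f := hC1.differentiable (by simp)
  set ε : ℕ → ℝ := fun n => 1 / ((n : ℝ) + 2) with hε
  have hε0 : ∀ n, 0 < ε n := fun n => by positivity
  have hε1 : ∀ n, ε n < 1 := fun n => by
    rw [hε]; simp only
    rw [div_lt_one (by positivity)]
    linarith [(Nat.cast_nonneg n : (0 : ℝ) ≤ n)]
  have hεl : Tendsto ε atTop (𝓝 0) := by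
    have := (tendsto_add_atTop_iff_nat 1).2 (tendsto_one_div_add_atTop_nhds_zero_nat (𝕜 := ℝ))
    refine this.congr fun n => ?_
    rw [hε]; push_cast; ring
  set Z : α → ℝ := fun x => inner ℝ (gradient f (a x)) (b x - a x) with hZ
  have hZm : AEStronglyMeasurable Z μ :=
    ((continuous_gradient_of_contDiff hC1).comp_aestronglyMeasurable ha).inner (hb.sub ha)
  -- The difference quotients have no integrable bound from below. By convexity they stay below `f
  -- (b x) - f (a x)`, so `h n ≥ 0` and Fatou's lemma gives both the integrability of the limit and
  -- the inequality.
  set h : ℕ → α → ℝ := fun n x =>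
    f (b x) - f (a x) - (f (a x + ε n • (b x - a x)) - f (a x)) / ε n with hh
  have hpos : ∀ n x, 0 ≤ h n x := fun n x => by
    have h1 := hf.2 (mem_univ (a x)) (mem_univ (b x)) (sub_nonneg.2 (hε1 n).le) (hε0 n).le (by ring)
    have e : a x + ε n • (b x - a x) = (1 - ε n) • a x + ε n • b x := by module
    simp only [hh]
    rw [e, sub_nonneg, div_le_iff₀ (hε0 n)]
    simp only [smul_eq_mul] at h1
    linarith
  have hint : ∀ n, Integrable (h n) μ := fun n =>
    (hfb.sub hfa).sub (((h0 _ (hε0 n) (hε1 n)).1.sub hfa).div_const _)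
  set K : ℝ := ∫ x, f (b x) ∂μ - ∫ x, f (a x) ∂μ - c with hK
  have hKn : ∀ n, ∫ x, h n x ∂μ ≤ K := fun n => by
    obtain ⟨h1, h2⟩ := h0 _ (hε0 n) (hε1 n)
    have h3 : c ≤ (∫ x, f (a x + ε n • (b x - a x)) ∂μ - ∫ x, f (a x) ∂μ) / ε n := by
      rw [le_div_iff₀ (hε0 n)]; linarith
    have i1 : Integrable (fun x => f (b x) - f (a x)) μ := hfb.sub hfa
    have i2 : Integrable (fun x => (f (a x + ε n • (b x - a x)) - f (a x)) / ε n) μ :=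
      (h1.sub hfa).div_const _
    simp only [hh]
    rw [integral_sub i1 i2, integral_sub hfb hfa, integral_div, integral_sub h1 hfa, hK]
    linarith
  set h' : α → ℝ := fun x => f (b x) - f (a x) - Z x with hh'
  have hlim : ∀ x, Tendsto (fun n => h n x) atTop (𝓝 (h' x)) := fun x =>
    (tendsto_quotient_inner_gradient hd (a x) (b x) (fun n => (hε0 n).ne') hεl).const_sub _
  have hpos' : ∀ x, 0 ≤ h' x := fun x => ge_of_tendsto' (hlim x) fun n => hpos n x
  have hfat : ∫⁻ x, ENNReal.ofReal (h' x) ∂μ ≤ ENNReal.ofReal K := by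
    calc ∫⁻ x, ENNReal.ofReal (h' x) ∂μ
        = ∫⁻ x, liminf (fun n => ENNReal.ofReal (h n x)) atTop ∂μ := by
          refine lintegral_congr fun x => ?_
          exact (((ENNReal.continuous_ofReal.tendsto _).comp (hlim x)).liminf_eq).symm
      _ ≤ liminf (fun n => ∫⁻ x, ENNReal.ofReal (h n x) ∂μ) atTop :=
          lintegral_liminf_le' fun n => (hint n).aemeasurable.ennreal_ofReal
      _ ≤ ENNReal.ofReal K := by
          refine liminf_le_of_le (by isBoundedDefault) fun b hb => ?_
          obtain ⟨n, hn⟩ := hb.exists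
          refine hn.trans ?_
          rw [← ofReal_integral_eq_lintegral_ofReal (hint n) (ae_of_all _ (hpos n))]
          exact ENNReal.ofReal_le_ofReal (hKn n)
  have hK0 : 0 ≤ K := (integral_nonneg (hpos 0)).trans (hKn 0)
  have hm' : AEStronglyMeasurable h' μ :=
    (hfb.sub hfa).aestronglyMeasurable.sub hZm
  have hint' : Integrable h' μ := by
    refine ⟨hm', ?_⟩
    rw [hasFiniteIntegral_iff_ofReal (ae_of_all _ hpos')]
    exact hfat.trans_lt ENNReal.ofReal_lt_top
  have hle : ∫ x, h' x ∂μ ≤ K := by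
    rw [integral_eq_lintegral_of_nonneg_ae (ae_of_all _ hpos') hm']
    exact ENNReal.toReal_le_of_le_ofReal hK0 hfat
  have hZint : Integrable Z μ := by
    have := (hfb.sub hfa).sub hint'
    refine this.congr (ae_of_all _ fun x => ?_)
    simp [hh']
  refine ⟨hZint, ?_⟩
  have i1 : Integrable (fun x => f (b x) - f (a x)) μ := hfb.sub hfa
  rw [hh', integral_sub i1 hZint, integral_sub hfb hfa, hK] at hle
  linarith

/-- A vector field whose pairing with the gradient of every test function is integrable is locally
integrable. -/
lemma locallyIntegrableOn_of_forall_inner_gradient (hΩ : IsOpen Ω) {Z : E d → E d}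
    (h : ∀ φ : E d → ℝ, IsTestFunction Ω φ → IntegrableOn (fun x => inner ℝ (Z x) (gradient φ x)) Ω) :
    LocallyIntegrableOn Z Ω := by
  intro x₀ hx₀
  obtain ⟨r, hr, hsub⟩ := Metric.isOpen_iff.1 hΩ x₀ hx₀
  let χ : ContDiffBump x₀ := ⟨r / 4, r / 2, by positivity, by linarith⟩
  -- These test functions have the constant gradient `v` on a smaller ball, which isolates each
  -- component of `Z` there.
  have hφ : ∀ v : E d, IsTestFunction Ω fun x => χ x * inner ℝ v x := fun v => by
    refine ⟨χ.contDiff.mul (contDiff_const.inner ℝ contDiff_id), χ.hasCompactSupport.mul_right, ?_⟩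
    refine (tsupport_mul_subset_left).trans ?_
    rw [χ.tsupport_eq]
    exact (Metric.closedBall_subset_ball (by change r / 2 < r; linarith)).trans hsub
  have hgrad : ∀ v : E d, ∀ x ∈ Metric.ball x₀ (r / 4),
      gradient (fun x => χ x * inner ℝ v x) x = v := fun v x hx => by
    have : (fun x => χ x * inner ℝ v x) =ᶠ[𝓝 x] fun x => inner ℝ v x := by
      filter_upwards [Metric.isOpen_ball.mem_nhds hx] with y hy
      rw [χ.one_of_mem_closedBall (Metric.ball_subset_closedBall hy), one_mul]
    rw [gradient, this.fderiv_eq]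
    have e : (fun x : E d => inner ℝ v x) = InnerProductSpace.toDual ℝ (E d) v := by ext; simp
    rw [e, ContinuousLinearMap.fderiv]
    simp
  have hcomp : ∀ v : E d, IntegrableOn (fun x => inner ℝ (Z x) v) (Ω ∩ Metric.ball x₀ (r / 4)) :=
    fun v => by
      refine ((h _ (hφ v)).mono_set inter_subset_left).congr_fun (fun x hx => ?_)
        (hΩ.inter Metric.isOpen_ball).measurableSet
      simp only [hgrad v x hx.2]
  refine ⟨Ω ∩ Metric.ball x₀ (r / 4), inter_mem self_mem_nhdsWithin
    (mem_nhdsWithin_of_mem_nhds (Metric.ball_mem_nhds _ (by positivity))), ?_⟩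
  let e := EuclideanSpace.basisFun (Fin d) ℝ
  have hsum : Z = fun x => ∑ i, (inner ℝ (Z x) (e i)) • e i := by
    ext1 x
    conv_lhs => rw [← e.sum_repr' (Z x)]
    refine Finset.sum_congr rfl fun i _ => ?_
    rw [real_inner_comm]
  rw [hsum]
  exact integrable_finsetSum _ fun i _ => (hcomp (e i)).smul_const _

/-- The Euler–Lagrange equation satisfied by the subgradients of the energy. -/
lemma isWeakDivergence_of_isSubgrad [IsFiniteMeasure (volume.restrict Ω)] (hΩ : IsOpen Ω)
    (hF_zero : F 0 = 0) (hF_conv : ConvexOn ℝ≥0 univ F) {γ : ℝ} (hγ : 0 < γ)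
    (hF : IsGammaConvex γ F) (hA : IsAdmissibleConstraint F 𝒜) (hfin : ∀ ξ, F ξ ≠ ⊤)
    (hC1 : ContDiff ℝ 1 fun ξ => (F ξ).toReal) {u : L1 Ω} {q : LInf Ω}
    (hq : IsSubgrad (constrainedEnergy F 𝒜) u (pairing q)) :
    IsWeakDivergence Ω (fun x => gradient (fun ξ => (F ξ).toReal) (grad u x)) (fun x => -q x) := by
  set f : E d → ℝ := fun ξ => (F ξ).toReal with hf
  have hFf : ∀ ξ, F ξ = ENNReal.ofReal (f ξ) := fun ξ => (ENNReal.ofReal_toReal (hfin ξ)).symm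
  have hf0 : ∀ ξ, 0 ≤ f ξ := fun ξ => ENNReal.toReal_nonneg
  have hfc : Continuous f := hC1.continuous
  have hconv := toReal_convexOn hF_conv hfin
  obtain ⟨hgu, huA, heu⟩ := constrainedEnergy_lt_top hΩ hF_zero hγ hF hq.1
  obtain ⟨g, Gg, hg, ⟨θ, hθ, hθint⟩, hgA⟩ := hA.datum
  have hint_of : ∀ {a : E d → E d}, AEStronglyMeasurable a (volume.restrict Ω) →
      ∫⁻ x in Ω, F (a x) < ⊤ → IntegrableOn (fun x => f (a x)) Ω ∧
        ∫ x in Ω, f (a x) = (∫⁻ x in Ω, F (a x)).toReal := fun {a} ha hlt => by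
    have hm : AEStronglyMeasurable (fun x => f (a x)) (volume.restrict Ω) :=
      hfc.comp_aestronglyMeasurable ha
    simp only [hFf] at hlt ⊢
    exact ⟨⟨hm, by rwa [hasFiniteIntegral_iff_ofReal (ae_of_all _ fun x => hf0 _)]⟩,
      integral_eq_lintegral_of_nonneg_ae (ae_of_all _ fun x => hf0 _) hm⟩
  obtain ⟨hfa, hfa'⟩ := hint_of hgu.2.1.aestronglyMeasurable (heu ▸ hq.1)
  set a : E d → E d := fun x => grad u x with ha
  have hgI := isW11Gradient_iff.1 hg
  -- the variational inequality
  have hvar : ∀ φ : E d → ℝ, IsTestFunction Ω φ →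
      IntegrableOn (fun x => inner ℝ (gradient f (a x)) (Gg x + gradient φ x - a x)) Ω ∧
      ∫ x in Ω, q x * (g x + φ x - u x) ≤
        ∫ x in Ω, inner ℝ (gradient f (a x)) (Gg x + gradient φ x - a x) := fun φ hφ => by
    have hw := hg.add hφ.isW11Gradient
    set w : L1 Ω := hw.1.toL1 _ with hwdef
    have hwae : w =ᵐ[volume.restrict Ω] fun x => g x + φ x := hw.1.coeFn_toL1
    have hwA : w ∈ 𝒜 := hgA φ w hφ hwae
    have hwG : IsW11Gradient Ω w (fun x => Gg x + gradient φ x) :=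
      hw.congr hwae.symm (EventuallyEq.refl _ _)
    -- Without an upper growth bound on `F`, `u + φ` may have infinite energy; the competitor is
    -- therefore `g + φ`. Its gradient is the convex combination `(1 / θ) (θ Dg) + (1 - 1 / θ) ((1 -
    -- 1 / θ)⁻¹ Dφ)`, whose second part has bounded energy density: this is the role of `θ > 1`.
    have hblt : ∫⁻ x in Ω, F (Gg x + gradient φ x) < ⊤ := by
      obtain ⟨B, hB⟩ := (hφ.hasCompactSupport_gradient.comp_left
        (g := fun v : E d => f ((1 - 1 / θ)⁻¹ • v)) (by simp [hf, hF_zero])).exists_bound_of_continuous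
        ((hfc.comp (continuous_const_smul _)).comp hφ.continuous_gradient)
      have hθ0 : (0 : ℝ) < 1 - 1 / θ := by
        rw [sub_pos, div_lt_one (by linarith)]; exact hθ
      have hpt : ∀ x, F (Gg x + gradient φ x) ≤ F (θ • Gg x) + ENNReal.ofReal B := fun x => by
        have h1 := hconv.2 (mem_univ (θ • Gg x)) (mem_univ ((1 - 1 / θ)⁻¹ • gradient φ x))
          (by positivity : 0 ≤ 1 / θ) hθ0.le (by ring)
        rw [smul_smul, smul_smul, mul_inv_cancel₀ hθ0.ne', one_div_mul_cancel (by linarith),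
          one_smul, one_smul] at h1
        rw [hFf, hFf (θ • Gg x), ← ENNReal.ofReal_add (hf0 _) ((norm_nonneg _).trans (hB x))]
        refine ENNReal.ofReal_le_ofReal (h1.trans ?_)
        have h2 := (le_abs_self _).trans (hB x)
        simp only [Function.comp_apply] at h2
        have h3 : 1 / θ ≤ 1 := by linarith
        have h4 := hf0 (θ • Gg x)
        have h5 := hf0 ((1 - 1 / θ)⁻¹ • gradient φ x)
        have h6 : 0 ≤ 1 / θ := by positivity
        simp only [smul_eq_mul]
        change 1 / θ * f (θ • Gg x) + (1 - 1 / θ) * f ((1 - 1 / θ)⁻¹ • gradient φ x) ≤ f (θ • Gg x) + B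
        nlinarith
      refine (lintegral_mono hpt).trans_lt ?_
      rw [lintegral_add_right _ measurable_const]
      refine ENNReal.add_lt_top.2 ⟨hθint, ?_⟩
      rw [lintegral_const]
      exact ENNReal.mul_lt_top ENNReal.ofReal_lt_top (measure_lt_top _ _)
    have hbm : AEStronglyMeasurable (fun x => Gg x + gradient φ x) (volume.restrict Ω) :=
      hwG.2.1.aestronglyMeasurable
    obtain ⟨hfb, -⟩ := hint_of hbm hblt
    have hwΦ : constrainedEnergy F 𝒜 w < ⊤ := by
      rwa [constrainedEnergy_eq hΩ hwG hwA]
    have e0 : ∫ x in Ω, q x * (g x + φ x - u x) = pairing q (w - u) := by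
      rw [pairing_apply]
      refine integral_congr_ae ?_
      filter_upwards [hwae, Lp.coeFn_sub w u] with x h1 h2
      rw [h2, Pi.sub_apply, h1]
    rw [e0]
    refine integrable_inner_gradient hconv hC1 hgu.2.1.aestronglyMeasurable hbm hfa hfb
      fun ε h0 h1 => ?_
    have hsegA : (1 - ε) • u + ε • w ∈ 𝒜 := hA.convex huA hwA (by linarith) h0.le (by ring)
    have hsegG : IsW11Gradient Ω ((1 - ε) • u + ε • w : L1 Ω)
        (fun x => a x + ε • (Gg x + gradient φ x - a x)) := by
      refine ((hgu.const_smul (1 - ε)).add (hwG.const_smul ε)).congr ?_ (ae_of_all _ fun x => ?_)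
      · filter_upwards [Lp.coeFn_add ((1 - ε) • u) (ε • w), Lp.coeFn_smul (1 - ε) u,
          Lp.coeFn_smul ε w] with x h1 h2 h3
        rw [h1, Pi.add_apply, h2, h3]; rfl
      · simp only [ha]; module
    have hseg_eq := constrainedEnergy_eq (F := F) hΩ hsegG hsegA
    have hseglt : ∫⁻ x in Ω, F (a x + ε • (Gg x + gradient φ x - a x)) < ⊤ := by
      have hpt : ∀ x, F (a x + ε • (Gg x + gradient φ x - a x)) ≤
          F (a x) + F (Gg x + gradient φ x) := fun x => by
        have h2 := hconv.2 (mem_univ (a x)) (mem_univ (Gg x + gradient φ x))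
          (sub_nonneg.2 h1.le) h0.le (by ring)
        have e : a x + ε • (Gg x + gradient φ x - a x) =
          (1 - ε) • a x + ε • (Gg x + gradient φ x) := by module
        rw [e, hFf, hFf (a x), hFf (Gg x + gradient φ x), ← ENNReal.ofReal_add (hf0 _) (hf0 _)]
        refine ENNReal.ofReal_le_ofReal (h2.trans ?_)
        have h4 := hf0 (a x)
        have h5 := hf0 (Gg x + gradient φ x)
        simp only [smul_eq_mul]
        change (1 - ε) * f (a x) + ε * f (Gg x + gradient φ x) ≤ f (a x) + f (Gg x + gradient φ x)
        nlinarith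
      refine (lintegral_mono hpt).trans_lt ?_
      rw [lintegral_add_left' (by
        simp only [hFf]
        exact (hfc.comp_aestronglyMeasurable hgu.2.1.aestronglyMeasurable).aemeasurable.ennreal_ofReal)]
      exact ENNReal.add_lt_top.2 ⟨heu ▸ hq.1, hblt⟩
    obtain ⟨i1, i2⟩ := hint_of hsegG.2.1.aestronglyMeasurable hseglt
    refine ⟨i1, ?_⟩
    have h2 := hq.2 _ (by rw [hseg_eq]; exact hseglt)
    have e1 : (1 - ε) • u + ε • w - u = ε • (w - u) := by module
    rw [e1, map_smul, smul_eq_mul, hseg_eq, heu, ← hfa', ← i2] at h2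
    linarith
  obtain ⟨hz0, hz0'⟩ := hvar _ (isTestFunction_zero Ω)
  have hg00 : ∀ x, gradient (fun _ : E d => (0 : ℝ)) x = 0 := fun x => by simp [gradient]
  simp only [hg00, add_zero] at hz0 hz0'
  have hzφ : ∀ φ : E d → ℝ, IsTestFunction Ω φ →
      IntegrableOn (fun x => inner ℝ (gradient f (a x)) (gradient φ x)) Ω := fun φ hφ => by
    refine ((hvar φ hφ).1.sub hz0).congr (ae_of_all _ fun x => ?_)
    simp only [Pi.sub_apply]
    rw [← inner_sub_right]; congr 1; abel
  have hqint : IntegrableOn q Ω := (Lp.memLp q).integrable le_top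
  refine ⟨locallyIntegrableOn_of_forall_inner_gradient hΩ hzφ, hqint.neg.locallyIntegrableOn,
    fun φ hφ => ?_⟩
  have hqφ : IntegrableOn (fun x => q x * φ x) Ω := integrable_mul_of_top q hφ.isW11Gradient.1
  have hqg : IntegrableOn (fun x => q x * (g x - u x)) Ω :=
    integrable_mul_of_top q (hg.1.sub hgu.1)
  set T : ℝ := (∫ x in Ω, inner ℝ (gradient f (a x)) (gradient φ x)) - ∫ x in Ω, q x * φ x with hT
  set c₀ : ℝ := (∫ x in Ω, inner ℝ (gradient f (a x)) (Gg x - a x)) -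
    ∫ x in Ω, q x * (g x - u x) with hc₀
  -- Replacing `φ` by `c φ` makes the variational inequality affine in `c`; being valid for all real
  -- `c`, it forces the slope `T` to vanish, whatever the contribution `c₀` of the datum.
  have hlin : ∀ c : ℝ, 0 ≤ c₀ + c * T := fun c => by
    obtain ⟨-, h1⟩ := hvar _ (hφ.const_mul c)
    have e1 : ∫ x in Ω, q x * (g x + c * φ x - u x) =
        (∫ x in Ω, q x * (g x - u x)) + c * ∫ x in Ω, q x * φ x := by
      rw [← integral_const_mul, ← integral_add hqg (hqφ.const_mul c)]
      refine integral_congr_ae (ae_of_all _ fun x => ?_)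
      simp only; ring
    have e2 : ∫ x in Ω, inner ℝ (gradient f (a x)) (Gg x + gradient (fun x => c * φ x) x - a x) =
        (∫ x in Ω, inner ℝ (gradient f (a x)) (Gg x - a x)) +
          c * ∫ x in Ω, inner ℝ (gradient f (a x)) (gradient φ x) := by
      rw [← integral_const_mul, ← integral_add hz0 ((hzφ φ hφ).const_mul c)]
      refine integral_congr_ae (ae_of_all _ fun x => ?_)
      simp only [gradient_const_mul' hφ.differentiable]
      rw [← real_inner_smul_right, ← inner_add_right]; congr 1; abel
    rw [e1, e2] at h1
    rw [hc₀, hT]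
    linarith
  have hT0 : T = 0 := by
    by_contra hne
    have := hlin (-(c₀ + 1) / T)
    rw [div_mul_cancel₀ _ hne] at this
    linarith
  have e : ∫ x in Ω, -q x * φ x = - ∫ x in Ω, q x * φ x := by
    rw [← integral_neg]; simp only [neg_mul]
  rw [e, neg_neg]
  linarith

end EulerLagrange

/-! ### Weak limits along ultrafilters. -/

section WeakLimit

variable {H : Type*} [NormedAddCommGroup H] [InnerProductSpace ℝ H] [CompleteSpace H]

/-- Limits along one fixed ultrafilter exist for all bounded quantities simultaneously, in
particular for the speeds at every time. This replaces the extraction of subsequences. -/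
lemma exists_ultrafilter_tendsto (𝒰 : Ultrafilter ℕ) {a : ℕ → ℝ} {C : ℝ} (h : ∀ n, |a n| ≤ C) :
    ∃ x, Tendsto a 𝒰 (𝓝 x) := by
  obtain ⟨x, -, hx⟩ := (isCompact_Icc (a := -C) (b := C)).ultrafilter_le_nhds' (𝒰.map a)
    (Ultrafilter.mem_map.2 (univ_mem' fun n => abs_le.1 (h n)))
  exact ⟨x, hx⟩

/-- Bounded sequences of functionals converge pointwise along ultrafilters. -/
lemma exists_weakStar_limit {X : Type*} [NormedAddCommGroup X] [NormedSpace ℝ X] (𝒰 : Ultrafilter ℕ)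
    {l : ℕ → StrongDual ℝ X} {C : ℝ} (h : ∀ n, ‖l n‖ ≤ C) :
    ∃ L : StrongDual ℝ X, ∀ y, Tendsto (fun n => l n y) 𝒰 (𝓝 (L y)) := by
  have hb : ∀ y n, |l n y| ≤ C * ‖y‖ := fun y n => (l n).le_of_opNorm_le (h n) y
  choose L hL using fun y => exists_ultrafilter_tendsto 𝒰 (hb y)
  let L' : X →ₗ[ℝ] ℝ :=
    { toFun := L
      map_add' := fun y z => tendsto_nhds_unique (hL _) (by
        simpa using (hL y).add (hL z))
      map_smul' := fun c y => tendsto_nhds_unique (hL _) (by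
        simpa using (hL y).const_mul c) }
  exact ⟨L'.mkContinuous C fun y => le_of_tendsto' (hL y).abs (hb y), hL⟩

/-- Bounded sequences of a Hilbert space converge weakly along ultrafilters. -/
lemma exists_weak_limit (𝒰 : Ultrafilter ℕ) {x : ℕ → H} {C : ℝ} (h : ∀ n, ‖x n‖ ≤ C) :
    ∃ x₀ : H, ∀ y, Tendsto (fun n => inner ℝ (x n) y) 𝒰 (𝓝 (inner ℝ x₀ y)) := by
  obtain ⟨L, hL⟩ := exists_weakStar_limit 𝒰 (l := fun n => InnerProductSpace.toDual ℝ H (x n))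
    (C := C) fun n => by simpa using h n
  refine ⟨(InnerProductSpace.toDual ℝ H).symm L, fun y => ?_⟩
  rw [InnerProductSpace.toDual_symm_apply]
  exact hL y

/-- A point outside a closed convex set is strictly separated from it by a vector `y`, which
contradicts the convergence of the pairings with `y`. -/
lemma mem_of_weak_limit {𝒰 : Ultrafilter ℕ} {x : ℕ → H} {x₀ : H}
    (h : ∀ y, Tendsto (fun n => inner ℝ (x n) y) 𝒰 (𝓝 (inner ℝ x₀ y))) {K : Set H}
    (hK : IsClosed K) (hK' : Convex ℝ K) (hx : ∀ᶠ n in 𝒰, x n ∈ K) : x₀ ∈ K := by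
  by_contra hx₀
  obtain ⟨f, c, hc, hf⟩ := geometric_hahn_banach_point_closed hK' hK hx₀
  obtain ⟨y, rfl⟩ := (InnerProductSpace.toDual ℝ H).surjective f
  have h1 := h y
  simp only [InnerProductSpace.toDual_apply_apply] at hc hf
  refine absurd (ge_of_tendsto h1 (hx.mono fun n hn => ?_)) (not_le.2 ((real_inner_comm _ _).trans_lt hc))
  rw [real_inner_comm]
  exact (hf _ hn).le

end WeakLimit

/-! ### Functions on space-time and their slices. -/

section SpaceTime

variable {d : ℕ} {Ω : Set (E d)}

/-- Lebesgue measure on `(0, +∞) × Ω`. -/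
noncomputable abbrev stMeasure (Ω : Set (E d)) : Measure (ℝ × E d) :=
  (volume.restrict (Ioi (0 : ℝ))).prod (volume.restrict Ω)

lemma restrict_prod_eq (t : ℝ) (Ω : Set (E d)) : (volume : Measure (ℝ × E d)).restrict (Ioi t ×ˢ Ω) =
    (volume.restrict (Ioi t)).prod (volume.restrict Ω) := by
  rw [Measure.prod_restrict, Measure.volume_eq_prod]

lemma restrict_stMeasure_le {t : ℝ} (ht : 0 ≤ t) :
    (volume : Measure (ℝ × E d)).restrict (Ioi t ×ˢ Ω) ≤ stMeasure Ω := by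
  rw [stMeasure, ← restrict_prod_eq]
  exact Measure.restrict_mono (prod_mono (Ioi_subset_Ioi ht) le_rfl) le_rfl

lemma ae_tendsto_zero_of_tsum {α : Type*} [MeasurableSpace α] {μ : Measure α} {g : ℕ → α → ℝ≥0∞}
    (hg : ∀ n, AEMeasurable (g n) μ) (h : ∑' n, ∫⁻ x, g n x ∂μ ≠ ⊤) :
    ∀ᵐ x ∂μ, Tendsto (fun n => g n x) atTop (𝓝 0) := by
  rw [← lintegral_tsum hg] at h
  filter_upwards [ae_lt_top' (AEMeasurable.tsum hg) h] with x hx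
  exact ENNReal.tendsto_atTop_zero_of_tsum_ne_top hx.ne

lemma ae_slice_memLp {V : Type*} [NormedAddCommGroup V] {μ : Measure ℝ} [SFinite μ]
    {ν : Measure (E d)} [SFinite ν] {f : ℝ × E d → V} (hf : MemLp f 2 (μ.prod ν)) :
    ∀ᵐ s ∂μ, MemLp (fun x => f (s, x)) 2 ν := by
  have h1 : ∫⁻ s, ∫⁻ x, ‖f (s, x)‖ₑ ^ 2 ∂ν ∂μ < ⊤ := by
    rw [← lintegral_prod _ (hf.1.enorm.pow_const 2)]
    have := hf.2
    rw [eLpNorm_lt_top_iff_lintegral_rpow_enorm_lt_top (by norm_num) (by norm_num)] at this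
    simpa using this
  have hm : AEMeasurable (fun s => ∫⁻ x, ‖f (s, x)‖ₑ ^ 2 ∂ν) μ :=
    (hf.1.enorm.pow_const 2).lintegral_prod_right'
  filter_upwards [ae_lt_top' hm h1.ne, hf.1.prodMk_left] with s hs hs'
  refine ⟨hs', ?_⟩
  rw [eLpNorm_lt_top_iff_lintegral_rpow_enorm_lt_top (by norm_num) (by norm_num)]
  simpa using hs

lemma tendsto_lintegral_of_sq {α V : Type*} [MeasurableSpace α] {μ : Measure α} [IsFiniteMeasure μ]
    [NormedAddCommGroup V] {f : ℕ → α → V} (hf : ∀ n, AEStronglyMeasurable (f n) μ)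
    (h : Tendsto (fun n => ∫⁻ x, ‖f n x‖ₑ ^ 2 ∂μ) atTop (𝓝 0)) :
    Tendsto (fun n => ∫⁻ x, ‖f n x‖ₑ ∂μ) atTop (𝓝 0) := by
  have h1 : Tendsto (fun n => (∫⁻ x, ‖f n x‖ₑ ∂μ) ^ 2) atTop (𝓝 0) := by
    have h2 : Tendsto (fun n => μ univ * ∫⁻ x, ‖f n x‖ₑ ^ 2 ∂μ) atTop (𝓝 0) := by
      simpa using ENNReal.Tendsto.const_mul h (Or.inr (measure_ne_top μ univ))
    exact tendsto_of_tendsto_of_tendsto_of_le_of_le tendsto_const_nhds h2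
      (fun _ => zero_le) fun n => sq_lintegral_le (hf n).enorm
  have h3 := (ENNReal.continuous_rpow_const (y := (1 / 2 : ℝ))).tendsto 0 |>.comp h1
  rw [ENNReal.zero_rpow_of_pos (by norm_num)] at h3
  refine h3.congr fun n => ?_
  rw [Function.comp_apply, ← ENNReal.rpow_natCast, ← ENNReal.rpow_mul]
  norm_num

/-- The Hilbert space of pairs of square integrable functions on `(0, +∞) × Ω`. -/
noncomputable abbrev PairSpace (Ω : Set (E d)) :=
  WithLp 2 (Lp ℝ 2 (stMeasure Ω) × Lp (E d) 2 (stMeasure Ω))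

/-- The pairs `(v, Dv)` such that `Dv(s)` is the weak gradient of `v(s)` for almost every `s`. -/
noncomputable def gradientPairs (Ω : Set (E d)) : Submodule ℝ (PairSpace Ω) where
  carrier := {p | ∀ᵐ s ∂(volume.restrict (Ioi (0 : ℝ))),
    IsW11Gradient Ω (fun x => p.fst (s, x)) (fun x => p.snd (s, x))}
  add_mem' := by
    intro p q hp hq
    have h1 := Measure.ae_ae_of_ae_prod (Lp.coeFn_add p.fst q.fst)
    have h2 := Measure.ae_ae_of_ae_prod (Lp.coeFn_add p.snd q.snd)
    filter_upwards [hp, hq, h1, h2] with s a b c e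
    exact (a.add b).congr (by filter_upwards [c] with x hx; exact hx.symm)
      (by filter_upwards [e] with x hx; exact hx.symm)
  zero_mem' := by
    have h1 := Measure.ae_ae_of_ae_prod (Lp.coeFn_zero ℝ 2 (stMeasure Ω))
    have h2 := Measure.ae_ae_of_ae_prod (Lp.coeFn_zero (E d) 2 (stMeasure Ω))
    filter_upwards [h1, h2] with s c e
    exact isW11Gradient_zero.congr (by filter_upwards [c] with x hx; exact hx.symm)
      (by filter_upwards [e] with x hx; exact hx.symm)
  smul_mem' := by
    intro c p hp
    have h1 := Measure.ae_ae_of_ae_prod (Lp.coeFn_smul c p.fst)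
    have h2 := Measure.ae_ae_of_ae_prod (Lp.coeFn_smul c p.snd)
    filter_upwards [hp, h1, h2] with s a b e
    exact (a.const_smul c).congr (by filter_upwards [b] with x hx; exact hx.symm)
      (by filter_upwards [e] with x hx; exact hx.symm)

/-- Along a subsequence with squared distances below `2⁻ʲ`, the squared norms of the slices of the
differences have a summable sequence of time integrals, so they tend to zero at almost every time.
-/
lemma exists_subseq_ae_tendsto_slice {V : Type*} [NormedAddCommGroup V] {μ : Measure ℝ} [SFinite μ]
    {ν : Measure (E d)} [SFinite ν] {f : ℕ → Lp V 2 (μ.prod ν)} {g : Lp V 2 (μ.prod ν)}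
    (h : Tendsto f atTop (𝓝 g)) :
    ∃ φ : ℕ → ℕ, StrictMono φ ∧ ∀ᵐ s ∂μ,
      Tendsto (fun n => ∫⁻ x, ‖f (φ n) (s, x) - g (s, x)‖ₑ ^ 2 ∂ν) atTop (𝓝 0) := by
  have hm : ∀ n, AEStronglyMeasurable (fun z => f n z - g z) (μ.prod ν) := fun n =>
    (Lp.aestronglyMeasurable _).sub (Lp.aestronglyMeasurable _)
  have e : ∀ n, ‖f n - g‖ₑ ^ 2 = ∫⁻ s, ∫⁻ x, ‖f n (s, x) - g (s, x)‖ₑ ^ 2 ∂ν ∂μ := fun n => by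
    rw [enorm_sq_eq_lintegral, ← lintegral_prod _ ((hm n).enorm.pow_const 2)]
    refine lintegral_congr_ae ?_
    filter_upwards [Lp.coeFn_sub (f n) g] with z hz
    rw [hz, Pi.sub_apply]
  have h1 : Tendsto (fun n => ‖f n - g‖ₑ ^ 2) atTop (𝓝 0) := by
    have := ((ENNReal.continuous_pow 2).tendsto 0).comp
      ((tendsto_iff_edist_tendsto_0.1 h).congr fun n => edist_eq_enorm_sub _ _)
    simpa [Function.comp_def] using this
  obtain ⟨φ, hφ, hφ'⟩ := Filter.extraction_forall_of_eventually (P := fun j n =>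
    ‖f n - g‖ₑ ^ 2 < (1 / 2) ^ j) fun j =>
    h1.eventually (gt_mem_nhds (pos_iff_ne_zero.2 (pow_ne_zero _ (by simp))))
  refine ⟨φ, hφ, ae_tendsto_zero_of_tsum
    (fun n => ((hm (φ n)).enorm.pow_const 2).lintegral_prod_right') ?_⟩
  simp only [← e]
  refine ne_top_of_le_ne_top ?_ (ENNReal.tsum_le_tsum fun j => (hφ' j).le)
  rw [ENNReal.tsum_geometric]
  simp

/-- Two successive extractions make both components converge on almost every slice, where the closed
graph of the weak gradient applies. As a closed subspace, it is also weakly closed. -/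
lemma isClosed_gradientPairs [IsFiniteMeasure (volume.restrict Ω)] :
    IsClosed (gradientPairs Ω : Set (PairSpace Ω)) := by
  refine isClosed_of_closure_subset fun p hp => ?_
  obtain ⟨q, hq, hlim⟩ := mem_closure_iff_seq_limit.1 hp
  have h1 : Tendsto (fun n => (q n).fst) atTop (𝓝 p.fst) :=
    ((WithLp.prod_continuous_ofLp 2 _ _).fst.tendsto p).comp hlim
  have h2 : Tendsto (fun n => (q n).snd) atTop (𝓝 p.snd) :=
    ((WithLp.prod_continuous_ofLp 2 _ _).snd.tendsto p).comp hlim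
  obtain ⟨φ, hφ, t1⟩ := exists_subseq_ae_tendsto_slice h1
  obtain ⟨χ, hχ, t2⟩ := exists_subseq_ae_tendsto_slice (h2.comp hφ.tendsto_atTop)
  have hall : ∀ᵐ s ∂(volume.restrict (Ioi (0 : ℝ))), ∀ j,
      IsW11Gradient Ω (fun x => (q (φ (χ j))).fst (s, x)) (fun x => (q (φ (χ j))).snd (s, x)) :=
    ae_all_iff.2 fun j => hq (φ (χ j))
  have m1 : ∀ᵐ s ∂(volume.restrict (Ioi (0 : ℝ))), ∀ j, AEStronglyMeasurable
      (fun x => (q (φ (χ j))).fst (s, x) - p.fst (s, x)) (volume.restrict Ω) :=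
    ae_all_iff.2 fun j =>
      ((Lp.aestronglyMeasurable _).sub (Lp.aestronglyMeasurable p.fst)).prodMk_left
  have m2 : ∀ᵐ s ∂(volume.restrict (Ioi (0 : ℝ))), ∀ j, AEStronglyMeasurable
      (fun x => (q (φ (χ j))).snd (s, x) - p.snd (s, x)) (volume.restrict Ω) :=
    ae_all_iff.2 fun j =>
      ((Lp.aestronglyMeasurable _).sub (Lp.aestronglyMeasurable p.snd)).prodMk_left
  have s1 := ae_slice_memLp (Lp.memLp p.fst)
  have s2 := ae_slice_memLp (Lp.memLp p.snd)
  change ∀ᵐ s ∂(volume.restrict (Ioi (0 : ℝ))), _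
  filter_upwards [t1, t2, hall, s1, s2, m1, m2] with s a b c e f g h
  exact IsW11Gradient.of_tendsto c (e.integrable (by norm_num)) (f.integrable (by norm_num))
    (tendsto_lintegral_of_sq g (a.comp hχ.tendsto_atTop)) (tendsto_lintegral_of_sq h b)

/-- A convex and closed condition on the slices passes to weak limits. -/
lemma ae_slice_mem_of_weak_limit {V : Type*} [NormedAddCommGroup V] [InnerProductSpace ℝ V]
    [CompleteSpace V] {μ : Measure ℝ} [SFinite μ] {ν : Measure (E d)} [SFinite ν] {𝒰 : Ultrafilter ℕ}
    {f : ℕ → Lp V 2 (μ.prod ν)} {g : Lp V 2 (μ.prod ν)}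
    (h : ∀ y, Tendsto (fun n => inner ℝ (f n) y) 𝒰 (𝓝 (inner ℝ g y)))
    {K : ℝ → Set (Lp V 2 ν)} (hK : ∀ s, IsClosed (K s)) (hK' : ∀ s, Convex ℝ (K s))
    (hf : ∀ᶠ n in 𝒰, ∀ᵐ s ∂μ, ∃ w ∈ K s, w =ᵐ[ν] fun x => f n (s, x)) :
    ∀ᵐ s ∂μ, ∃ w ∈ K s, w =ᵐ[ν] fun x => g (s, x) := by
  -- The space-time functions satisfying the slice condition form a closed convex set, so the weak
  -- convergence is needed only in space-time and never on slices.
  refine mem_of_weak_limit (K := {p : Lp V 2 (μ.prod ν) |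
    ∀ᵐ s ∂μ, ∃ w ∈ K s, w =ᵐ[ν] fun x => p (s, x)}) h ?_ ?_ hf
  · refine isClosed_of_closure_subset fun p hp => ?_
    obtain ⟨q, hq, hlim⟩ := mem_closure_iff_seq_limit.1 hp
    obtain ⟨φ, hφ, t⟩ := exists_subseq_ae_tendsto_slice hlim
    have hall := ae_all_iff.2 fun j => hq (φ j)
    change ∀ᵐ s ∂μ, _
    filter_upwards [t, hall, ae_slice_memLp (Lp.memLp p)] with s a b c
    choose w hw hw' using b
    refine ⟨c.toLp, (hK s).mem_of_tendsto (b := atTop) (f := w) ?_ (Eventually.of_forall hw),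
      c.coeFn_toLp⟩
    rw [tendsto_iff_edist_tendsto_0]
    have e : ∀ j, edist (w j) c.toLp ^ 2 = ∫⁻ x, ‖q (φ j) (s, x) - p (s, x)‖ₑ ^ 2 ∂ν := fun j => by
      rw [edist_eq_enorm_sub, enorm_sq_eq_lintegral]
      refine lintegral_congr_ae ?_
      filter_upwards [Lp.coeFn_sub (w j) c.toLp, hw' j, c.coeFn_toLp] with x h1 h2 h3
      rw [h1, Pi.sub_apply, h2, h3]
    simp only [← e] at a
    have h3 := (ENNReal.continuous_rpow_const (y := (1 / 2 : ℝ))).tendsto 0 |>.comp a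
    rw [ENNReal.zero_rpow_of_pos (by norm_num)] at h3
    refine h3.congr fun n => ?_
    rw [Function.comp_apply, ← ENNReal.rpow_natCast, ← ENNReal.rpow_mul]
    norm_num
  · intro p hp q hq a b ha hb hab
    have h1 := Measure.ae_ae_of_ae_prod (Lp.coeFn_add (a • p) (b • q))
    have h2 := Measure.ae_ae_of_ae_prod (Lp.coeFn_smul a p)
    have h3 := Measure.ae_ae_of_ae_prod (Lp.coeFn_smul b q)
    change ∀ᵐ s ∂μ, _
    filter_upwards [hp, hq, h1, h2, h3] with s ⟨w, hw, hw'⟩ ⟨z, hz, hz'⟩ k1 k2 k3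
    refine ⟨a • w + b • z, hK' s hw hz ha hb hab, ?_⟩
    filter_upwards [hw', hz', k1, k2, k3, Lp.coeFn_add (a • w) (b • z), Lp.coeFn_smul a w,
      Lp.coeFn_smul b z] with x e1 e2 e3 e4 e5 e6 e7 e8
    rw [e6, Pi.add_apply, e7, e8, e3, Pi.add_apply, e4, e5, Pi.smul_apply, Pi.smul_apply,
      Pi.smul_apply, Pi.smul_apply, e1, e2]

end SpaceTime

/-! ### Step functions in time and the time weight. -/

section Step

lemma floor_add_div {s τ : ℝ} (hτ : 0 < τ) (hs : 0 ≤ s) : ⌊(s + τ) / τ⌋₊ = ⌊s / τ⌋₊ + 1 := by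
  rw [add_div, div_self hτ.ne', Nat.floor_add_one (by positivity)]

lemma floor_div_mul_le {s τ : ℝ} (hτ : 0 < τ) (hs : 0 ≤ s) : (⌊s / τ⌋₊ : ℝ) * τ ≤ s :=
  (le_div_iff₀ hτ).1 (Nat.floor_le (by positivity))

lemma lt_floor_div_add_one_mul {s τ : ℝ} (hτ : 0 < τ) : s < ((⌊s / τ⌋₊ : ℝ) + 1) * τ :=
  (div_lt_iff₀ hτ).1 (Nat.lt_floor_add_one _)

lemma floor_div_mono {s s' τ : ℝ} (hτ : 0 < τ) (h : s ≤ s') : ⌊s / τ⌋₊ ≤ ⌊s' / τ⌋₊ :=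
  Nat.floor_mono (by gcongr)

lemma lintegral_Ici_floor_div {τ : ℝ} (hτ : 0 < τ) (g : ℕ → ℝ≥0∞) (N : ℕ) :
    ∫⁻ s in Ici (N * τ), g ⌊s / τ⌋₊ = ∑' i, ENNReal.ofReal τ * g (N + i) := by
  have hU : Ici (N * τ) = ⋃ i : ℕ, Ico (((N + i : ℕ) : ℝ) * τ) (((N + i : ℕ) : ℝ) * τ + τ) := by
    ext s
    simp only [mem_Ici, mem_iUnion, mem_Ico]
    constructor
    · intro hs
      have h0 : 0 ≤ s := le_trans (by positivity) hs
      have h1 : N ≤ ⌊s / τ⌋₊ := Nat.le_floor ((le_div_iff₀ hτ).2 hs)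
      refine ⟨⌊s / τ⌋₊ - N, ?_⟩
      rw [Nat.add_sub_cancel' h1]
      refine ⟨floor_div_mul_le hτ h0, ?_⟩
      have := lt_floor_div_add_one_mul (s := s) hτ
      linarith
    · rintro ⟨i, hi, -⟩
      refine le_trans ?_ hi
      push_cast
      gcongr
      simp
  have hfl : ∀ i : ℕ, ∀ s ∈ Ico (((N + i : ℕ) : ℝ) * τ) (((N + i : ℕ) : ℝ) * τ + τ),
      ⌊s / τ⌋₊ = N + i := fun i s hs => by
    have h0 : 0 ≤ s := le_trans (by positivity) hs.1
    rw [Nat.floor_eq_iff (by positivity)]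
    refine ⟨(le_div_iff₀ hτ).2 hs.1, (div_lt_iff₀ hτ).2 ?_⟩
    have := hs.2
    linarith
  rw [hU, lintegral_iUnion (fun _ => measurableSet_Ico)]
  · refine tsum_congr fun i => ?_
    rw [setLIntegral_congr_fun (g := fun _ => g (N + i)) measurableSet_Ico
      (fun s hs => by simp only [hfl i s hs]), setLIntegral_const, Real.volume_Ico,
      add_sub_cancel_left, mul_comm]
  · intro i j hij
    refine Set.disjoint_left.2 fun s hi hj => hij ?_
    have := (hfl i s hi).symm.trans (hfl j s hj)
    omega

lemma lintegral_Ici_floor_div_le {τ : ℝ} (hτ : 0 < τ) {g : ℕ → ℝ} (hg : ∀ n, 0 ≤ g n) {N : ℕ}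
    {C : ℝ} (h : ∀ k, ∑ i ∈ Finset.range k, τ * g (N + i) ≤ C) :
    ∫⁻ s in Ici (N * τ), ENNReal.ofReal (g ⌊s / τ⌋₊) ≤ ENNReal.ofReal C := by
  rw [lintegral_Ici_floor_div hτ (fun n => ENNReal.ofReal (g n))]
  refine ENNReal.tsum_le_of_sum_range_le fun k => ?_
  simp only [← ENNReal.ofReal_mul hτ.le]
  rw [← ENNReal.ofReal_sum_of_nonneg fun i _ => mul_nonneg hτ.le (hg _)]
  exact ENNReal.ofReal_le_ofReal (h k)

/-- The weight `min s 1`. -/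
noncomputable def weight (s : ℝ) : ℝ := min s 1

lemma weight_pos {s : ℝ} (hs : 0 < s) : 0 < weight s := lt_min hs one_pos

lemma weight_le_one (s : ℝ) : weight s ≤ 1 := min_le_right _ _

lemma measurable_weight : Measurable weight := measurable_id.min measurable_const

lemma weight_mono : Monotone weight := fun _ _ h => min_le_min h le_rfl

/-- A tail bound `C / s` does not make `g` integrable near `0`. Up to the factor `4`, `weight s ^ 2`
is at most the integral of `r` over the `r < s` in `(0, 1)`; by Fubini's theorem the weighted
integral is then an average of the bounded quantities `r ∫_r^∞ g`. -/
lemma lintegral_weight_sq_le {g : ℝ → ℝ≥0∞} (hg : Measurable g) {C : ℝ≥0∞}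
    (h : ∀ s, 0 < s → ENNReal.ofReal s * ∫⁻ r in Ioi s, g r ≤ C) :
    ∫⁻ s in Ioi (0 : ℝ), ENNReal.ofReal (weight s) ^ 2 * g s ≤ 4 * C := by
  have hw : ∀ s ∈ Ioi (0 : ℝ), ENNReal.ofReal (weight s) ^ 2 ≤
      4 * ∫⁻ r in Ioo (0 : ℝ) 1, ENNReal.ofReal r * (Ioi r).indicator 1 s := fun s hs => by
    have hb : 0 < weight s := weight_pos hs
    calc ENNReal.ofReal (weight s) ^ 2
        = 4 * ∫⁻ r in Ioo (weight s / 2) (weight s), ENNReal.ofReal (weight s / 2) := by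
          rw [setLIntegral_const, Real.volume_Ioo, ← ENNReal.ofReal_mul (by positivity),
            ← ENNReal.ofReal_pow hb.le, show (4 : ℝ≥0∞) = ENNReal.ofReal 4 by norm_num,
            ← ENNReal.ofReal_mul (by norm_num)]
          congr 1
          ring
      _ ≤ 4 * ∫⁻ r in Ioo (weight s / 2) (weight s),
            ENNReal.ofReal r * (Ioi r).indicator 1 s := by
          gcongr 4 * ?_
          refine setLIntegral_mono' measurableSet_Ioo fun r hr => ?_
          have : r < s := hr.2.trans_le (min_le_left _ _)
          rw [indicator_of_mem (mem_Ioi.2 this), Pi.one_apply, mul_one]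
          exact ENNReal.ofReal_le_ofReal hr.1.le
      _ ≤ _ := by
          gcongr 4 * ?_
          exact lintegral_mono_set (Ioo_subset_Ioo (by positivity) (weight_le_one s))
  have hind : Measurable fun p : ℝ × ℝ => (Ioi p.2).indicator (1 : ℝ → ℝ≥0∞) p.1 := by
    have : (fun p : ℝ × ℝ => (Ioi p.2).indicator (1 : ℝ → ℝ≥0∞) p.1) =
        {p : ℝ × ℝ | p.2 < p.1}.indicator 1 := by
      ext p; simp [indicator_apply]
    rw [this]
    exact measurable_one.indicator (measurableSet_lt measurable_snd measurable_fst)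
  have hF : Measurable fun p : ℝ × ℝ =>
      ENNReal.ofReal p.2 * (Ioi p.2).indicator (1 : ℝ → ℝ≥0∞) p.1 * g p.1 :=
    ((measurable_snd.ennreal_ofReal).mul hind).mul (hg.comp measurable_fst)
  calc ∫⁻ s in Ioi (0 : ℝ), ENNReal.ofReal (weight s) ^ 2 * g s
      ≤ ∫⁻ s in Ioi (0 : ℝ), 4 * ∫⁻ r in Ioo (0 : ℝ) 1,
          ENNReal.ofReal r * (Ioi r).indicator 1 s * g s := by
        refine setLIntegral_mono' measurableSet_Ioi fun s hs => ?_
        rw [lintegral_mul_const _ (by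
          exact (measurable_id.ennreal_ofReal).mul (hind.comp (measurable_const.prodMk measurable_id))),
          ← mul_assoc]
        gcongr
        exact hw s hs
    _ = 4 * ∫⁻ r in Ioo (0 : ℝ) 1, ∫⁻ s in Ioi (0 : ℝ),
          ENNReal.ofReal r * (Ioi r).indicator 1 s * g s := by
        rw [lintegral_const_mul _ hF.lintegral_prod_right', lintegral_lintegral_swap hF.aemeasurable]
    _ ≤ 4 * ∫⁻ r in Ioo (0 : ℝ) 1, C := by
        gcongr 4 * ?_
        refine setLIntegral_mono' measurableSet_Ioo fun r hr => ?_
        refine le_trans ?_ (h r hr.1)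
        rw [← lintegral_const_mul _ hg, ← lintegral_indicator (measurableSet_Ioi (a := r))]
        refine (lintegral_mono' Measure.restrict_le_self le_rfl).trans (lintegral_mono fun s => ?_)
        by_cases hs : s ∈ Ioi r <;> simp [hs]
    _ = 4 * C := by simp

end Step

/-! ### The discrete estimates in continuous time. -/

section Flow

variable {d : ℕ} {Ω : Set (E d)} {Φ : L1 Ω → ℝ≥0∞} {γ τ : ℝ} {U : ℕ → L1 Ω}
  {l : ℕ → StrongDual ℝ (L1 Ω)} {m : ℕ → ℝ}

namespace IsFlowData

lemma mul_m_sq_le (h : IsFlowData Φ τ U l m) (hΦ : IsStrongEnergy γ Φ) (hγ : 0 ≤ γ) (s : ℝ) :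
    s * m ⌊s / τ⌋₊ ^ 2 ≤ (Φ (U 0)).toReal := by
  refine le_trans ?_ (h.m_sq_le hΦ hγ ⌊s / τ⌋₊)
  gcongr
  exact (lt_floor_div_add_one_mul h.pos).le

lemma norm_sub_le (h : IsFlowData Φ τ U l m) (hΦ : IsStrongEnergy γ Φ) (hγ : 0 ≤ γ) (n k : ℕ) :
    ‖U (n + k) - U n‖ ≤ k * τ * m n := by
  induction k with
  | zero => simp
  | succ k ih =>
    have h1 := h.speed (n + k)
    have h2 := norm_add_le (U (n + k + 1) - U (n + k)) (U (n + k) - U n)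
    rw [sub_add_sub_cancel] at h2
    have h3 := mul_le_mul_of_nonneg_left (h.antitone hΦ hγ (Nat.le_add_right n k)) h.pos.le
    rw [← add_assoc]
    push_cast
    linarith

lemma norm_floor_sub_le (h : IsFlowData Φ τ U l m) (hΦ : IsStrongEnergy γ Φ) (hγ : 0 ≤ γ)
    {s s' : ℝ} (hs : 0 ≤ s) (hs' : s ≤ s') :
    ‖U ⌊s' / τ⌋₊ - U ⌊s / τ⌋₊‖ ≤ (s' - s + τ) * m ⌊s / τ⌋₊ := by
  obtain ⟨k, hk⟩ := Nat.exists_eq_add_of_le (floor_div_mono h.pos hs')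
  rw [hk]
  refine (h.norm_sub_le hΦ hγ _ k).trans ?_
  have h1 := floor_div_mul_le h.pos (hs.trans hs')
  have h2 := lt_floor_div_add_one_mul (s := s) h.pos
  rw [hk] at h1
  push_cast at h1
  have := h.m_nonneg ⌊s / τ⌋₊
  gcongr
  linarith

/-- The number `k` of steps between `s` and `s'` satisfies `k τ > s' - s - τ`, and each of them
dissipates at least `τ` times the square of the final speed. -/
lemma energy_floor_le (h : IsFlowData Φ τ U l m) (hΦ : IsStrongEnergy γ Φ) (hγ : 0 ≤ γ)
    {s s' : ℝ} (hs : 0 ≤ s) (hs' : s ≤ s') :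
    (Φ (U ⌊s' / τ⌋₊)).toReal + (s' - s - τ) * m ⌊s' / τ⌋₊ ^ 2 ≤ (Φ (U ⌊s / τ⌋₊)).toReal := by
  obtain ⟨k, hk⟩ := Nat.exists_eq_add_of_le (floor_div_mono h.pos hs')
  have h1 := floor_div_mul_le h.pos hs
  have h2 := lt_floor_div_add_one_mul (s := s') h.pos
  rw [hk] at h2 ⊢
  push_cast at h2
  refine le_trans ?_ (h.energy_sum hΦ hγ _ k)
  have h3 : ∑ i ∈ Finset.range k, τ * m (⌊s / τ⌋₊ + k) ^ 2 ≤
      ∑ i ∈ Finset.range k, τ * m (⌊s / τ⌋₊ + i) ^ 2 := by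
    refine Finset.sum_le_sum fun i hi => ?_
    have h4 := h.antitone hΦ hγ (show ⌊s / τ⌋₊ + i ≤ ⌊s / τ⌋₊ + k by
      have := Finset.mem_range.1 hi; omega)
    have h5 := h.pos
    have h6 := h.m_nonneg (⌊s / τ⌋₊ + k)
    gcongr
  rw [Finset.sum_const, Finset.card_range, nsmul_eq_mul, ← mul_assoc] at h3
  refine le_trans ?_ (add_le_add_right h3 _)
  gcongr
  linarith

lemma energy_le (h : IsFlowData Φ τ U l m) (hΦ : IsStrongEnergy γ Φ) (hγ : 0 ≤ γ) (n : ℕ) :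
    Φ (U n) ≤ Φ (U 0) :=
  (ENNReal.toReal_le_toReal (h.fin n).ne (h.fin 0).ne).1 (h.energy_antitone hΦ hγ (Nat.zero_le n))

lemma lintegral_m_sq_le (h : IsFlowData Φ τ U l m) (hΦ : IsStrongEnergy γ Φ) (hγ : 0 ≤ γ) :
    ∫⁻ s in Ioi (0 : ℝ), ENNReal.ofReal (m ⌊s / τ⌋₊ ^ 2) ≤ Φ (U 0) := by
  rw [← ENNReal.ofReal_toReal (h.fin 0).ne]
  have := lintegral_Ici_floor_div_le h.pos (g := fun n => m n ^ 2) (fun n => sq_nonneg _) (N := 0)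
    (C := (Φ (U 0)).toReal) fun k => by
      have h1 := h.energy_sum hΦ hγ 0 k
      have h2 := ENNReal.toReal_nonneg (a := Φ (U (0 + k)))
      linarith
  refine le_trans (lintegral_mono_set ?_) this
  simp

lemma lintegral_grad_le (h : IsFlowData Φ τ U l m) (hγ : 0 ≤ γ) {N : ℕ} {C : ℝ}
    (hC : ∀ k, ∑ i ∈ Finset.range k,
      γ * (τ * ‖τ⁻¹ • (grad (U (N + i + 1)) - grad (U (N + i)))‖ ^ 2) ≤ C) :
    ENNReal.ofReal γ * ∫⁻ s in Ici (N * τ),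
      ‖τ⁻¹ • (grad (U (⌊s / τ⌋₊ + 1)) - grad (U ⌊s / τ⌋₊))‖ₑ ^ 2 ≤ ENNReal.ofReal C := by
  have h1 := lintegral_Ici_floor_div_le h.pos (N := N) (C := C)
    (g := fun n => γ * ‖τ⁻¹ • (grad (U (n + 1)) - grad (U n))‖ ^ 2)
    (fun n => by positivity) fun k => by
      refine le_trans (le_of_eq (Finset.sum_congr rfl fun i _ => ?_)) (hC k)
      ring
  rw [← lintegral_const_mul']
  · refine le_trans (le_of_eq (lintegral_congr fun s => ?_)) h1
    rw [ENNReal.ofReal_mul hγ, ← ofReal_norm, ENNReal.ofReal_pow (norm_nonneg _)]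
  · simp

/-- With `⌊t / τ⌋ = n + 1` the discrete estimate gives `Φ / (2 (n + 1) τ)`, and `t < (n + 2) τ ≤ 2
(n + 1) τ`: the factor `2` absorbs the rounding, so the constant in front of `Φ / t` is `1`. -/
lemma lintegral_grad_tail_le (h : IsFlowData Φ τ U l m) (hΦ : IsStrongEnergy γ Φ) (hγ : 0 ≤ γ)
    {t : ℝ} (hτ : τ ≤ t) :
    ENNReal.ofReal γ * ∫⁻ s in Ioi t,
      ‖τ⁻¹ • (grad (U (⌊s / τ⌋₊ + 1)) - grad (U ⌊s / τ⌋₊))‖ₑ ^ 2 ≤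
        ENNReal.ofReal ((Φ (U 0)).toReal / t) := by
  have hτ0 := h.pos
  have ht : 0 < t := hτ0.trans_le hτ
  obtain ⟨n, hn⟩ : ∃ n, ⌊t / τ⌋₊ = n + 1 := Nat.exists_eq_succ_of_ne_zero (by
    have : 1 ≤ ⌊t / τ⌋₊ := Nat.le_floor (by rw [Nat.cast_one]; exact (one_le_div hτ0).2 hτ)
    omega)
  have h1 := floor_div_mul_le hτ0 ht.le
  have h2 := lt_floor_div_add_one_mul (s := t) hτ0
  rw [hn] at h1 h2
  push_cast at h1 h2
  refine le_trans (mul_le_mul_right (lintegral_mono_set (Ioi_subset_Ici ?_)) _)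
    ((h.lintegral_grad_le hγ (h.tail_sum_succ hΦ hγ n)).trans (ENNReal.ofReal_le_ofReal ?_))
  · push_cast; exact h1
  · have := ENNReal.toReal_nonneg (a := Φ (U 0))
    gcongr
    nlinarith

/-- Rough version without restriction on `t`, needed for the weighted bound: when `t < τ` the first
step is included and the constant becomes `3`. -/
lemma lintegral_grad_tail_le' (h : IsFlowData Φ τ U l m) (hΦ : IsStrongEnergy γ Φ) (hγ : 0 ≤ γ)
    {t : ℝ} (ht : 0 < t) :
    ENNReal.ofReal γ * ∫⁻ s in Ioi t,
      ‖τ⁻¹ • (grad (U (⌊s / τ⌋₊ + 1)) - grad (U ⌊s / τ⌋₊))‖ₑ ^ 2 ≤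
        ENNReal.ofReal (3 * (Φ (U 0)).toReal / t) := by
  have hΦ0 := ENNReal.toReal_nonneg (a := Φ (U 0))
  rcases le_total τ t with hτ | hτ
  · refine (h.lintegral_grad_tail_le hΦ hγ hτ).trans (ENNReal.ofReal_le_ofReal ?_)
    gcongr
    linarith
  · refine le_trans (mul_le_mul_right (lintegral_mono_set (Ioi_subset_Ici ?_)) _)
      ((h.lintegral_grad_le hγ (N := 0) (C := 3 * (Φ (U 0)).toReal / τ) fun k => by
        simpa using h.tail_sum_zero hΦ hγ k).trans (ENNReal.ofReal_le_ofReal ?_))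
    · simpa using ht.le
    · gcongr

end IsFlowData

end Flow

/-! ### From integral bounds to norms in `L²`. -/

section SquareIntegrable

lemma memLp_two_of_lintegral_le {α V : Type*} [MeasurableSpace α] {μ : Measure α}
    [NormedAddCommGroup V] {f : α → V} (hf : AEStronglyMeasurable f μ) {C : ℝ≥0∞} (hC : C ≠ ⊤)
    (h : ∫⁻ x, ‖f x‖ₑ ^ 2 ∂μ ≤ C) : ∃ h' : MemLp f 2 μ, ‖h'.toLp‖ ≤ √C.toReal := by
  have h' : MemLp f 2 μ := by
    refine ⟨hf, ?_⟩
    rw [eLpNorm_lt_top_iff_lintegral_rpow_enorm_lt_top (by norm_num) (by norm_num)]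
    simpa using h.trans_lt hC.lt_top
  refine ⟨h', Real.le_sqrt_of_sq_le ?_⟩
  have h1 : ‖h'.toLp‖ₑ ^ 2 ≤ C := by
    rw [enorm_sq_eq_lintegral]
    refine le_trans (le_of_eq (lintegral_congr_ae ?_)) h
    filter_upwards [h'.coeFn_toLp] with x hx
    rw [hx]
  have h2 := ENNReal.toReal_mono hC h1
  rwa [ENNReal.toReal_pow, toReal_enorm] at h2

end SquareIntegrable

/-! ### Removing the time weight away from time zero. -/

section Unweight

variable {d : ℕ} {Ω : Set (E d)}

lemma stMeasure_restrict {t : ℝ} (ht : 0 ≤ t) (Ω : Set (E d)) :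
    (stMeasure Ω).restrict (Ioi t ×ˢ univ) = volume.restrict (Ioi t ×ˢ Ω) := by
  rw [stMeasure, ← restrict_prod_eq, Measure.restrict_restrict (measurableSet_Ioi.prod .univ),
    prod_inter_prod, univ_inter, inter_eq_left.2 (Ioi_subset_Ioi ht)]

lemma ae_restrict_fst_mem {t : ℝ} (ht : 0 ≤ t) (Ω : Set (E d)) :
    ∀ᵐ z ∂(volume.restrict (Ioi t ×ˢ Ω)), t < z.1 := by
  rw [← stMeasure_restrict ht]
  filter_upwards [ae_restrict_mem (measurableSet_Ioi.prod .univ)] with z hz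
  exact hz.1

lemma memLp_tail {W : Type*} [NormedAddCommGroup W] {t : ℝ} (ht : 0 ≤ t) {f : ℝ × E d → W}
    (hf : MemLp f 2 (stMeasure Ω)) :
    MemLp f 2 (volume.restrict (Ioi t ×ˢ Ω)) :=
  hf.mono_measure (restrict_stMeasure_le ht)

variable {V : Type*} [NormedAddCommGroup V] [InnerProductSpace ℝ V]

lemma memLp_inv_weight_smul {t : ℝ} (ht : 0 < t) {f : ℝ × E d → V}
    (hf : MemLp f 2 (volume.restrict (Ioi t ×ˢ Ω))) :
    MemLp (fun z => (weight z.1)⁻¹ • f z) 2 (volume.restrict (Ioi t ×ˢ Ω)) := by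
  refine hf.of_le_mul (c := (weight t)⁻¹)
    ((measurable_weight.comp measurable_fst).inv.aestronglyMeasurable.smul hf.1) ?_
  filter_upwards [ae_restrict_fst_mem ht.le Ω] with z hz
  have h1 := weight_pos ht
  have h2 := weight_mono hz.le
  rw [norm_smul, norm_inv, Real.norm_of_nonneg (h1.le.trans h2)]
  gcongr

/-- Weak limits in a weighted space, as weak limits on the cylinders `(t, +∞) × Ω`. -/
lemma tendsto_integral_inner_of_weight {𝒰 : Ultrafilter ℕ} {x : ℕ → ℝ × E d → V}
    (hx : ∀ k, MemLp (fun z => weight z.1 • x k z) 2 (stMeasure Ω)) {X : Lp V 2 (stMeasure Ω)}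
    (hX : ∀ y, Tendsto (fun k => inner ℝ (hx k).toLp y) 𝒰 (𝓝 (inner ℝ X y)))
    {t : ℝ} (ht : 0 < t) {y : ℝ × E d → V} (hy : MemLp y 2 (volume.restrict (Ioi t ×ˢ Ω))) :
    Tendsto (fun k => ∫ z in Ioi t ×ˢ Ω, inner ℝ (x k z) (y z)) 𝒰
      (𝓝 (∫ z in Ioi t ×ˢ Ω, inner ℝ ((weight z.1)⁻¹ • X z) (y z))) := by
  have hS : MeasurableSet (Ioi t ×ˢ (univ : Set (E d))) := measurableSet_Ioi.prod .univ
  -- The inverse weight is bounded for `s > t`, so it can be moved onto the test function, extended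
  -- by zero to earlier times.
  have hY : MemLp ((Ioi t ×ˢ (univ : Set (E d))).indicator fun z => (weight z.1)⁻¹ • y z) 2
      (stMeasure Ω) := by
    rw [memLp_indicator_iff_restrict hS, stMeasure_restrict ht.le]
    exact memLp_inv_weight_smul ht hy
  have key : ∀ w : Lp V 2 (stMeasure Ω), inner ℝ w hY.toLp =
      ∫ z in Ioi t ×ˢ Ω, inner ℝ (w z) ((weight z.1)⁻¹ • y z) := fun w => by
    rw [L2.inner_def, ← stMeasure_restrict ht.le, ← integral_indicator hS]
    refine integral_congr_ae ?_
    filter_upwards [hY.coeFn_toLp] with z hz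
    rw [hz]
    by_cases h : z ∈ Ioi t ×ˢ (univ : Set (E d)) <;> simp [h]
  have h1 := hX hY.toLp
  rw [key] at h1
  simp only [real_inner_smul_left]
  simp only [real_inner_smul_right] at h1 key
  refine h1.congr fun k => ?_
  rw [key]
  refine integral_congr_ae ?_
  have h2 : ∀ᵐ z : ℝ × E d ∂(volume.restrict (Ioi t ×ˢ Ω)),
      ((hx k).toLp : Lp V 2 (stMeasure Ω)) z = weight z.1 • x k z := by
    rw [← stMeasure_restrict ht.le]
    exact ae_restrict_of_ae (hx k).coeFn_toLp
  filter_upwards [h2, ae_restrict_fst_mem ht.le Ω] with z hz hzt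
  have h3 := weight_pos (ht.trans hzt)
  rw [hz, real_inner_smul_left, inv_mul_cancel_left₀ h3.ne']

lemma lintegral_weight_smul {x : ℝ × E d → V} (hx : StronglyMeasurable x) :
    ∫⁻ z, ‖weight z.1 • x z‖ₑ ^ 2 ∂(stMeasure Ω) =
      ∫⁻ s in Ioi (0 : ℝ), ENNReal.ofReal (weight s) ^ 2 * ∫⁻ y in Ω, ‖x (s, y)‖ₑ ^ 2 := by
  have hm : StronglyMeasurable fun z : ℝ × E d => weight z.1 • x z :=
    (measurable_weight.comp measurable_fst).stronglyMeasurable.smul hx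
  rw [lintegral_prod _ (hm.enorm.pow_const 2).aemeasurable]
  refine setLIntegral_congr_fun measurableSet_Ioi fun s hs => ?_
  simp only
  rw [← lintegral_const_mul' _ _ (by simp)]
  refine lintegral_congr fun y => ?_
  rw [enorm_smul, mul_pow, Real.enorm_of_nonneg (weight_pos hs).le]

end Unweight

/-! ### Discrete velocities and their weak limit. -/

section Velocity

variable {d : ℕ} {Ω : Set (E d)} {Φ : L1 Ω → ℝ≥0∞} {γ : ℝ}

lemma stronglyMeasurable_step {V : Type*} [NormedAddCommGroup V] [SecondCountableTopology V]
    [MeasurableSpace V] [BorelSpace V] {p : ℝ≥0∞} {μ : Measure (E d)} (f : ℕ → Lp V p μ) (τ : ℝ) :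
    StronglyMeasurable fun z : ℝ × E d => f ⌊z.1 / τ⌋₊ z.2 := by
  have h : Measurable fun p : ℕ × E d => f p.1 p.2 :=
    measurable_from_prod_countable_right fun n => (Lp.stronglyMeasurable (f n)).measurable
  exact (h.comp ((Nat.measurable_floor.comp (measurable_fst.div_const τ)).prodMk
    measurable_snd)).stronglyMeasurable

/-- The difference quotients of a discrete flow. -/
noncomputable def vel (τ : ℝ) (U : ℕ → L1 Ω) (n : ℕ) : L1 Ω := τ⁻¹ • (U (n + 1) - U n)

/-- The difference quotients of the gradients of a discrete flow. -/
noncomputable def gradVel (τ : ℝ) (U : ℕ → L1 Ω) (n : ℕ) : L2V Ω :=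
  τ⁻¹ • (grad (U (n + 1)) - grad (U n))

variable {τ : ℝ} {U : ℕ → L1 Ω} {l : ℕ → StrongDual ℝ (L1 Ω)} {m : ℕ → ℝ}

lemma IsFlowData.hasGrad_vel (h : IsFlowData Φ τ U l m) (hΦ : IsStrongEnergy γ Φ) (n : ℕ) :
    HasGrad (vel τ U n) (gradVel τ U n) :=
  ((hΦ.hasGrad _ (h.fin _)).sub (hΦ.hasGrad _ (h.fin _))).smul _

lemma IsFlowData.norm_vel (h : IsFlowData Φ τ U l m) (n : ℕ) : ‖vel τ U n‖ = m n := by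
  rw [vel, norm_smul, h.speed, norm_inv, Real.norm_of_nonneg h.pos.le,
    inv_mul_cancel_left₀ h.pos.ne']

lemma IsFlowData.lintegral_weight_gradVel_le (h : IsFlowData Φ τ U l m) (hΦ : IsStrongEnergy γ Φ)
    (hγ : 0 < γ) :
    ∫⁻ z, ‖weight z.1 • gradVel τ U ⌊z.1 / τ⌋₊ z.2‖ₑ ^ 2 ∂(stMeasure Ω) ≤
      4 * (3 * Φ (U 0) / ENNReal.ofReal γ) := by
  rw [lintegral_weight_smul (stronglyMeasurable_step (gradVel τ U) τ)]
  simp only [← enorm_sq_eq_lintegral]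
  have hm : Measurable fun s : ℝ => ‖gradVel τ U ⌊s / τ⌋₊‖ₑ ^ 2 :=
    (measurable_of_countable fun n => ‖gradVel τ U n‖ₑ ^ 2).comp
      (Nat.measurable_floor.comp (measurable_id.div_const τ))
  refine lintegral_weight_sq_le hm fun s hs => ?_
  have h1 := h.lintegral_grad_tail_le' hΦ hγ.le hs
  rw [ENNReal.ofReal_div_of_pos hs, ENNReal.ofReal_mul (by norm_num),
    ENNReal.ofReal_toReal (h.fin 0).ne] at h1
  rw [ENNReal.le_div_iff_mul_le (Or.inl (by simpa using hγ)) (Or.inl (by simp))]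
  rw [ENNReal.le_div_iff_mul_le (Or.inl (by simpa using hs)) (Or.inl (by simp))] at h1
  calc _ = ENNReal.ofReal γ * (∫⁻ r in Ioi s, ‖gradVel τ U ⌊r / τ⌋₊‖ₑ ^ 2) * ENNReal.ofReal s := by
        ring
    _ ≤ _ := h1.trans (by simp)

/-- The embedding bounds the `L²` norm of each velocity by that of its gradient, integrable with the
weight, and by its `L¹` norm, the speed, whose square is integrable in time by dissipation. -/
lemma IsFlowData.lintegral_weight_vel_le (h : IsFlowData Φ τ U l m) (hΦ : IsStrongEnergy γ Φ)
    (hγ : 0 < γ) {C : ℝ≥0∞} (hC : C ≠ ⊤)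
    (hemb : ∀ (w : L1 Ω) (G : L2V Ω), HasGrad w G →
      ∫⁻ x in Ω, ‖w x‖ₑ ^ 2 ≤ C * (‖G‖ₑ ^ 2 + ‖w‖ₑ ^ 2)) :
    ∫⁻ z, ‖weight z.1 • vel τ U ⌊z.1 / τ⌋₊ z.2‖ₑ ^ 2 ∂(stMeasure Ω) ≤
      C * (4 * (3 * Φ (U 0) / ENNReal.ofReal γ) + Φ (U 0)) := by
  have h1 := h.lintegral_weight_gradVel_le hΦ hγ
  rw [lintegral_weight_smul (stronglyMeasurable_step (gradVel τ U) τ)] at h1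
  rw [lintegral_weight_smul (stronglyMeasurable_step (vel τ U) τ)]
  simp only [← enorm_sq_eq_lintegral] at h1
  have hfl : Measurable fun s : ℝ => ⌊s / τ⌋₊ := Nat.measurable_floor.comp (measurable_id.div_const τ)
  have hm : Measurable fun s : ℝ => ENNReal.ofReal (weight s) ^ 2 * ‖gradVel τ U ⌊s / τ⌋₊‖ₑ ^ 2 :=
    (measurable_weight.ennreal_ofReal.pow_const 2).mul
      ((measurable_of_countable fun n => ‖gradVel τ U n‖ₑ ^ 2).comp hfl)
  calc _ ≤ ∫⁻ s in Ioi (0 : ℝ), C * (ENNReal.ofReal (weight s) ^ 2 * ‖gradVel τ U ⌊s / τ⌋₊‖ₑ ^ 2 +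
          ENNReal.ofReal (m ⌊s / τ⌋₊ ^ 2)) := by
        refine lintegral_mono fun s => ?_
        have h2 := hemb _ _ (h.hasGrad_vel hΦ ⌊s / τ⌋₊)
        have h3 : ‖vel τ U ⌊s / τ⌋₊‖ₑ ^ 2 = ENNReal.ofReal (m ⌊s / τ⌋₊ ^ 2) := by
          rw [ENNReal.ofReal_pow (h.m_nonneg _), ← h.norm_vel, ofReal_norm]
        rw [h3] at h2
        have h4 : ENNReal.ofReal (weight s) ^ 2 ≤ 1 := by
          refine pow_le_one' ?_ 2
          rw [← ENNReal.ofReal_one]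
          exact ENNReal.ofReal_le_ofReal (weight_le_one s)
        generalize ENNReal.ofReal (weight s) ^ 2 = w at h4 ⊢
        generalize ‖gradVel τ U ⌊s / τ⌋₊‖ₑ ^ 2 = G at h2 ⊢
        generalize ENNReal.ofReal (m ⌊s / τ⌋₊ ^ 2) = M at h2 ⊢
        calc _ ≤ w * (C * (G + M)) := mul_le_mul_right h2 _
          _ = C * (w * G + w * M) := by ring
          _ ≤ C * (w * G + M) := by
            gcongr
            exact mul_le_of_le_one_left' h4
    _ ≤ _ := by
        rw [lintegral_const_mul' _ _ hC, lintegral_add_left hm]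
        gcongr
        exact h.lintegral_m_sq_le hΦ hγ.le

/-- The weak limit of the velocities of discrete flows. -/
lemma exists_velocity (hΩ : IsOpen Ω) (hb : Bornology.IsBounded Ω) (hlip : HasLipschitzBoundary Ω)
    [IsFiniteMeasure (volume.restrict Ω)]
    (hΦ : IsStrongEnergy γ Φ) (hγ : 0 < γ) {τ : ℕ → ℝ} {U : ℕ → ℕ → L1 Ω}
    {l : ℕ → ℕ → StrongDual ℝ (L1 Ω)} {m : ℕ → ℕ → ℝ}
    (h : ∀ k, IsFlowData Φ (τ k) (U k) (l k) (m k)) {u₀ : L1 Ω} (h0 : ∀ k, U k 0 = u₀)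
    (𝒰 : Ultrafilter ℕ) :
    ∃ (v : ℝ × E d → ℝ) (Dv : ℝ × E d → E d), StronglyMeasurable v ∧ StronglyMeasurable Dv ∧
      (∀ t : ℝ, 0 < t → MemLp v 2 (volume.restrict (Ioi t ×ˢ Ω)) ∧
        MemLp Dv 2 (volume.restrict (Ioi t ×ˢ Ω))) ∧
      (∀ᵐ s ∂(volume.restrict (Ioi (0 : ℝ))),
        IsW11Gradient Ω (fun x => v (s, x)) (fun x => Dv (s, x))) ∧
      (∀ t : ℝ, 0 < t → ∀ y : ℝ × E d → ℝ, MemLp y 2 (volume.restrict (Ioi t ×ˢ Ω)) →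
        Tendsto (fun k => ∫ z in Ioi t ×ˢ Ω, inner ℝ (vel (τ k) (U k) ⌊z.1 / τ k⌋₊ z.2) (y z)) 𝒰
          (𝓝 (∫ z in Ioi t ×ˢ Ω, inner ℝ (v z) (y z)))) ∧
      (∀ t : ℝ, 0 < t → ∀ y : ℝ × E d → E d, MemLp y 2 (volume.restrict (Ioi t ×ˢ Ω)) →
        Tendsto (fun k => ∫ z in Ioi t ×ˢ Ω, inner ℝ (gradVel (τ k) (U k) ⌊z.1 / τ k⌋₊ z.2) (y z)) 𝒰
          (𝓝 (∫ z in Ioi t ×ˢ Ω, inner ℝ (Dv z) (y z)))) := by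
  obtain ⟨C, hC, hemb⟩ := exists_embedding_constant hΩ hb hlip
  have hu₀ : Φ u₀ ≠ ⊤ := by rw [← h0 0]; exact ((h 0).fin 0).ne
  have hwm : StronglyMeasurable fun z : ℝ × E d => weight z.1 :=
    (measurable_weight.comp measurable_fst).stronglyMeasurable
  have hC1 : 4 * (3 * Φ u₀ / ENNReal.ofReal γ) ≠ ⊤ :=
    ENNReal.mul_ne_top (by norm_num) (ENNReal.div_ne_top (ENNReal.mul_ne_top (by norm_num) hu₀)
      (by simpa using hγ))
  have hC2 : C * (4 * (3 * Φ u₀ / ENNReal.ofReal γ) + Φ u₀) ≠ ⊤ :=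
    ENNReal.mul_ne_top hC (ENNReal.add_ne_top.2 ⟨hC1, hu₀⟩)
  choose hG hGb using fun k => memLp_two_of_lintegral_le
    (f := fun z : ℝ × E d => weight z.1 • gradVel (τ k) (U k) ⌊z.1 / τ k⌋₊ z.2)
    (hwm.smul (stronglyMeasurable_step (gradVel (τ k) (U k)) (τ k))).aestronglyMeasurable hC1
    (by simpa only [h0 k] using (h k).lintegral_weight_gradVel_le hΦ hγ)
  choose hv hvb using fun k => memLp_two_of_lintegral_le
    (f := fun z : ℝ × E d => weight z.1 • vel (τ k) (U k) ⌊z.1 / τ k⌋₊ z.2)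
    (hwm.smul (stronglyMeasurable_step (vel (τ k) (U k)) (τ k))).aestronglyMeasurable hC2
    (by simpa only [h0 k] using (h k).lintegral_weight_vel_le hΦ hγ hC hemb)
  -- Velocity and gradient are taken to the limit as one vector, so that the limit belongs to the
  -- weakly closed space `gradientPairs` and the second component remains the gradient of the first.
  obtain ⟨P, hP⟩ := exists_weak_limit 𝒰
    (x := fun k => (WithLp.toLp 2 ((hv k).toLp, (hG k).toLp) : PairSpace Ω))
    (C := √(C * (4 * (3 * Φ u₀ / ENNReal.ofReal γ) + Φ u₀)).toReal +
      √(4 * (3 * Φ u₀ / ENNReal.ofReal γ)).toReal) fun k => by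
      have h1 := norm_add_le (WithLp.toLp 2 ((hv k).toLp, 0) : PairSpace Ω)
        (WithLp.toLp 2 (0, (hG k).toLp))
      rw [← WithLp.toLp_add, Prod.mk_add_mk, add_zero, zero_add, WithLp.norm_toLp_fst,
        WithLp.norm_toLp_snd] at h1
      exact h1.trans (add_le_add (hvb k) (hGb k))
  have hP1 : ∀ y, Tendsto (fun k => inner ℝ (hv k).toLp y) 𝒰 (𝓝 (inner ℝ P.fst y)) := fun y => by
    simpa [WithLp.prod_inner_apply] using hP (WithLp.toLp 2 (y, 0))
  have hP2 : ∀ y, Tendsto (fun k => inner ℝ (hG k).toLp y) 𝒰 (𝓝 (inner ℝ P.snd y)) := fun y => by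
    simpa [WithLp.prod_inner_apply] using hP (WithLp.toLp 2 (0, y))
  have hPmem : P ∈ (gradientPairs Ω : Set (PairSpace Ω)) := by
    refine mem_of_weak_limit hP isClosed_gradientPairs (gradientPairs Ω).convex
      (Eventually.of_forall fun k => ?_)
    change ∀ᵐ s ∂(volume.restrict (Ioi (0 : ℝ))), _
    filter_upwards [Measure.ae_ae_of_ae_prod (hv k).coeFn_toLp,
      Measure.ae_ae_of_ae_prod (hG k).coeFn_toLp] with s h1 h2
    refine (IsW11Gradient.const_smul ((h k).hasGrad_vel hΦ ⌊s / τ k⌋₊) (weight s)).congr ?_ ?_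
    · filter_upwards [h1] with x hx using hx.symm
    · filter_upwards [h2] with x hx using hx.symm
  have hwi : StronglyMeasurable fun z : ℝ × E d => (weight z.1)⁻¹ :=
    (measurable_weight.comp measurable_fst).inv.stronglyMeasurable
  refine ⟨fun z => (weight z.1)⁻¹ • P.fst z, fun z => (weight z.1)⁻¹ • P.snd z,
    hwi.smul (Lp.stronglyMeasurable _), hwi.smul (Lp.stronglyMeasurable _), fun t ht =>
    ⟨memLp_inv_weight_smul ht (memLp_tail ht.le (Lp.memLp _)),
      memLp_inv_weight_smul ht (memLp_tail ht.le (Lp.memLp _))⟩, ?_,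
    fun t ht y hy => tendsto_integral_inner_of_weight hv hP1 ht hy,
    fun t ht y hy => tendsto_integral_inner_of_weight hG hP2 ht hy⟩
  have hPmem' : ∀ᵐ s ∂(volume.restrict (Ioi (0 : ℝ))),
    IsW11Gradient Ω (fun x => P.fst (s, x)) (fun x => P.snd (s, x)) := hPmem
  filter_upwards [hPmem'] with s hs
  exact hs.const_smul _

end Velocity

/-! ### Convergence of the discrete flows. -/

section Limit

variable {d : ℕ} {Ω : Set (E d)} {Φ : L1 Ω → ℝ≥0∞} {γ : ℝ}

lemma IsFlowData.memLp_gradVel {τ : ℝ} {U : ℕ → L1 Ω} {l : ℕ → StrongDual ℝ (L1 Ω)} {m : ℕ → ℝ}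
    (h : IsFlowData Φ τ U l m) (hΦ : IsStrongEnergy γ Φ) (hγ : 0 < γ) {t : ℝ} (ht : 0 < t) :
    MemLp (fun z : ℝ × E d => gradVel τ U ⌊z.1 / τ⌋₊ z.2) 2 (volume.restrict (Ioi t ×ˢ Ω)) := by
  have hC : 4 * (3 * Φ (U 0) / ENNReal.ofReal γ) ≠ ⊤ :=
    ENNReal.mul_ne_top (by norm_num) (ENNReal.div_ne_top (ENNReal.mul_ne_top (by norm_num)
      (h.fin 0).ne) (by simpa using hγ))
  obtain ⟨h1, -⟩ := memLp_two_of_lintegral_le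
    (f := fun z : ℝ × E d => weight z.1 • gradVel τ U ⌊z.1 / τ⌋₊ z.2)
    ((measurable_weight.comp measurable_fst).stronglyMeasurable.smul
      (stronglyMeasurable_step (gradVel τ U) τ)).aestronglyMeasurable hC
    (h.lintegral_weight_gradVel_le hΦ hγ)
  refine (memLp_inv_weight_smul ht (memLp_tail ht.le h1)).ae_eq ?_
  filter_upwards [ae_restrict_fst_mem ht.le Ω] with z hz
  rw [inv_smul_smul₀ (weight_pos (ht.trans hz)).ne']

lemma IsFlowData.memLp_vel {τ : ℝ} {U : ℕ → L1 Ω} {l : ℕ → StrongDual ℝ (L1 Ω)} {m : ℕ → ℝ}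
    (h : IsFlowData Φ τ U l m) (hΩ : IsOpen Ω) (hb : Bornology.IsBounded Ω)
    (hlip : HasLipschitzBoundary Ω)
    (hΦ : IsStrongEnergy γ Φ) (hγ : 0 < γ) {t : ℝ} (ht : 0 < t) :
    MemLp (fun z : ℝ × E d => vel τ U ⌊z.1 / τ⌋₊ z.2) 2 (volume.restrict (Ioi t ×ˢ Ω)) := by
  obtain ⟨C, hC, hemb⟩ := exists_embedding_constant hΩ hb hlip
  have hC' : C * (4 * (3 * Φ (U 0) / ENNReal.ofReal γ) + Φ (U 0)) ≠ ⊤ :=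
    ENNReal.mul_ne_top hC (ENNReal.add_ne_top.2 ⟨ENNReal.mul_ne_top (by norm_num)
      (ENNReal.div_ne_top (ENNReal.mul_ne_top (by norm_num)
      (h.fin 0).ne) (by simpa using hγ)), (h.fin 0).ne⟩)
  obtain ⟨h1, -⟩ := memLp_two_of_lintegral_le
    (f := fun z : ℝ × E d => weight z.1 • vel τ U ⌊z.1 / τ⌋₊ z.2)
    ((measurable_weight.comp measurable_fst).stronglyMeasurable.smul
      (stronglyMeasurable_step (vel τ U) τ)).aestronglyMeasurable hC'
    (h.lintegral_weight_vel_le hΦ hγ hC hemb)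
  refine (memLp_inv_weight_smul ht (memLp_tail ht.le h1)).ae_eq ?_
  filter_upwards [ae_restrict_fst_mem ht.le Ω] with z hz
  rw [inv_smul_smul₀ (weight_pos (ht.trans hz)).ne']

lemma intervalIntegrable_step (c : ℕ → ℝ) {τ : ℝ} (hτ : 0 < τ) (a b : ℝ) :
    IntervalIntegrable (fun s => c ⌊s / τ⌋₊) volume a b := by
  have hm : Measurable fun s : ℝ => c ⌊s / τ⌋₊ :=
    (measurable_of_countable c).comp (Nat.measurable_floor.comp (measurable_id.div_const τ))
  rw [intervalIntegrable_iff]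
  refine Measure.integrableOn_of_bounded (by simp) hm.aestronglyMeasurable
    (M := ∑ n ∈ Finset.range (⌊max a b / τ⌋₊ + 1), |c n|) ?_
  filter_upwards [ae_restrict_mem measurableSet_uIoc] with s hs
  exact Finset.single_le_sum (f := fun n => |c n|) (fun n _ => abs_nonneg _)
    (Finset.mem_range.2 (Nat.lt_succ_of_le (floor_div_mono hτ hs.2)))

/-- The curve `u` is the limit of discrete flows, for which the optimality conditions hold. -/
structure IsApproximation (Φ : L1 Ω → ℝ≥0∞) (u₀ : L1 Ω) (u : ℝ → L1 Ω) (τ : ℕ → ℝ)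
    (U : ℕ → ℕ → L1 Ω) (l : ℕ → ℕ → StrongDual ℝ (L1 Ω)) (m : ℕ → ℕ → ℝ) : Prop where
  data : ∀ k, IsFlowData Φ (τ k) (U k) (l k) (m k)
  init : ∀ k, U k 0 = u₀
  step : Tendsto τ atTop (𝓝 0)
  cont : ContinuousOn u (Ici 0)
  conv : ∀ T : ℝ, 0 < T → TendstoUniformlyOn (fun k t => U k ⌊t / τ k⌋₊) u atTop (Icc 0 T)

variable {u₀ : L1 Ω} {u : ℝ → L1 Ω} {τ : ℕ → ℝ} {U : ℕ → ℕ → L1 Ω}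
  {l : ℕ → ℕ → StrongDual ℝ (L1 Ω)} {m : ℕ → ℕ → ℝ}

namespace IsApproximation

/-- The window of length `τ k` after `s` covers the value at `s`, the value one step later and the
averages over one step; all of them converge to `u s`. -/
lemma eventually_norm_lt (h : IsApproximation Φ u₀ u τ U l m) {s : ℝ} (hs : 0 ≤ s) {ε : ℝ}
    (hε : 0 < ε) : ∀ᶠ k in atTop, ∀ σ ∈ Icc s (s + τ k), ‖U k ⌊σ / τ k⌋₊ - u s‖ < ε := by
  have h1 := Metric.tendstoUniformlyOn_iff.1 (h.conv (s + 1) (by linarith)) (ε / 2) (by linarith)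
  obtain ⟨δ, hδ, h2⟩ := Metric.continuousWithinAt_iff.1 (h.cont s hs) (ε / 2) (by linarith)
  filter_upwards [h1, h.step.eventually (gt_mem_nhds (lt_min hδ one_pos))] with k hk hk' σ hσ
  have h3 := hk σ ⟨hs.trans hσ.1, by linarith [hσ.2, (lt_min_iff.1 hk').2]⟩
  have h4 := h2 (x := σ) (hs.trans hσ.1) (by
    rw [Real.dist_eq, abs_of_nonneg (by linarith [hσ.1])]
    linarith [hσ.2, (lt_min_iff.1 hk').1])
  rw [dist_comm, dist_eq_norm] at h3
  rw [dist_eq_norm] at h4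
  calc _ = ‖(U k ⌊σ / τ k⌋₊ - u σ) + (u σ - u s)‖ := by rw [sub_add_sub_cancel]
    _ ≤ _ := norm_add_le _ _
    _ < ε := by linarith

lemma tendsto (h : IsApproximation Φ u₀ u τ U l m) {s : ℝ} (hs : 0 ≤ s) :
    Tendsto (fun k => U k ⌊s / τ k⌋₊) atTop (𝓝 (u s)) := by
  refine Metric.tendsto_nhds.2 fun ε hε => ?_
  filter_upwards [h.eventually_norm_lt hs hε] with k hk
  rw [dist_eq_norm]
  exact hk s ⟨le_rfl, by linarith [(h.data k).pos]⟩

lemma tendsto_succ (h : IsApproximation Φ u₀ u τ U l m) {s : ℝ} (hs : 0 ≤ s) :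
    Tendsto (fun k => U k (⌊s / τ k⌋₊ + 1)) atTop (𝓝 (u s)) := by
  refine Metric.tendsto_nhds.2 fun ε hε => ?_
  filter_upwards [h.eventually_norm_lt hs hε] with k hk
  rw [dist_eq_norm, ← floor_add_div (h.data k).pos hs]
  exact hk _ ⟨by linarith [(h.data k).pos], le_rfl⟩

lemma tendsto_average (h : IsApproximation Φ u₀ u τ U l m) {s : ℝ} (hs : 0 ≤ s)
    (L : StrongDual ℝ (L1 Ω)) :
    Tendsto (fun k => (τ k)⁻¹ * ∫ σ in s..(s + τ k), L (U k ⌊σ / τ k⌋₊)) atTop (𝓝 (L (u s))) := by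
  refine Metric.tendsto_nhds.2 fun ε hε => ?_
  have hε' : 0 < ε / (2 * (‖L‖ + 1)) := by positivity
  filter_upwards [h.eventually_norm_lt hs hε'] with k hk
  have hτ := (h.data k).pos
  have h1 : (τ k)⁻¹ * (∫ σ in s..(s + τ k), L (U k ⌊σ / τ k⌋₊)) - L (u s) =
      (τ k)⁻¹ * ∫ σ in s..(s + τ k), (L (U k ⌊σ / τ k⌋₊) - L (u s)) := by
    rw [intervalIntegral.integral_sub (intervalIntegrable_step (fun n => L (U k n)) hτ _ _)
      intervalIntegrable_const, intervalIntegral.integral_const, add_sub_cancel_left, smul_eq_mul,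
      mul_sub, inv_mul_cancel_left₀ hτ.ne']
  have h2 := intervalIntegral.norm_integral_le_of_norm_le_const (a := s) (b := s + τ k)
    (f := fun σ => L (U k ⌊σ / τ k⌋₊) - L (u s)) (C := ε / 2) fun σ hσ => by
      rw [uIoc_of_le (by linarith)] at hσ
      rw [← map_sub]
      refine (L.le_opNorm _).trans ?_
      have h3 := (hk σ ⟨hσ.1.le, hσ.2⟩).le
      calc ‖L‖ * ‖U k ⌊σ / τ k⌋₊ - u s‖ ≤ (‖L‖ + 1) * (ε / (2 * (‖L‖ + 1))) := by
            gcongr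
            linarith
        _ = ε / 2 := by field_simp
  rw [Real.dist_eq, h1, abs_mul, abs_inv, abs_of_pos hτ]
  rw [add_sub_cancel_left, abs_of_pos hτ, Real.norm_eq_abs] at h2
  calc _ ≤ (τ k)⁻¹ * (ε / 2 * τ k) := by gcongr
    _ = ε / 2 := by field_simp
    _ < ε := by linarith

/-- The integral over `(s, s')` of a difference quotient with step `τ` is the average over `(s', s'
+ τ)` minus the average over `(s, s + τ)`. -/
lemma tendsto_integral_vel (h : IsApproximation Φ u₀ u τ U l m) {s s' : ℝ} (hs : 0 ≤ s)
    (hs' : s ≤ s') (L : StrongDual ℝ (L1 Ω)) :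
    Tendsto (fun k => ∫ σ in s..s', L (vel (τ k) (U k) ⌊σ / τ k⌋₊)) atTop
      (𝓝 (L (u s' - u s))) := by
  rw [map_sub]
  refine ((h.tendsto_average (hs.trans hs') L).sub (h.tendsto_average hs L)).congr fun k => ?_
  have hτ := (h.data k).pos
  have hi := fun a b => intervalIntegrable_step (fun n => L (U k n)) hτ a b
  have h1 : ∫ σ in s..s', L (vel (τ k) (U k) ⌊σ / τ k⌋₊) =
      ∫ σ in s..s', (τ k)⁻¹ * (L (U k ⌊(σ + τ k) / τ k⌋₊) - L (U k ⌊σ / τ k⌋₊)) := by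
    refine intervalIntegral.integral_congr fun σ hσ => ?_
    rw [uIcc_of_le hs'] at hσ
    rw [floor_add_div hτ (hs.trans hσ.1), vel, map_smul, map_sub, smul_eq_mul]
  rw [h1, intervalIntegral.integral_const_mul, intervalIntegral.integral_sub
    ?_ (hi _ _), intervalIntegral.integral_comp_add_right (fun σ => L (U k ⌊σ / τ k⌋₊)), ← mul_sub]
  · have e1 := intervalIntegral.integral_add_adjacent_intervals (hi s s') (hi s' (s' + τ k))
    have e2 := intervalIntegral.integral_add_adjacent_intervals (hi s (s + τ k))
      (hi (s + τ k) (s' + τ k))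
    congr 1
    linarith
  · have := (hi (s + τ k) (s' + τ k)).comp_add_right (τ k)
    rwa [add_sub_cancel_right, add_sub_cancel_right] at this

end IsApproximation

end Limit

/-! ### Integration over bounded time cylinders. -/

section Cylinder

variable {d : ℕ} {Ω : Set (E d)}

lemma volume_restrict_prod (A : Set ℝ) (Ω : Set (E d)) :
    (volume : Measure (ℝ × E d)).restrict (A ×ˢ Ω) = (volume.restrict A).prod (volume.restrict Ω) := by
  rw [Measure.prod_restrict, Measure.volume_eq_prod]

lemma restrict_Ioc_le {s s' : ℝ} : (volume : Measure (ℝ × E d)).restrict (Ioc s s' ×ˢ Ω) ≤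
    volume.restrict (Ioi s ×ˢ Ω) :=
  Measure.restrict_mono (Set.prod_mono Ioc_subset_Ioi_self le_rfl) le_rfl

lemma restrict_restrict_Ioc (s s' : ℝ) (Ω : Set (E d)) :
    ((volume : Measure (ℝ × E d)).restrict (Ioi s ×ˢ Ω)).restrict (Ioc s s' ×ˢ univ) =
      volume.restrict (Ioc s s' ×ˢ Ω) := by
  rw [Measure.restrict_restrict (measurableSet_Ioc.prod .univ), prod_inter_prod, univ_inter,
    inter_eq_left.2 Ioc_subset_Ioi_self]

instance isFiniteMeasure_Ioc [IsFiniteMeasure (volume.restrict Ω)] (s s' : ℝ) :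
    IsFiniteMeasure ((volume : Measure (ℝ × E d)).restrict (Ioc s s' ×ˢ Ω)) := by
  rw [volume_restrict_prod]
  infer_instance

lemma memLp_comp_snd [IsFiniteMeasure (volume.restrict Ω)] (q : LInf Ω) (s s' : ℝ) :
    MemLp (fun z : ℝ × E d => q z.2) 2 (volume.restrict (Ioc s s' ×ˢ Ω)) := by
  refine MemLp.of_bound ((Lp.stronglyMeasurable q).comp_measurable
    measurable_snd).aestronglyMeasurable ‖q‖ ?_
  rw [volume_restrict_prod]
  exact Measure.quasiMeasurePreserving_snd.ae (ae_norm_le_norm_top q)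

lemma integral_prod_pairing [IsFiniteMeasure (volume.restrict Ω)] {s s' : ℝ} (hs : s ≤ s')
    {f : ℝ → L1 Ω} (hf : MemLp (fun z : ℝ × E d => f z.1 z.2) 2 (volume.restrict (Ioi s ×ˢ Ω)))
    (q : LInf Ω) :
    ∫ z in Ioc s s' ×ˢ Ω, f z.1 z.2 * q z.2 = ∫ σ in s..s', pairing q (f σ) := by
  have hi : Integrable (fun z : ℝ × E d => f z.1 z.2 * q z.2) (volume.restrict (Ioc s s' ×ˢ Ω)) :=
    (hf.mono_measure restrict_Ioc_le).integrable_mul (memLp_comp_snd q s s')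
  rw [volume_restrict_prod] at hi ⊢
  rw [integral_prod _ hi, intervalIntegral.integral_of_le hs]
  refine integral_congr_ae (Eventually.of_forall fun σ => ?_)
  simp only
  rw [pairing_apply]
  simp only [mul_comm]

end Cylinder

/-! ### Increments of the limit curve as integrals of the velocity. -/

section Increment

variable {d : ℕ} {Ω : Set (E d)} {Φ : L1 Ω → ℝ≥0∞} {γ : ℝ} {u₀ : L1 Ω} {u : ℝ → L1 Ω} {τ : ℕ → ℝ}
  {U : ℕ → ℕ → L1 Ω} {l : ℕ → ℕ → StrongDual ℝ (L1 Ω)} {m : ℕ → ℕ → ℝ}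

/-- `v` is the weak limit of the velocities of the discrete flows `U k`. -/
structure IsVelocity (Ω : Set (E d)) (τ : ℕ → ℝ) (U : ℕ → ℕ → L1 Ω) (𝒰 : Ultrafilter ℕ)
    (v : ℝ × E d → ℝ) : Prop where
  le_atTop : (𝒰 : Filter ℕ) ≤ atTop
  memLp_vel : ∀ k (t : ℝ), 0 < t →
    MemLp (fun z : ℝ × E d => vel (τ k) (U k) ⌊z.1 / τ k⌋₊ z.2) 2 (volume.restrict (Ioi t ×ˢ Ω))
  meas : StronglyMeasurable v
  memLp : ∀ t : ℝ, 0 < t → MemLp v 2 (volume.restrict (Ioi t ×ˢ Ω))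
  weak : ∀ t : ℝ, 0 < t → ∀ y : ℝ × E d → ℝ, MemLp y 2 (volume.restrict (Ioi t ×ˢ Ω)) →
    Tendsto (fun k => ∫ z in Ioi t ×ˢ Ω, inner ℝ (vel (τ k) (U k) ⌊z.1 / τ k⌋₊ z.2) (y z)) 𝒰
      (𝓝 (∫ z in Ioi t ×ˢ Ω, inner ℝ (v z) (y z)))

variable [IsFiniteMeasure (volume.restrict Ω)] {𝒰 : Ultrafilter ℕ} {v : ℝ × E d → ℝ}

/-- Both sides are limits of the same discrete integrals: telescoping gives one, and weak
convergence tested with `q` on the cylinder `(s, s'] × Ω` gives the other. -/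
lemma IsVelocity.pairing_sub (hv : IsVelocity Ω τ U 𝒰 v) (h : IsApproximation Φ u₀ u τ U l m)
    {s s' : ℝ} (hs : 0 < s) (hs' : s ≤ s') (q : LInf Ω) :
    pairing q (u s' - u s) = ∫ z in Ioc s s' ×ˢ Ω, v z * q z.2 := by
  have hS : MeasurableSet (Ioc s s' ×ˢ (univ : Set (E d))) := measurableSet_Ioc.prod .univ
  have hy : MemLp ((Ioc s s' ×ˢ (univ : Set (E d))).indicator fun z => q z.2) 2
      (volume.restrict (Ioi s ×ˢ Ω)) := by
    rw [memLp_indicator_iff_restrict hS, restrict_restrict_Ioc]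
    exact memLp_comp_snd q s s'
  have key : ∀ f : ℝ × E d → ℝ, ∫ z in Ioi s ×ˢ Ω,
      inner ℝ (f z) ((Ioc s s' ×ˢ (univ : Set (E d))).indicator (fun z => q z.2) z) =
      ∫ z in Ioc s s' ×ˢ Ω, f z * q z.2 := fun f => by
    rw [← restrict_restrict_Ioc s s' Ω, ← integral_indicator hS]
    refine integral_congr_ae (Eventually.of_forall fun z => ?_)
    by_cases hz : z ∈ Ioc s s' ×ˢ (univ : Set (E d)) <;> simp [hz, mul_comm]
  have h1 := hv.weak s hs _ hy
  simp only [key] at h1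
  refine tendsto_nhds_unique ((h.tendsto_integral_vel hs.le hs' (pairing q)).mono_left hv.le_atTop)
    (h1.congr fun k => ?_)
  exact integral_prod_pairing hs' (f := fun σ => vel (τ k) (U k) ⌊σ / τ k⌋₊) (hv.memLp_vel k s hs) q

lemma IsVelocity.integrable_sub (hv : IsVelocity Ω τ U 𝒰 v) {s : ℝ} (hs : 0 < s) (s' : ℝ) (w : L1 Ω) :
    Integrable (fun z : ℝ × E d => v z - w z.2) (volume.restrict (Ioc s s' ×ˢ Ω)) := by
  refine (((hv.memLp s hs).mono_measure restrict_Ioc_le).integrable (by norm_num)).sub ?_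
  rw [volume_restrict_prod]
  exact (L1.integrable_coeFn w).comp_snd _

/-- By duality, the norm is attained by the pairing with a function bounded by `1`. Subtracting a
fixed `w` prepares the Lebesgue point argument for the right derivative. -/
lemma IsVelocity.norm_sub_le (hv : IsVelocity Ω τ U 𝒰 v) (h : IsApproximation Φ u₀ u τ U l m)
    {s s' : ℝ} (hs : 0 < s) (hs' : s ≤ s') (w : L1 Ω) :
    ‖u s' - u s - (s' - s) • w‖ ≤ ∫ σ in s..s', ∫ x in Ω, |v (σ, x) - w x| := by
  obtain ⟨L, hL, hL'⟩ := exists_dual_vector'' ℝ (u s' - u s - (s' - s) • w)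
  obtain ⟨q, rfl, hq⟩ := exists_pairing_eq L
  have hi := hv.integrable_sub hs s' w
  have hiq : ∀ f : ℝ × E d → ℝ, Integrable f (volume.restrict (Ioc s s' ×ˢ Ω)) →
      Integrable (fun z => f z * q z.2) (volume.restrict (Ioc s s' ×ˢ Ω)) := fun f hf => by
    refine hf.mul_bdd (c := ‖q‖) (memLp_comp_snd q s s').1 ?_
    rw [volume_restrict_prod]
    exact Measure.quasiMeasurePreserving_snd.ae (ae_norm_le_norm_top q)
  have hw : Integrable (fun z : ℝ × E d => w z.2) (volume.restrict (Ioc s s' ×ˢ Ω)) := by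
    rw [volume_restrict_prod]
    exact (L1.integrable_coeFn w).comp_snd _
  have hv1 : Integrable v (volume.restrict (Ioc s s' ×ˢ Ω)) :=
    ((hv.memLp s hs).mono_measure restrict_Ioc_le).integrable (by norm_num)
  have h1 : (s' - s) * pairing q w = ∫ z in Ioc s s' ×ˢ Ω, w z.2 * q z.2 := by
    have h2 := hiq _ hw
    rw [volume_restrict_prod] at h2 ⊢
    rw [integral_prod _ h2]
    simp only [integral_const, measureReal_restrict_apply_univ, Real.volume_real_Ioc_of_le hs',
      smul_eq_mul, pairing_apply, mul_comm]
  calc ‖u s' - u s - (s' - s) • w‖ = pairing q (u s' - u s - (s' - s) • w) := hL'.symm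
    _ = ∫ z in Ioc s s' ×ˢ Ω, (v z - w z.2) * q z.2 := by
        rw [map_sub, map_smul, hv.pairing_sub h hs hs', smul_eq_mul, h1,
          ← integral_sub (hiq _ hv1) (hiq _ hw)]
        simp only [sub_mul]
    _ ≤ ∫ z in Ioc s s' ×ˢ Ω, |v z - w z.2| := by
        have hq1 : ∀ᵐ z : ℝ × E d ∂(volume.restrict (Ioc s s' ×ˢ Ω)), ‖q z.2‖ ≤ ‖q‖ := by
          rw [volume_restrict_prod]
          exact Measure.quasiMeasurePreserving_snd.ae (ae_norm_le_norm_top q)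
        refine integral_mono_ae (hiq _ hi) hi.abs ?_
        filter_upwards [hq1] with z hz
        refine (le_abs_self _).trans ?_
        rw [abs_mul]
        exact mul_le_of_le_one_right (abs_nonneg _) (hz.trans (hq.trans hL))
    _ = _ := by
        have h3 := hi.abs
        rw [volume_restrict_prod] at h3 ⊢
        rw [integral_prod _ h3, intervalIntegral.integral_of_le hs']

end Increment

/-! ### Pairings with bounded functions. -/

section Pair

variable {d : ℕ} {Ω : Set (E d)}

lemma integrable_mul_of_bound (w : L1 Ω) {ψ : E d → ℝ} (hψ : Measurable ψ) {B : ℝ}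
    (hB : ∀ x, |ψ x| ≤ B) : Integrable (fun x => w x * ψ x) (volume.restrict Ω) :=
  (L1.integrable_coeFn w).mul_bdd (c := B) hψ.aestronglyMeasurable (Eventually.of_forall hB)

lemma abs_integral_mul_le (w : L1 Ω) {ψ : E d → ℝ} {B : ℝ} (hB : ∀ x, |ψ x| ≤ B) :
    |∫ x in Ω, w x * ψ x| ≤ B * ‖w‖ := by
  rw [L1.norm_eq_integral_norm, ← integral_const_mul]
  refine norm_integral_le_of_norm_le (G := ℝ) ((L1.integrable_coeFn w).norm.const_mul B)
    (Eventually.of_forall fun x => ?_)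
  rw [norm_mul, mul_comm]
  exact mul_le_mul_of_nonneg_right (hB x) (norm_nonneg _)

lemma integral_sub_mul (w w' : L1 Ω) {ψ : E d → ℝ} (hψ : Measurable ψ) {B : ℝ}
    (hB : ∀ x, |ψ x| ≤ B) :
    ∫ x in Ω, (w - w') x * ψ x = (∫ x in Ω, w x * ψ x) - ∫ x in Ω, w' x * ψ x := by
  rw [← integral_sub (integrable_mul_of_bound w hψ hB) (integrable_mul_of_bound w' hψ hB)]
  refine integral_congr_ae ?_
  filter_upwards [Lp.coeFn_sub w w'] with x hx
  rw [hx, Pi.sub_apply, sub_mul]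

lemma tendsto_integral_mul {w : ℕ → L1 Ω} {w₀ : L1 Ω} (hw : Tendsto w atTop (𝓝 w₀))
    {ψ : ℕ → E d → ℝ} {ψ₀ : E d → ℝ} (hψ : ∀ k, Measurable (ψ k)) {B : ℝ}
    (hB : ∀ᶠ k in atTop, ∀ x, |ψ k x| ≤ B) (h : ∀ x, Tendsto (fun k => ψ k x) atTop (𝓝 (ψ₀ x))) :
    Tendsto (fun k => ∫ x in Ω, w k x * ψ k x) atTop (𝓝 (∫ x in Ω, w₀ x * ψ₀ x)) := by
  have h1 : Tendsto (fun k => ∫ x in Ω, w₀ x * ψ k x) atTop (𝓝 (∫ x in Ω, w₀ x * ψ₀ x)) := by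
    refine tendsto_integral_filter_of_dominated_convergence (fun x => |w₀ x| * B)
      (Eventually.of_forall fun k => (L1.integrable_coeFn w₀).1.mul (hψ k).aestronglyMeasurable)
      ?_ ((L1.integrable_coeFn w₀).abs.mul_const B)
      (Eventually.of_forall fun x => (h x).const_mul _)
    filter_upwards [hB] with k hk
    refine Eventually.of_forall fun x => ?_
    rw [norm_mul]
    exact mul_le_mul_of_nonneg_left (hk x) (norm_nonneg _)
  have h2 : Tendsto (fun k => ∫ x in Ω, (w k - w₀) x * ψ k x) atTop (𝓝 0) := by
    refine squeeze_zero_norm' (a := fun k => B * ‖w k - w₀‖) ?_ ?_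
    · filter_upwards [hB] with k hk
      exact abs_integral_mul_le _ hk
    · simpa using (tendsto_iff_norm_sub_tendsto_zero.1 hw).const_mul B
  have h3 := h2.add h1
  rw [zero_add] at h3
  refine h3.congr' ?_
  filter_upwards [hB] with k hk
  rw [integral_sub_mul _ _ (hψ k) hk, sub_add_cancel]

lemma integrable_integral_step (U : ℕ → L1 Ω) {τ : ℝ} (hτ : 0 < τ) {ψ : ℝ × E d → ℝ}
    (hψ : Continuous ψ) {B : ℝ} (hB : ∀ z, |ψ z| ≤ B) {a b : ℝ}
    (hs : ∀ z : ℝ × E d, z.1 ∉ Ioc a b → ψ z = 0) :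
    Integrable fun σ => ∫ x in Ω, U ⌊σ / τ⌋₊ x * ψ (σ, x) := by
  have hsupp : Function.support (fun σ => ∫ x in Ω, U ⌊σ / τ⌋₊ x * ψ (σ, x)) ⊆ Ioc a b := by
    refine fun σ hσ => by_contra fun h => hσ ?_
    simp [hs (σ, _) h]
  rw [← integrableOn_iff_integrable_of_support_subset hsupp]
  have h1 : IntegrableOn (fun σ => B * ‖U ⌊σ / τ⌋₊‖) (Ioc a b) := by
    rcases le_total a b with hab | hab
    · exact (intervalIntegrable_iff_integrableOn_Ioc_of_le hab).1
        (intervalIntegrable_step (fun n => B * ‖U n‖) hτ a b)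
    · simp [Ioc_eq_empty_of_le hab]
  refine Integrable.mono' h1 ?_ (Eventually.of_forall fun σ =>
    abs_integral_mul_le _ fun x => hB (σ, x))
  exact ((stronglyMeasurable_step U τ).mul
    hψ.stronglyMeasurable).integral_prod_right'.aestronglyMeasurable

end Pair

/-! ### The weak limit is the distributional time derivative. -/

section TimeDerivative

variable {d : ℕ} {Ω : Set (E d)} {Φ : L1 Ω → ℝ≥0∞} {γ : ℝ} {u₀ : L1 Ω} {u : ℝ → L1 Ω} {τ : ℕ → ℝ}
  {U : ℕ → ℕ → L1 Ω} {l : ℕ → ℕ → StrongDual ℝ (L1 Ω)} {m : ℕ → ℕ → ℝ}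

/-- Summation by parts for the step functions. -/
lemma integral_vel_mul_eq (U : ℕ → L1 Ω) {τ : ℝ} (hτ : 0 < τ) {φ : ℝ × E d → ℝ}
    (hφ : Continuous φ) {B : ℝ} (hB : ∀ z, |φ z| ≤ B) {a b : ℝ} (ha : 0 ≤ a)
    (hs : ∀ z : ℝ × E d, z.1 ∉ Ioc a b → φ z = 0) :
    ∫ σ, ∫ x in Ω, vel τ U ⌊σ / τ⌋₊ x * φ (σ, x) =
      ∫ σ, ∫ x in Ω, U ⌊σ / τ⌋₊ x * (τ⁻¹ * (φ (σ - τ, x) - φ (σ, x))) := by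
  have hφ' : Continuous fun z : ℝ × E d => φ (z.1 - τ, z.2) := by fun_prop
  have hmx : ∀ σ, Measurable fun x => φ (σ, x) := fun σ => by
    have : Continuous fun x => φ (σ, x) := by fun_prop
    exact this.measurable
  have i1 : Integrable fun σ => ∫ x in Ω, U ⌊σ / τ⌋₊ x * φ (σ - τ, x) :=
    integrable_integral_step U hτ hφ' (fun z => hB _) (a := a + τ) (b := b + τ) fun z hz =>
      hs _ fun h => hz ⟨by linarith [h.1], by linarith [h.2]⟩
  have i2 : Integrable fun σ => ∫ x in Ω, U ⌊σ / τ⌋₊ x * φ (σ, x) :=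
    integrable_integral_step U hτ hφ hB hs
  have i3 : Integrable fun σ => ∫ x in Ω, U ⌊(σ + τ) / τ⌋₊ x * φ (σ, x) := by
    simpa using i1.comp_add_right τ
  have e1 : ∀ σ, ∫ x in Ω, vel τ U ⌊σ / τ⌋₊ x * φ (σ, x) =
      τ⁻¹ * ((∫ x in Ω, U ⌊(σ + τ) / τ⌋₊ x * φ (σ, x)) - ∫ x in Ω, U ⌊σ / τ⌋₊ x * φ (σ, x)) := by
    intro σ
    by_cases hσ : σ ∈ Ioc a b
    · rw [← integral_sub_mul _ _ (hmx σ) (fun x => hB _), ← integral_const_mul,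
        floor_add_div hτ (ha.trans hσ.1.le)]
      refine integral_congr_ae ?_
      filter_upwards [Lp.coeFn_smul τ⁻¹ (U (⌊σ / τ⌋₊ + 1) - U ⌊σ / τ⌋₊)] with x hx
      rw [vel, hx, Pi.smul_apply, smul_eq_mul, mul_assoc]
    · simp [hs (σ, _) hσ]
  have e2 : ∀ σ, ∫ x in Ω, U ⌊σ / τ⌋₊ x * (τ⁻¹ * (φ (σ - τ, x) - φ (σ, x))) =
      τ⁻¹ * ((∫ x in Ω, U ⌊σ / τ⌋₊ x * φ (σ - τ, x)) - ∫ x in Ω, U ⌊σ / τ⌋₊ x * φ (σ, x)) := by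
    intro σ
    rw [← integral_sub (integrable_mul_of_bound _ (hmx _) fun x => hB _)
      (integrable_mul_of_bound _ (hmx _) fun x => hB _), ← integral_const_mul]
    congr 1
    ext x
    ring
  simp only [e1, e2]
  rw [integral_const_mul, integral_const_mul, integral_sub i3 i2, integral_sub i1 i2,
    ← integral_add_right_eq_self (fun σ => ∫ x in Ω, U ⌊σ / τ⌋₊ x * φ (σ - τ, x)) τ]
  simp

lemma IsTestFunction.exists_time_bounds {φ : ℝ × E d → ℝ} (hφ : IsTestFunction (Ioi 0 ×ˢ Ω) φ) :
    ∃ a b : ℝ, 0 < a ∧ ∀ z : ℝ × E d, z.1 ∉ Ioc a b → φ z = 0 := by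
  obtain ⟨a, ha, ha'⟩ := hφ.2.1.isCompact.exists_forall_le' (f := Prod.fst) (a := (0 : ℝ))
    continuous_fst.continuousOn fun z hz => (hφ.2.2 hz).1
  obtain ⟨b, hb⟩ := (hφ.2.1.isCompact.image continuous_fst).bddAbove
  refine ⟨a / 2, b, by positivity, fun z hz => image_eq_zero_of_notMem_tsupport fun h => hz ⟨?_, ?_⟩⟩
  · linarith [ha' z h]
  · exact hb (mem_image_of_mem _ h)

variable [IsFiniteMeasure (volume.restrict Ω)] {𝒰 : Ultrafilter ℕ} {v : ℝ × E d → ℝ}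

lemma IsVelocity.locallyIntegrableOn (hv : IsVelocity Ω τ U 𝒰 v) :
    LocallyIntegrableOn v (Ioi 0 ×ˢ Ω) := by
  intro z hz
  have hz1 : 0 < z.1 := hz.1
  refine ⟨Ioc (z.1 / 2) (z.1 + 1) ×ˢ Ω, ?_,
    ((hv.memLp (z.1 / 2) (by linarith)).mono_measure restrict_Ioc_le).integrable (by norm_num)⟩
  have h1 : Ioc (z.1 / 2) (z.1 + 1) ×ˢ (univ : Set (E d)) ∈ 𝓝 z :=
    prod_mem_nhds (Ioc_mem_nhds (by linarith) (by linarith)) univ_mem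
  filter_upwards [mem_nhdsWithin_of_mem_nhds h1, self_mem_nhdsWithin] with y hy hy'
  exact ⟨hy.1, hy'.2⟩

lemma IsVelocity.isTimeDerivative (hv : IsVelocity Ω τ U 𝒰 v) (hΩ : IsOpen Ω)
    (h : IsApproximation Φ u₀ u τ U l m) : IsTimeDerivative u v := by
  refine ⟨hv.locallyIntegrableOn, fun φ hφ => ?_⟩
  obtain ⟨a, b, ha, hs⟩ := hφ.exists_time_bounds
  obtain ⟨K, hK⟩ := hφ.1.lipschitzWith_of_hasCompactSupport hφ.2.1 (by simp)
  obtain ⟨B, hB⟩ := hφ.exists_bound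
  have hcont := hφ.continuous
  have hφ2 : MemLp φ 2 (volume.restrict (Ioi a ×ˢ Ω)) :=
    (hcont.memLp_of_hasCompactSupport hφ.2.1).restrict _
  have hτ := fun k => (h.data k).pos
  -- the limit of the left hand sides
  have hL := (hv.weak a ha φ hφ2)
  have eL : ∀ k, ∫ z in Ioi a ×ˢ Ω, inner ℝ (vel (τ k) (U k) ⌊z.1 / τ k⌋₊ z.2) (φ z) =
      ∫ σ, ∫ x in Ω, U k ⌊σ / τ k⌋₊ x * ((τ k)⁻¹ * (φ (σ - τ k, x) - φ (σ, x))) := fun k => by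
    rw [← integral_vel_mul_eq (U k) (hτ k) hcont hB ha.le hs]
    have hi : Integrable (fun z : ℝ × E d => vel (τ k) (U k) ⌊z.1 / τ k⌋₊ z.2 * φ z)
      (volume.restrict (Ioi a ×ˢ Ω)) := (hv.memLp_vel k a ha).integrable_mul hφ2
    have e1 : ∫ z in Ioi a ×ˢ Ω, inner ℝ (vel (τ k) (U k) ⌊z.1 / τ k⌋₊ z.2) (φ z) =
        ∫ z in Ioi a ×ˢ Ω, vel (τ k) (U k) ⌊z.1 / τ k⌋₊ z.2 * φ z := by
      refine integral_congr_ae (Eventually.of_forall fun z => ?_)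
      simp [mul_comm]
    rw [e1]
    rw [volume_restrict_prod] at hi ⊢
    rw [integral_prod _ hi]
    refine setIntegral_eq_integral_of_forall_compl_eq_zero fun σ hσ => ?_
    simp [hs (σ, _) fun h' => hσ h'.1]
  simp only [eL] at hL
  -- The backward difference quotients of `φ` are bounded by its Lipschitz constant, converge
  -- pointwise to `-∂φ/∂t` and vanish off a bounded time interval, so dominated convergence applies
  -- with the strong convergence of `U`.
  have hR : Tendsto (fun k => ∫ σ, ∫ x in Ω, U k ⌊σ / τ k⌋₊ x *
      ((τ k)⁻¹ * (φ (σ - τ k, x) - φ (σ, x)))) atTop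
      (𝓝 (∫ σ, ∫ x in Ω, u σ x * -deriv (fun r => φ (r, x)) σ)) := by
    have hDm : ∀ k, Continuous fun z : ℝ × E d => (τ k)⁻¹ * (φ (z.1 - τ k, z.2) - φ z) := by
      fun_prop
    have hDK : ∀ k σ x, |(τ k)⁻¹ * (φ (σ - τ k, x) - φ (σ, x))| ≤ K := fun k σ x => by
      have h1 := hK.dist_le_mul (σ - τ k, x) (σ, x)
      rw [Prod.dist_eq, dist_self, Real.dist_eq, Real.dist_eq, sub_sub_cancel_left, abs_neg,
        abs_of_pos (hτ k), max_eq_left (hτ k).le] at h1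
      rw [abs_mul, abs_inv, abs_of_pos (hτ k)]
      calc _ ≤ (τ k)⁻¹ * (K * τ k) := mul_le_mul_of_nonneg_left h1 (inv_nonneg.2 (hτ k).le)
        _ = K := by have := (hτ k).ne'; field_simp
    have hD : ∀ σ x, Tendsto (fun k => (τ k)⁻¹ * (φ (σ - τ k, x) - φ (σ, x))) atTop
        (𝓝 (-deriv (fun r => φ (r, x)) σ)) := fun σ x => by
      have hd : DifferentiableAt ℝ (fun r => φ (r, x)) σ :=
        (hφ.differentiable (σ, x)).comp σ (by fun_prop : DifferentiableAt ℝ (fun r => (r, x)) σ)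
      have hτ0 : Tendsto (fun k => -τ k) atTop (𝓝[≠] 0) := by
        refine tendsto_nhdsWithin_iff.2 ⟨by simpa using h.step.neg, Eventually.of_forall fun k => ?_⟩
        simpa using (hτ k).ne'
      refine ((hd.hasDerivAt.tendsto_slope_zero.comp hτ0).neg).congr fun k => ?_
      simp only [Function.comp_apply, smul_eq_mul, ← sub_eq_add_neg]
      rw [inv_neg]
      ring
    have hzero : ∀ᶠ k in atTop, ∀ σ x, σ ∉ Ioc 0 (b + 1) →
        (τ k)⁻¹ * (φ (σ - τ k, x) - φ (σ, x)) = 0 := by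
      filter_upwards [h.step.eventually (gt_mem_nhds one_pos)] with k hk σ x hσ
      have hk0 := hτ k
      rw [hs (σ - τ k, x) fun h' => hσ ⟨by linarith [h'.1], by linarith [h'.2]⟩,
        hs (σ, x) fun h' => hσ ⟨by linarith [h'.1], by linarith [h'.2]⟩]
      simp
    refine tendsto_integral_filter_of_dominated_convergence
      ((Ioc 0 (b + 1)).indicator fun σ => K * (‖u σ‖ + 1)) (Eventually.of_forall fun k => ?_) ?_ ?_
      (Eventually.of_forall fun σ => ?_)
    · exact ((stronglyMeasurable_step (U k) (τ k)).mul
        (hDm k).stronglyMeasurable).integral_prod_right'.aestronglyMeasurable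
    · filter_upwards [hzero, Metric.tendstoUniformlyOn_iff.1
        (h.conv (max (b + 1) 1) (by positivity)) 1 one_pos] with k hk hk'
      refine Eventually.of_forall fun σ => ?_
      by_cases hσ : σ ∈ Ioc 0 (b + 1)
      · rw [indicator_of_mem hσ]
        refine (abs_integral_mul_le _ (hDK k σ)).trans ?_
        have h1 := hk' σ ⟨hσ.1.le, hσ.2.trans (le_max_left _ _)⟩
        rw [dist_comm, dist_eq_norm] at h1
        have h2 := norm_add_le (u σ) (U k ⌊σ / τ k⌋₊ - u σ)
        rw [add_sub_cancel] at h2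
        gcongr
        linarith
      · simp [hk σ _ hσ, indicator_of_notMem hσ]
    · rw [integrable_indicator_iff measurableSet_Ioc]
      have h1 : ContinuousOn (fun σ => (K : ℝ) * (‖u σ‖ + 1)) (Icc 0 (b + 1)) :=
        ((h.cont.mono Icc_subset_Ici_self).norm.add continuousOn_const).const_smul (K : ℝ)
      exact (h1.integrableOn_Icc).mono_set Ioc_subset_Icc_self
    · by_cases hσ : 0 ≤ σ
      · exact tendsto_integral_mul (h.tendsto hσ)
          (fun k => ((hDm k).comp (by fun_prop : Continuous fun x : E d => (σ, x))).measurable)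
          (Eventually.of_forall fun k => hDK k σ) (hD σ)
      -- At negative times nothing is known about `U`, but the difference quotients of `φ` vanish
      -- for large `k`.
      · have h1 : ∀ x, -deriv (fun r => φ (r, x)) σ = 0 := fun x =>
          tendsto_nhds_unique_of_eventuallyEq (hD σ x) tendsto_const_nhds
            (hzero.mono fun k hk => hk σ x fun h' => hσ h'.1.le)
        simp only [h1]
        refine tendsto_const_nhds.congr' (hzero.mono fun k hk => ?_)
        simp [hk σ _ fun h' => hσ h'.1.le]
  have hlim := tendsto_nhds_unique hL (hR.mono_left hv.le_atTop)
  have hzero : ∀ σ x, σ ∉ Ioi (0 : ℝ) → deriv (fun r => φ (r, x)) σ = 0 := fun σ x hσ => by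
    have : (fun r => φ (r, x)) =ᶠ[𝓝 σ] fun _ => 0 := by
      filter_upwards [gt_mem_nhds ((not_lt.1 hσ).trans_lt ha)] with r hr
      exact hs (r, x) fun h' => absurd h'.1 (not_lt.2 (le_of_lt hr))
    rw [this.deriv_eq, deriv_const]
  rw [setIntegral_eq_integral_of_forall_compl_eq_zero fun σ hσ => by simp [hzero σ _ hσ],
    setIntegral_eq_of_subset_of_forall_sdiff_eq_zero (s := Ioi a ×ˢ Ω)
      (measurableSet_Ioi.prod hΩ.measurableSet)
      (Set.prod_mono (Ioi_subset_Ioi ha.le) le_rfl) fun z hz => by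
        rw [hs z fun h' => hz.2 ⟨h'.1, hz.1.2⟩, mul_zero]]
  simp only [mul_neg, integral_neg] at hlim
  rw [← neg_eq_iff_eq_neg, ← hlim]
  refine integral_congr_ae (Eventually.of_forall fun z => ?_)
  simp [mul_comm]

end TimeDerivative

/-! ### The two gradient estimates in the limit. -/

section Bound

/-- Closed balls are weakly closed; written for functions rather than classes, and with a bound
required only eventually. -/
lemma lintegral_le_of_weak_limit {α V : Type*} [MeasurableSpace α] {μ : Measure α}
    [NormedAddCommGroup V] [InnerProductSpace ℝ V] [CompleteSpace V] {𝒰 : Ultrafilter ℕ}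
    {x : ℕ → α → V} {x₀ : α → V} (hx : ∀ k, MemLp (x k) 2 μ) (hx₀ : MemLp x₀ 2 μ)
    (hw : ∀ y, MemLp y 2 μ → Tendsto (fun k => ∫ z, inner ℝ (x k z) (y z) ∂μ) 𝒰
      (𝓝 (∫ z, inner ℝ (x₀ z) (y z) ∂μ))) {C : ℝ≥0∞} (hC : C ≠ ⊤)
    (hb : ∀ᶠ k in 𝒰, ∫⁻ z, ‖x k z‖ₑ ^ 2 ∂μ ≤ C) : ∫⁻ z, ‖x₀ z‖ₑ ^ 2 ∂μ ≤ C := by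
  have key : ∀ (f : α → V) (hf : MemLp f 2 μ) (y : Lp V 2 μ),
      inner ℝ hf.toLp y = ∫ z, inner ℝ (f z) (y z) ∂μ := fun f hf y => by
    rw [L2.inner_def]
    refine integral_congr_ae ?_
    filter_upwards [hf.coeFn_toLp] with z hz
    rw [hz]
  have key2 : ∀ (f : α → V) (hf : MemLp f 2 μ), ‖hf.toLp‖ₑ ^ 2 = ∫⁻ z, ‖f z‖ₑ ^ 2 ∂μ :=
    fun f hf => by
    rw [enorm_sq_eq_lintegral]
    refine lintegral_congr_ae ?_
    filter_upwards [hf.coeFn_toLp] with z hz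
    rw [hz]
  have hmem : hx₀.toLp ∈ Metric.closedBall (0 : Lp V 2 μ) √C.toReal := by
    refine mem_of_weak_limit (x := fun k => (hx k).toLp) (fun y => ?_) Metric.isClosed_closedBall
      (convex_closedBall _ _) (hb.mono fun k hk => ?_)
    · rw [key]
      simp only [key]
      exact hw y (Lp.memLp y)
    · obtain ⟨h', hh⟩ := memLp_two_of_lintegral_le (hx k).1 hC hk
      simpa using hh
  rw [mem_closedBall_zero_iff] at hmem
  rw [← key2 _ hx₀, ← ofReal_norm, ← ENNReal.ofReal_pow (norm_nonneg _), ← ENNReal.ofReal_toReal hC]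
  refine ENNReal.ofReal_le_ofReal ?_
  calc _ ≤ √C.toReal ^ 2 := by gcongr
    _ = _ := Real.sq_sqrt ENNReal.toReal_nonneg

variable {d : ℕ} {Ω : Set (E d)} {Φ : L1 Ω → ℝ≥0∞} {γ : ℝ} {u₀ : L1 Ω} {u : ℝ → L1 Ω} {τ : ℕ → ℝ}
  {U : ℕ → ℕ → L1 Ω} {l : ℕ → ℕ → StrongDual ℝ (L1 Ω)} {m : ℕ → ℕ → ℝ} {𝒰 : Ultrafilter ℕ}

lemma IsApproximation.lintegral_gradient_le (h : IsApproximation Φ u₀ u τ U l m)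
    (hΦ : IsStrongEnergy γ Φ) (hγ : 0 < γ) {Dv : ℝ × E d → E d} {t : ℝ}
    (ht : 0 < t) (hDv : MemLp Dv 2 (volume.restrict (Ioi t ×ˢ Ω)))
    (hw : ∀ y : ℝ × E d → E d, MemLp y 2 (volume.restrict (Ioi t ×ˢ Ω)) →
      Tendsto (fun k => ∫ z in Ioi t ×ˢ Ω, inner ℝ (gradVel (τ k) (U k) ⌊z.1 / τ k⌋₊ z.2) (y z)) 𝒰
        (𝓝 (∫ z in Ioi t ×ˢ Ω, inner ℝ (Dv z) (y z)))) {C : ℝ≥0∞} (hC : C ≠ ⊤)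
    (hb : ∀ᶠ k in 𝒰, ENNReal.ofReal γ * ∫⁻ s in Ioi t, ‖gradVel (τ k) (U k) ⌊s / τ k⌋₊‖ₑ ^ 2 ≤ C) :
    ENNReal.ofReal γ * (∫⁻ s in Ioi t, ∫⁻ x in Ω, ‖Dv (s, x)‖ₑ ^ 2) ≤ C := by
  have hγ' : ENNReal.ofReal γ ≠ 0 := by simpa using hγ
  rw [mul_comm, ← ENNReal.le_div_iff_mul_le (Or.inl hγ') (Or.inl (by simp))]
  have h1 := lintegral_le_of_weak_limit (fun k => (h.data k).memLp_gradVel hΦ hγ ht) hDv hw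
    (C := C / ENNReal.ofReal γ) (ENNReal.div_ne_top hC hγ') (hb.mono fun k hk => ?_)
  · rw [volume_restrict_prod, lintegral_prod] at h1
    · exact h1
    · have := hDv.1
      rw [volume_restrict_prod] at this
      exact this.enorm.pow_const 2
  · rw [volume_restrict_prod, lintegral_prod]
    · simp only [← enorm_sq_eq_lintegral]
      rwa [ENNReal.le_div_iff_mul_le (Or.inl hγ') (Or.inl (by simp)), mul_comm]
    · exact ((stronglyMeasurable_step (gradVel (τ k) (U k)) (τ k)).enorm.pow_const 2).aemeasurable

lemma IsApproximation.lintegral_gradient_le_div (h : IsApproximation Φ u₀ u τ U l m)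
    (h𝒰 : (𝒰 : Filter ℕ) ≤ atTop)
    (hΦ : IsStrongEnergy γ Φ) (hγ : 0 < γ) {Dv : ℝ × E d → E d} {t : ℝ}
    (ht : 0 < t) (hDv : MemLp Dv 2 (volume.restrict (Ioi t ×ˢ Ω)))
    (hw : ∀ y : ℝ × E d → E d, MemLp y 2 (volume.restrict (Ioi t ×ˢ Ω)) →
      Tendsto (fun k => ∫ z in Ioi t ×ˢ Ω, inner ℝ (gradVel (τ k) (U k) ⌊z.1 / τ k⌋₊ z.2) (y z)) 𝒰
        (𝓝 (∫ z in Ioi t ×ˢ Ω, inner ℝ (Dv z) (y z)))) :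
    ENNReal.ofReal γ * (∫⁻ s in Ioi t, ∫⁻ x in Ω, ‖Dv (s, x)‖ₑ ^ 2) ≤ Φ u₀ / ENNReal.ofReal t := by
  have hu₀ : Φ u₀ ≠ ⊤ := by rw [← h.init 0]; exact ((h.data 0).fin 0).ne
  refine h.lintegral_gradient_le hΦ hγ ht hDv hw (ENNReal.div_ne_top hu₀ (by simpa using ht))
    (h𝒰 ?_)
  filter_upwards [h.step.eventually (gt_mem_nhds ht)] with k hk
  have := (h.data k).lintegral_grad_tail_le hΦ hγ.le hk.le
  rwa [ENNReal.ofReal_div_of_pos ht, h.init, ENNReal.ofReal_toReal hu₀] at this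

lemma isSubgrad_of_mem_subdifferential {q : LInf Ω} (hq : q ∈ subdifferential Φ u₀) :
    IsSubgrad Φ u₀ (pairing q) := by
  refine ⟨hq.1.lt_top, fun w hw => ?_⟩
  have h1 := hq.2 w
  have e : ∫ x in Ω, q x * (w x - u₀ x) = pairing q (w - u₀) := by
    rw [pairing_apply]
    refine integral_congr_ae ?_
    filter_upwards [Lp.coeFn_sub w u₀] with x hx
    rw [hx, Pi.sub_apply]
  rw [e, ← ENNReal.ofReal_toReal hq.1, ← ENNReal.ofReal_toReal hw.ne,
    EReal.coe_ennreal_ofReal, EReal.coe_ennreal_ofReal, max_eq_left ENNReal.toReal_nonneg,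
    max_eq_left ENNReal.toReal_nonneg] at h1
  exact_mod_cast h1

lemma IsApproximation.lintegral_gradient_le_minSubgradientNorm
    (h : IsApproximation Φ u₀ u τ U l m)
    (hΦ : IsStrongEnergy γ Φ) (hγ : 0 < γ) {Dv : ℝ × E d → E d}
    (hDv : ∀ t : ℝ, 0 < t → MemLp Dv 2 (volume.restrict (Ioi t ×ˢ Ω)))
    (hw : ∀ t : ℝ, 0 < t → ∀ y : ℝ × E d → E d, MemLp y 2 (volume.restrict (Ioi t ×ˢ Ω)) →
      Tendsto (fun k => ∫ z in Ioi t ×ˢ Ω, inner ℝ (gradVel (τ k) (U k) ⌊z.1 / τ k⌋₊ z.2) (y z)) 𝒰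
        (𝓝 (∫ z in Ioi t ×ˢ Ω, inner ℝ (Dv z) (y z))))
    (hne : (subdifferential Φ u₀).Nonempty) :
    ENNReal.ofReal γ * (∫⁻ s in Ioi (0 : ℝ), ∫⁻ x in Ω, ‖Dv (s, x)‖ₑ ^ 2) ≤
      1 / 2 * minSubgradientNorm Φ u₀ ^ 2 := by
  have key : ∀ q ∈ subdifferential Φ u₀,
      ENNReal.ofReal γ * (∫⁻ s in Ioi (0 : ℝ), ∫⁻ x in Ω, ‖Dv (s, x)‖ₑ ^ 2) ≤ 1 / 2 * ‖q‖ₑ ^ 2 := by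
    intro q hq
    have h1 : ∀ t : ℝ, 0 < t →
        ENNReal.ofReal γ * (∫⁻ s in Ioi t, ∫⁻ x in Ω, ‖Dv (s, x)‖ₑ ^ 2) ≤ 1 / 2 * ‖q‖ₑ ^ 2 := by
      intro t ht
      refine h.lintegral_gradient_le hΦ hγ ht (hDv t ht) (hw t ht)
        (ENNReal.mul_ne_top (by simp) (by simp)) (Eventually.of_forall fun k => ?_)
      have hk : IsSubgrad Φ (U k 0) (pairing q) := by
        rw [h.init]; exact isSubgrad_of_mem_subdifferential hq
      have h2 := (h.data k).lintegral_grad_le hγ.le (N := 0)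
        (fun N => (h.data k).tail_sum_le_norm hΦ hk N)
      refine (mul_le_mul_right (lintegral_mono_set ?_) _).trans (h2.trans ?_)
      · intro s hs
        simpa using (ht.trans hs).le
      · rw [← ofReal_norm, ← ENNReal.ofReal_pow (norm_nonneg _),
          show (1 / 2 : ℝ≥0∞) = ENNReal.ofReal (1 / 2) by
            rw [ENNReal.ofReal_div_of_pos (by norm_num)]; simp,
          ← ENNReal.ofReal_mul (by norm_num)]
        have := norm_pairing_le q
        exact ENNReal.ofReal_le_ofReal (by gcongr)
    -- The bound does not depend on `t`, so the integral from `0` is reached by monotone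
    -- convergence; weak convergence itself is available only away from `0`.
    have hU : Ioi (0 : ℝ) = ⋃ n : ℕ, Ioi (1 / ((n : ℝ) + 1)) := by
      ext s
      simp only [mem_Ioi, mem_iUnion]
      exact ⟨fun hs => exists_nat_one_div_lt hs, fun ⟨n, hn⟩ => lt_trans (by positivity) hn⟩
    rw [hU, setLIntegral_iUnion_of_directed _ (Monotone.directed_le fun i j hij =>
      Ioi_subset_Ioi (Nat.one_div_le_one_div hij)), ENNReal.mul_iSup]
    exact iSup_le fun n => h1 _ (by positivity)
  obtain ⟨q₀, hq₀⟩ := hne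
  generalize ENNReal.ofReal γ * (∫⁻ s in Ioi (0 : ℝ), ∫⁻ x in Ω, ‖Dv (s, x)‖ₑ ^ 2) = X at key ⊢
  -- `minSubgradientNorm` is an infimum of norms, not of their squares, so the square root is taken
  -- before passing to the infimum.
  have h2 : (2 * X) ^ (1 / 2 : ℝ) ≤ minSubgradientNorm Φ u₀ := by
    refine le_iInf₂ fun q hq => ?_
    rw [one_div, ENNReal.rpow_inv_le_iff (by norm_num)]
    calc 2 * X ≤ 2 * (1 / 2 * ‖q‖ₑ ^ 2) := by gcongr; exact key q hq
      _ = ‖q‖ₑ ^ (2 : ℝ) := by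
        rw [← mul_assoc, one_div, ENNReal.mul_inv_cancel (by norm_num) (by norm_num), one_mul]
        norm_cast
  rw [one_div, ENNReal.rpow_inv_le_iff (by norm_num)] at h2
  calc X = 1 / 2 * (2 * X) := by
        rw [← mul_assoc, one_div, ENNReal.inv_mul_cancel (by norm_num) (by norm_num), one_mul]
    _ ≤ 1 / 2 * minSubgradientNorm Φ u₀ ^ (2 : ℝ) := by gcongr
    _ = _ := by norm_cast

end Bound

/-! ### Speed, subgradients and energy of the limit curve at each time. -/

section Pointwise

variable {d : ℕ} {Ω : Set (E d)} {Φ : L1 Ω → ℝ≥0∞} {γ : ℝ} {u₀ : L1 Ω} {u : ℝ → L1 Ω} {τ : ℕ → ℝ}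
  {U : ℕ → ℕ → L1 Ω} {l : ℕ → ℕ → StrongDual ℝ (L1 Ω)} {m : ℕ → ℕ → ℝ} {𝒰 : Ultrafilter ℕ}

/-- A property that holds along an ultrafilter finer than `atTop` holds for infinitely many indices,
hence along a subsequence, to which the sequential closedness applies. -/
lemma IsStrongEnergy.le_of_eventually (hΦ : IsStrongEnergy γ Φ) (h𝒰 : (𝒰 : Filter ℕ) ≤ atTop)
    {un : ℕ → L1 Ω} {w : L1 Ω} {c : ℝ≥0∞} (hc : c < ⊤) (hu : Tendsto un atTop (𝓝 w))
    (h : ∀ᶠ k in 𝒰, Φ (un k) ≤ c) : Φ w ≤ c := by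
  obtain ⟨φ, hφ, hφ'⟩ := Filter.extraction_of_frequently_atTop (h.frequently.filter_mono h𝒰)
  exact hΦ.closed _ w c hc (hu.comp hφ.tendsto_atTop) hφ'

namespace IsApproximation

lemma energy_lt_top (h : IsApproximation Φ u₀ u τ U l m) : Φ u₀ < ⊤ := by
  rw [← h.init 0]; exact (h.data 0).fin 0

lemma m_le_sqrt (h : IsApproximation Φ u₀ u τ U l m) (hΦ : IsStrongEnergy γ Φ) (hγ : 0 < γ) {s : ℝ}
    (hs : 0 < s) (k : ℕ) : m k ⌊s / τ k⌋₊ ≤ √((Φ u₀).toReal / s) := by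
  have h1 := (h.data k).mul_m_sq_le hΦ hγ.le s
  rw [h.init] at h1
  exact Real.le_sqrt_of_sq_le ((le_div_iff₀ hs).2 (by linarith))

/-- The limit speed along an ultrafilter. -/
lemma exists_speed (h : IsApproximation Φ u₀ u τ U l m) (hΦ : IsStrongEnergy γ Φ) (hγ : 0 < γ)
    (𝒰 : Ultrafilter ℕ) :
    ∃ M : ℝ → ℝ, ∀ s, 0 < s → Tendsto (fun k => m k ⌊s / τ k⌋₊) 𝒰 (𝓝 (M s)) := by
  have : ∀ s : ℝ, ∃ x, 0 < s → Tendsto (fun k => m k ⌊s / τ k⌋₊) 𝒰 (𝓝 x) := fun s => by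
    by_cases hs : 0 < s
    · obtain ⟨x, hx⟩ := exists_ultrafilter_tendsto 𝒰 (a := fun k => m k ⌊s / τ k⌋₊) fun k => by
        rw [abs_of_nonneg ((h.data k).m_nonneg _)]
        exact h.m_le_sqrt hΦ hγ hs k
      exact ⟨x, fun _ => hx⟩
    · exact ⟨0, fun h' => absurd h' hs⟩
  choose M hM using this
  exact ⟨M, hM⟩

variable {M : ℝ → ℝ}

lemma speed_nonneg (h : IsApproximation Φ u₀ u τ U l m)
    (hM : ∀ s, 0 < s → Tendsto (fun k => m k ⌊s / τ k⌋₊) 𝒰 (𝓝 (M s))) {s : ℝ} (hs : 0 < s) :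
    0 ≤ M s := ge_of_tendsto' (hM s hs) fun k => (h.data k).m_nonneg _

lemma speed_antitoneOn (h : IsApproximation Φ u₀ u τ U l m) (hΦ : IsStrongEnergy γ Φ) (hγ : 0 < γ)
    (hM : ∀ s, 0 < s → Tendsto (fun k => m k ⌊s / τ k⌋₊) 𝒰 (𝓝 (M s))) :
    AntitoneOn M (Ioi 0) := fun s hs s' hs' hss =>
  le_of_tendsto_of_tendsto' (hM s' hs') (hM s hs) fun k =>
    (h.data k).antitone hΦ hγ.le (floor_div_mono (h.data k).pos hss)

lemma norm_sub_le (h : IsApproximation Φ u₀ u τ U l m) (hΦ : IsStrongEnergy γ Φ) (hγ : 0 < γ)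
    (h𝒰 : (𝒰 : Filter ℕ) ≤ atTop)
    (hM : ∀ s, 0 < s → Tendsto (fun k => m k ⌊s / τ k⌋₊) 𝒰 (𝓝 (M s))) {s s' : ℝ} (hs : 0 < s)
    (hs' : s ≤ s') : ‖u s' - u s‖ ≤ (s' - s) * M s := by
  have h1 := (((h.tendsto (hs.le.trans hs')).sub (h.tendsto hs.le)).norm).mono_left h𝒰
  have h2 := ((h.step.const_add (s' - s)).mono_left h𝒰).mul (hM s hs)
  rw [add_zero] at h2
  exact le_of_tendsto_of_tendsto' h1 h2 fun k =>
    (h.data k).norm_floor_sub_le hΦ hγ.le hs.le hs'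

lemma tendsto_apply_succ_sub (h : IsApproximation Φ u₀ u τ U l m) (hΦ : IsStrongEnergy γ Φ)
    (hγ : 0 < γ) {s : ℝ} (hs : 0 < s) :
    Tendsto (fun k => l k ⌊s / τ k⌋₊ (U k (⌊s / τ k⌋₊ + 1) - u s)) atTop (𝓝 0) := by
  refine squeeze_zero_norm (a := fun k => √((Φ u₀).toReal / s) * ‖U k (⌊s / τ k⌋₊ + 1) - u s‖)
    (fun k => ?_) ?_
  · exact (l k _).le_of_opNorm_le (((h.data k).bound _).trans (h.m_le_sqrt hΦ hγ hs k)) _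
  · simpa using (tendsto_iff_norm_sub_tendsto_zero.1 (h.tendsto_succ hs.le)).const_mul
      √((Φ u₀).toReal / s)

lemma energy_limit_le (h : IsApproximation Φ u₀ u τ U l m) (hΦ : IsStrongEnergy γ Φ) (hγ : 0 < γ)
    {s : ℝ} (hs : 0 ≤ s) : Φ (u s) ≤ Φ u₀ :=
  hΦ.closed _ _ _ h.energy_lt_top (h.tendsto hs) fun k => by
    rw [← h.init k]; exact (h.data k).energy_le hΦ hγ.le _

/-- The subdifferential of the energy along the limit curve contains the limits of the discrete
subgradients. -/
lemma exists_isSubgrad (h : IsApproximation Φ u₀ u τ U l m) (hΦ : IsStrongEnergy γ Φ) (hγ : 0 < γ)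
    (h𝒰 : (𝒰 : Filter ℕ) ≤ atTop)
    (hM : ∀ s, 0 < s → Tendsto (fun k => m k ⌊s / τ k⌋₊) 𝒰 (𝓝 (M s))) {s : ℝ} (hs : 0 < s) :
    ∃ L, IsSubgrad Φ (u s) L ∧ ‖L‖ ≤ M s := by
  obtain ⟨L, hL⟩ := exists_weakStar_limit 𝒰 (l := fun k => l k ⌊s / τ k⌋₊)
    fun k => ((h.data k).bound _).trans (h.m_le_sqrt hΦ hγ hs k)
  refine ⟨L, ⟨(h.energy_limit_le hΦ hγ hs.le).trans_lt h.energy_lt_top, fun w hw => ?_⟩,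
    L.opNorm_le_bound (h.speed_nonneg hM hs) fun y =>
      le_of_tendsto_of_tendsto' (hL y).norm ((hM s hs).mul_const _) fun k =>
        (l k _).le_of_opNorm_le ((h.data k).bound _) y⟩
  refine le_of_forall_pos_le_add fun ε hε => ?_
  have h1 := (hL (w - u s)).sub ((h.tendsto_apply_succ_sub hΦ hγ hs).mono_left h𝒰)
  rw [sub_zero] at h1
  -- The energies are only lower semicontinuous, so the discrete inequality is rewritten as an upper
  -- bound on them, up to `ε`, and passed to the limit by closedness of sublevel sets.
  have h2 : ∀ᶠ k in (𝒰 : Filter ℕ), (Φ (U k (⌊s / τ k⌋₊ + 1))).toReal ≤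
      (Φ w).toReal - L (w - u s) + ε := by
    filter_upwards [h1.eventually (lt_mem_nhds (sub_lt_self (L (w - u s)) hε))] with k hk
    have h3 := ((h.data k).sub ⌊s / τ k⌋₊).2 w hw
    rw [← map_sub, sub_sub_sub_cancel_right] at hk
    linarith
  obtain ⟨k, hk⟩ := h2.exists
  have h4 := hΦ.le_of_eventually h𝒰 ENNReal.ofReal_lt_top (h.tendsto_succ hs.le)
    (h2.mono fun k hk => (ENNReal.ofReal_toReal ((h.data k).fin _).ne).symm.trans_le
      (ENNReal.ofReal_le_ofReal hk))
  have h5 := ENNReal.toReal_le_of_le_ofReal (ENNReal.toReal_nonneg.trans hk) h4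
  linarith

lemma energy_sub_le (h : IsApproximation Φ u₀ u τ U l m) (hΦ : IsStrongEnergy γ Φ) (hγ : 0 < γ)
    (h𝒰 : (𝒰 : Filter ℕ) ≤ atTop)
    (hM : ∀ s, 0 < s → Tendsto (fun k => m k ⌊s / τ k⌋₊) 𝒰 (𝓝 (M s))) {s : ℝ} (hs : 0 < s)
    {w : L1 Ω} (hw : Φ w < ⊤) : (Φ (u s)).toReal - M s * ‖w - u s‖ ≤ (Φ w).toReal := by
  obtain ⟨L, hL, hL'⟩ := h.exists_isSubgrad hΦ hγ h𝒰 hM hs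
  have h1 := hL.2 w hw
  have h2 := neg_le_of_abs_le (L.le_of_opNorm_le hL' (w - u s))
  linarith

/-- Two-sided estimate: the subgradient at `u s` bounds the discrete energies from below and the
discrete subgradients bound them from above, with errors of the order of the `L¹` distance to `u s`.
-/
lemma tendsto_energy (h : IsApproximation Φ u₀ u τ U l m) (hΦ : IsStrongEnergy γ Φ) (hγ : 0 < γ)
    (h𝒰 : (𝒰 : Filter ℕ) ≤ atTop)
    (hM : ∀ s, 0 < s → Tendsto (fun k => m k ⌊s / τ k⌋₊) 𝒰 (𝓝 (M s))) {s : ℝ} (hs : 0 < s) :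
    Tendsto (fun k => (Φ (U k (⌊s / τ k⌋₊ + 1))).toReal) 𝒰 (𝓝 (Φ (u s)).toReal) := by
  have h1 : Tendsto (fun k => (Φ (u s)).toReal - M s * ‖U k (⌊s / τ k⌋₊ + 1) - u s‖) 𝒰
      (𝓝 (Φ (u s)).toReal) := by
    simpa using (((tendsto_iff_norm_sub_tendsto_zero.1 (h.tendsto_succ hs.le)).const_mul
      (M s)).const_sub (Φ (u s)).toReal).mono_left h𝒰
  have h2 : Tendsto (fun k => (Φ (u s)).toReal + l k ⌊s / τ k⌋₊ (U k (⌊s / τ k⌋₊ + 1) - u s)) 𝒰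
      (𝓝 (Φ (u s)).toReal) := by
    simpa using ((h.tendsto_apply_succ_sub hΦ hγ hs).const_add (Φ (u s)).toReal).mono_left h𝒰
  refine tendsto_of_tendsto_of_tendsto_of_le_of_le h1 h2
    (fun k => h.energy_sub_le hΦ hγ h𝒰 hM hs ((h.data k).fin _)) fun k => ?_
  have h3 := ((h.data k).sub ⌊s / τ k⌋₊).2 (u s)
    ((h.energy_limit_le hΦ hγ hs.le).trans_lt h.energy_lt_top)
  rw [← neg_sub, map_neg] at h3
  simp only
  linarith

/-- Limit of the discrete energy estimate. Convergence of the energies, rather than lower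
semicontinuity, is essential for the right-hand side. -/
lemma dissipation (h : IsApproximation Φ u₀ u τ U l m) (hΦ : IsStrongEnergy γ Φ) (hγ : 0 < γ)
    (h𝒰 : (𝒰 : Filter ℕ) ≤ atTop)
    (hM : ∀ s, 0 < s → Tendsto (fun k => m k ⌊s / τ k⌋₊) 𝒰 (𝓝 (M s))) {s s' : ℝ} (hs : 0 < s)
    (hs' : s < s') : (Φ (u s')).toReal + (s' - s) * M s' ^ 2 ≤ (Φ (u s)).toReal := by
  have hs0 := hs.trans hs'
  have h1 : Tendsto (fun k => s' - s - 2 * τ k) 𝒰 (𝓝 (s' - s)) := by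
    simpa using ((h.step.const_mul 2).const_sub (s' - s)).mono_left h𝒰
  refine le_of_tendsto_of_tendsto ((h.tendsto_energy hΦ hγ h𝒰 hM hs0).add
    (h1.mul ((hM s' hs0).pow 2))) (h.tendsto_energy hΦ hγ h𝒰 hM hs) ?_
  filter_upwards [h𝒰 (h.step.eventually (gt_mem_nhds (sub_pos.2 hs')))] with k hk
  have hτ := (h.data k).pos
  -- Starting at `s + τ k` produces the energy one step after `s`, the one whose limit is known; the
  -- shift and the rounding together cost `2 τ k`.
  have h2 := (h.data k).energy_floor_le hΦ hγ.le (s := s + τ k) (s' := s') (by linarith)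
    (by linarith)
  rw [floor_add_div hτ hs.le] at h2
  have h3 := (h.data k).energy_antitone hΦ hγ.le (Nat.le_succ ⌊s' / τ k⌋₊)
  simp only at h3
  rw [show s' - (s + τ k) - τ k = s' - s - 2 * τ k by ring] at h2
  simp only [Nat.succ_eq_add_one] at h3
  linarith

end IsApproximation

end Pointwise

/-! ### Bounded functions as closed convex sets. -/

section Box

variable {α : Type*} [MeasurableSpace α] {μ : Measure α}

lemma isClosed_ae_abs_le (c : ℝ) : IsClosed {f : Lp ℝ 2 μ | ∀ᵐ x ∂μ, |f x| ≤ c} := by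
  refine isClosed_of_closure_subset fun f hf => ?_
  obtain ⟨q, hq, hlim⟩ := mem_closure_iff_seq_limit.1 hf
  obtain ⟨φ, -, hφ⟩ := (tendstoInMeasure_of_tendsto_Lp hlim).exists_seq_tendsto_ae
  have hall := ae_all_iff.2 fun j => hq (φ j)
  change ∀ᵐ x ∂μ, _
  filter_upwards [hφ, hall] with x hx hx'
  exact le_of_tendsto' hx.abs hx'

lemma convex_ae_abs_le (c : ℝ) : Convex ℝ {f : Lp ℝ 2 μ | ∀ᵐ x ∂μ, |f x| ≤ c} := by
  intro f hf g hg a b ha hb hab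
  change ∀ᵐ x ∂μ, _
  filter_upwards [hf, hg, Lp.coeFn_add (a • f) (b • g), Lp.coeFn_smul a f, Lp.coeFn_smul b g] with
    x h1 h2 h3 h4 h5
  rw [h3, Pi.add_apply, h4, h5, Pi.smul_apply, Pi.smul_apply]
  exact abs_le.2 ((convex_Icc (-c) c) (abs_le.1 h1) (abs_le.1 h2) ha hb hab)

lemma memLp_two_of_lInf [IsFiniteMeasure μ] (q : Lp ℝ ⊤ μ) : MemLp q 2 μ :=
  (Lp.memLp q).mono_exponent le_top

lemma exists_lInf_of_ae_le {f : α → ℝ} (hf : AEStronglyMeasurable f μ) {c : ℝ}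
    (h : ∀ᵐ x ∂μ, |f x| ≤ c) : ∃ q : Lp ℝ ⊤ μ, q =ᵐ[μ] f :=
  ⟨(memLp_top_of_bound hf c h).toLp, MemLp.coeFn_toLp _⟩

end Box

/-! ### A measurable field of subgradients. -/

section Field

variable {d : ℕ} {Ω : Set (E d)} {Φ : L1 Ω → ℝ≥0∞} {γ : ℝ} {u₀ : L1 Ω} {u : ℝ → L1 Ω} {τ : ℕ → ℝ}
  {U : ℕ → ℕ → L1 Ω} {l : ℕ → ℕ → StrongDual ℝ (L1 Ω)} {m : ℕ → ℕ → ℝ} {𝒰 : Ultrafilter ℕ}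
  {M : ℝ → ℝ}

lemma IsStrongEnergy.memLp_two (hΦ : IsStrongEnergy γ Φ) (hΩ : IsOpen Ω) (hb : Bornology.IsBounded Ω)
    (hlip : HasLipschitzBoundary Ω) {w : L1 Ω} (hw : Φ w < ⊤) : MemLp w 2 (volume.restrict Ω) := by
  obtain ⟨C, hC, hemb⟩ := exists_embedding_constant hΩ hb hlip
  exact (memLp_two_of_lintegral_le (Lp.aestronglyMeasurable w)
    (ENNReal.mul_ne_top hC (by simp)) (hemb w _ (hΦ.hasGrad w hw))).1

namespace IsApproximation

lemma eventually_norm_succ_sub_le (h : IsApproximation Φ u₀ u τ U l m) (hΦ : IsStrongEnergy γ Φ)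
    (hγ : 0 < γ) (h𝒰 : (𝒰 : Filter ℕ) ≤ atTop)
    (hM : ∀ s, 0 < s → Tendsto (fun k => m k ⌊s / τ k⌋₊) 𝒰 (𝓝 (M s))) {r : ℝ} (hr : 0 < r) (T : ℝ)
    {ε : ℝ} (hε : 0 < ε) : ∀ᶠ k in (𝒰 : Filter ℕ), ∀ s ∈ Ioo r T,
      ‖U k (⌊s / τ k⌋₊ + 1) - u s‖ ≤ ε := by
  have h1 : Tendsto (fun k => τ k * m k ⌊r / τ k⌋₊) 𝒰 (𝓝 0) := by
    simpa using (h.step.mono_left h𝒰).mul (hM r hr)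
  filter_upwards [h1.eventually (gt_mem_nhds (half_pos hε)), h𝒰 (Metric.tendstoUniformlyOn_iff.1
    (h.conv (max T 1) (by positivity)) (ε / 2) (half_pos hε))] with k hk hk' s hs
  have h2 := hk' s ⟨(hr.trans hs.1).le, hs.2.le.trans (le_max_left _ _)⟩
  rw [dist_comm, dist_eq_norm] at h2
  have h3 := (h.data k).speed ⌊s / τ k⌋₊
  have h4 := mul_le_mul_of_nonneg_left ((h.data k).antitone hΦ hγ.le
    (floor_div_mono (h.data k).pos hs.1.le)) (h.data k).pos.le
  calc _ = ‖(U k (⌊s / τ k⌋₊ + 1) - U k ⌊s / τ k⌋₊) + (U k ⌊s / τ k⌋₊ - u s)‖ := by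
        rw [sub_add_sub_cancel]
    _ ≤ _ := norm_add_le _ _
    _ ≤ ε := by linarith

/-- A measurable selection of subgradients along the limit curve, bounded by the limit speed. -/
lemma exists_subgradient_field [IsFiniteMeasure (volume.restrict Ω)]
    (h : IsApproximation Φ u₀ u τ U l m) (hΩ : IsOpen Ω)
    (hb : Bornology.IsBounded Ω) (hlip : HasLipschitzBoundary Ω) (hΦ : IsStrongEnergy γ Φ)
    (hγ : 0 < γ) (h𝒰 : (𝒰 : Filter ℕ) ≤ atTop)
    (hM : ∀ s, 0 < s → Tendsto (fun k => m k ⌊s / τ k⌋₊) 𝒰 (𝓝 (M s))) :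
    ∃ Q : ℝ × E d → ℝ, StronglyMeasurable Q ∧ ∀ᵐ s ∂(volume.restrict (Ioi (0 : ℝ))),
      (∀ᵐ x ∂(volume.restrict Ω), |Q (s, x)| ≤ M s) ∧
      ∃ q : LInf Ω, q =ᵐ[volume.restrict Ω] (fun x => Q (s, x)) ∧ IsSubgrad Φ (u s) (pairing q) := by
  choose q hq hq' using fun k n => exists_pairing_eq (l k n)
  have hqm : ∀ k n, ‖q k n‖ ≤ m k n := fun k n => (hq' k n).trans ((h.data k).bound n)
  have hfin : ∀ s, 0 ≤ s → Φ (u s) < ⊤ := fun s hs =>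
    (h.energy_limit_le hΦ hγ hs).trans_lt h.energy_lt_top
  have hC : Φ u₀ * volume.restrict Ω univ ≠ ⊤ :=
    ENNReal.mul_ne_top h.energy_lt_top.ne (measure_ne_top _ _)
  choose hQ hQb using fun k => memLp_two_of_lintegral_le (μ := stMeasure Ω)
    (f := fun z : ℝ × E d => q k ⌊z.1 / τ k⌋₊ z.2)
    (stronglyMeasurable_step (q k) (τ k)).aestronglyMeasurable hC (by
      rw [lintegral_prod _ ((stronglyMeasurable_step (q k) (τ k)).enorm.pow_const 2).aemeasurable]
      calc _ ≤ ∫⁻ s in Ioi (0 : ℝ), ENNReal.ofReal (m k ⌊s / τ k⌋₊ ^ 2) * volume.restrict Ω univ := by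
            refine lintegral_mono fun s => ?_
            rw [← lintegral_const]
            refine lintegral_mono_ae ?_
            filter_upwards [ae_norm_le_norm_top (q k ⌊s / τ k⌋₊)] with x hx
            rw [ENNReal.ofReal_pow ((h.data k).m_nonneg _), ← ofReal_norm]
            gcongr
            exact hx.trans (hqm _ _)
        _ = (∫⁻ s in Ioi (0 : ℝ), ENNReal.ofReal (m k ⌊s / τ k⌋₊ ^ 2)) * volume.restrict Ω univ :=
            lintegral_mul_const' _ _ (measure_ne_top _ _)
        _ ≤ _ := by
            gcongr
            rw [← h.init k]
            exact (h.data k).lintegral_m_sq_le hΦ hγ.le)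
  obtain ⟨Q, hQw⟩ := exists_weak_limit 𝒰 hQb
  -- the pairing with differences of functions of finite energy is continuous
  have hy : ∀ s (w : L1 Ω), ∃ y : Lp ℝ 2 (volume.restrict Ω), 0 < s → Φ w < ⊤ →
      ∀ f : Lp ℝ 2 (volume.restrict Ω), ∫ x in Ω, f x * (w - u s) x = inner ℝ f y := fun s w => by
    by_cases hsw : 0 < s ∧ Φ w < ⊤
    · have h1 : MemLp (w - u s : L1 Ω) 2 (volume.restrict Ω) :=
        ((hΦ.memLp_two hΩ hb hlip hsw.2).sub (hΦ.memLp_two hΩ hb hlip (hfin s hsw.1.le))).ae_eq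
          (Lp.coeFn_sub _ _).symm
      refine ⟨h1.toLp, fun _ _ f => ?_⟩
      rw [L2.inner_def]
      refine integral_congr_ae ?_
      filter_upwards [h1.coeFn_toLp] with x hx
      rw [hx]
      simp [mul_comm]
    · exact ⟨0, fun h1 h2 => absurd ⟨h1, h2⟩ hsw⟩
  choose y hy using hy
  -- On a time slab, both the bound and the subgradient inequalities, relaxed by `ε`, are closed
  -- convex conditions on the slice `Q(s)`. The discrete subgradients satisfy them at almost every
  -- time of the slab for most `k`, and so does the weak limit.
  have key : ∀ (r T ε : ℝ), 0 < r → 0 < ε → ∀ᵐ s ∂(volume.restrict (Ioi (0 : ℝ))), s ∈ Ioo r T →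
      (∀ᵐ x ∂(volume.restrict Ω), |Q (s, x)| ≤ M r + ε) ∧
      ∀ w, Φ w < ⊤ → (Φ (u s)).toReal + ∫ x in Ω, Q (s, x) * (w - u s) x ≤ (Φ w).toReal + ε := by
    intro r T ε hr hε
    classical
    have hslice := ae_slice_mem_of_weak_limit hQw (K := fun s => if s ∈ Ioo r T then
      {f : Lp ℝ 2 (volume.restrict Ω) | ∀ᵐ x ∂(volume.restrict Ω), |f x| ≤ M r + ε} ∩
      ⋂ (w : L1 Ω) (_ : Φ w < ⊤), {f | inner ℝ f (y s w) ≤ (Φ w).toReal + ε - (Φ (u s)).toReal}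
      else univ) (fun s => ?_) (fun s => ?_) ?_
    · filter_upwards [hslice] with s ⟨f, hf, hf'⟩ hs
      rw [if_pos hs] at hf
      refine ⟨?_, fun w hw => ?_⟩
      · filter_upwards [hf.1, hf'] with x h1 h2
        rwa [← h2]
      · have h1 := mem_iInter₂.1 hf.2 w hw
        rw [Set.mem_ofPred_eq, ← hy s w (hr.trans hs.1) hw] at h1
        have h2 : ∫ x in Ω, Q (s, x) * (w - u s) x = ∫ x in Ω, f x * (w - u s) x := by
          refine integral_congr_ae ?_
          filter_upwards [hf'] with x hx
          rw [hx]
        linarith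
    · split_ifs
      · refine (isClosed_ae_abs_le _).inter (isClosed_iInter fun w => isClosed_iInter fun _ => ?_)
        exact isClosed_le (by fun_prop) continuous_const
      · exact isClosed_univ
    · split_ifs
      · refine (convex_ae_abs_le _).inter (convex_iInter fun w => convex_iInter fun _ => ?_)
        exact convex_halfSpace_le ⟨fun _ _ => inner_add_left _ _ _,
          fun _ _ => real_inner_smul_left _ _ _⟩ _
      · exact convex_univ
    · have hMr := h.speed_nonneg hM hr
      -- Replacing the base point `U k (⌊s / τ k⌋₊ + 1)` by `u s` costs its distance to `u s` times
      -- `(M r + ε) + M s ≤ 2 M r + ε`, with `M s ≤ M r`.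
      have hδ : 0 < ε / (2 * M r + ε) := by positivity
      filter_upwards [h.eventually_norm_succ_sub_le hΦ hγ h𝒰 hM hr T hδ,
        (hM r hr).eventually (gt_mem_nhds (lt_add_of_pos_right (M r) hε))] with k hk hk'
      filter_upwards [Measure.ae_ae_of_ae_prod (hQ k).coeFn_toLp] with s hs
      refine ⟨(memLp_two_of_lInf (q k ⌊s / τ k⌋₊)).toLp, ?_,
        (MemLp.coeFn_toLp _).trans (by filter_upwards [hs] with x hx using hx.symm)⟩
      split_ifs with hsr
      · have hs0 := hr.trans hsr.1
        have hmk : m k ⌊s / τ k⌋₊ ≤ M r + ε :=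
          ((h.data k).antitone hΦ hγ.le (floor_div_mono (h.data k).pos hsr.1.le)).trans hk'.le
        refine ⟨?_, mem_iInter₂.2 fun w hw => ?_⟩
        · change ∀ᵐ x ∂(volume.restrict Ω), _
          filter_upwards [ae_norm_le_norm_top (q k ⌊s / τ k⌋₊),
            (memLp_two_of_lInf (q k ⌊s / τ k⌋₊)).coeFn_toLp] with x h1 h2
          rw [h2]
          exact h1.trans ((hqm _ _).trans hmk)
        · rw [Set.mem_ofPred_eq, ← hy s w hs0 hw]
          have e1 : ∫ x in Ω, ((memLp_two_of_lInf (q k ⌊s / τ k⌋₊)).toLp :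
              Lp ℝ 2 (volume.restrict Ω)) x * (w - u s) x =
              l k ⌊s / τ k⌋₊ (w - u s) := by
            rw [← hq, pairing_apply]
            refine integral_congr_ae ?_
            filter_upwards [(memLp_two_of_lInf (q k ⌊s / τ k⌋₊)).coeFn_toLp] with x hx
            rw [hx]
          rw [e1]
          have h1 := h.energy_sub_le hΦ hγ h𝒰 hM hs0 ((h.data k).fin (⌊s / τ k⌋₊ + 1))
          have h2 := ((h.data k).sub ⌊s / τ k⌋₊).2 w hw
          have h3 := le_of_abs_le ((l k ⌊s / τ k⌋₊).le_of_opNorm_le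
            (((h.data k).bound _).trans hmk) (U k (⌊s / τ k⌋₊ + 1) - u s))
          have h4 : l k ⌊s / τ k⌋₊ (w - u s) = l k ⌊s / τ k⌋₊ (w - U k (⌊s / τ k⌋₊ + 1)) +
              l k ⌊s / τ k⌋₊ (U k (⌊s / τ k⌋₊ + 1) - u s) := by
            rw [← map_add, sub_add_sub_cancel]
          have h5 : M s ≤ M r := h.speed_antitoneOn hΦ hγ hM (mem_Ioi.2 hr) (mem_Ioi.2 hs0) hsr.1.le
          have h6 := hk s hsr
          have h7 : (2 * M r + ε) * ‖U k (⌊s / τ k⌋₊ + 1) - u s‖ ≤ ε := by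
            calc _ ≤ (2 * M r + ε) * (ε / (2 * M r + ε)) := by gcongr
              _ = ε := by field_simp
          have h8 := mul_le_mul_of_nonneg_right h5 (norm_nonneg (U k (⌊s / τ k⌋₊ + 1) - u s))
          linarith
      · exact mem_univ _
  refine ⟨Q, Lp.stronglyMeasurable Q, ?_⟩
  -- Rational `r` and integer `T`, `n` leave a single exceptional null set of times.
  have hall : ∀ᵐ s ∂(volume.restrict (Ioi (0 : ℝ))), ∀ (r : ℚ) (T n : ℕ), 0 < (r : ℝ) →
      s ∈ Ioo (r : ℝ) T → (∀ᵐ x ∂(volume.restrict Ω), |Q (s, x)| ≤ M r + 1 / ((n : ℝ) + 1)) ∧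
      ∀ w, Φ w < ⊤ → (Φ (u s)).toReal + ∫ x in Ω, Q (s, x) * (w - u s) x ≤
        (Φ w).toReal + 1 / ((n : ℝ) + 1) := by
    refine ae_all_iff.2 fun r => ae_all_iff.2 fun T => ae_all_iff.2 fun n => ?_
    by_cases hr : 0 < (r : ℝ)
    · filter_upwards [key r T _ hr (Nat.one_div_pos_of_nat (n := n))] with s hs _ using hs
    · exact Eventually.of_forall fun s h' => absurd h' hr
  have hcount : ∀ᵐ s ∂(volume.restrict (Ioi (0 : ℝ))), ContinuousWithinAt M (Ioi 0) s := by
    have h1 := (h.speed_antitoneOn hΦ hγ hM).countable_not_continuousWithinAt.ae_notMem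
      (volume.restrict (Ioi (0 : ℝ)))
    filter_upwards [h1, ae_restrict_mem measurableSet_Ioi] with s hs hs'
    by_contra hc
    exact hs ⟨hs', hc⟩
  have hmeas : ∀ s, AEStronglyMeasurable (fun x => Q (s, x)) (volume.restrict Ω) := fun s =>
    ((Lp.stronglyMeasurable Q).comp_measurable measurable_prodMk_left).aestronglyMeasurable
  filter_upwards [hall, hcount, ae_restrict_mem measurableSet_Ioi] with s hs hc hs0
  rw [mem_Ioi] at hs0
  obtain ⟨T, hT⟩ := exists_nat_gt s
  have hbound : ∀ᵐ x ∂(volume.restrict Ω), ∀ (r : ℚ) (n : ℕ), 0 < (r : ℝ) → (r : ℝ) < s →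
      |Q (s, x)| ≤ M r + 1 / ((n : ℝ) + 1) := by
    refine ae_all_iff.2 fun r => ae_all_iff.2 fun n => ?_
    by_cases hr : 0 < (r : ℝ) ∧ (r : ℝ) < s
    · filter_upwards [(hs r T n hr.1 ⟨hr.2, hT⟩).1] with x hx _ _ using hx
    · exact Eventually.of_forall fun x h1 h2 => absurd ⟨h1, h2⟩ hr
  -- The bound holds with `M r` for rational `r < s`; since a monotone function has countably many
  -- discontinuities, `r` can tend to `s`.
  have hbound' : ∀ᵐ x ∂(volume.restrict Ω), |Q (s, x)| ≤ M s := by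
    filter_upwards [hbound] with x hx
    refine le_of_forall_pos_le_add fun ε hε => ?_
    obtain ⟨n, hn⟩ := exists_nat_one_div_lt (half_pos hε)
    obtain ⟨δ, hδ, hδ'⟩ := Metric.continuousWithinAt_iff.1 hc (ε / 2) (half_pos hε)
    obtain ⟨r, hr1, hr2⟩ := exists_rat_btwn (max_lt hs0 (sub_lt_self s hδ))
    have hr0 : 0 < (r : ℝ) := (le_max_left _ _).trans_lt hr1
    have h1 := hx r n hr0 hr2
    have h2 := hδ' (x := (r : ℝ)) hr0 (by
      rw [Real.dist_eq, abs_sub_comm, abs_of_pos (sub_pos.2 hr2)]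
      linarith [(le_max_right _ _).trans_lt hr1])
    rw [Real.dist_eq] at h2
    linarith [le_abs_self (M r - M s)]
  obtain ⟨qs, hqs⟩ := exists_lInf_of_ae_le (hmeas s) hbound'
  refine ⟨hbound', qs, hqs, hfin s hs0.le, fun w hw => ?_⟩
  obtain ⟨r, hr1, hr2⟩ := exists_rat_btwn hs0
  have e : pairing qs (w - u s) = ∫ x in Ω, Q (s, x) * (w - u s) x := by
    rw [pairing_apply]
    refine integral_congr_ae ?_
    filter_upwards [hqs] with x hx
    rw [hx]
  rw [e]
  refine le_of_forall_pos_le_add fun ε hε => ?_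
  obtain ⟨n, hn⟩ := exists_nat_one_div_lt hε
  have := (hs r T n (by exact_mod_cast hr1) ⟨hr2, hT⟩).2 w hw
  linarith

end IsApproximation

end Field

/-! ### A measurable field of gradients. -/

section GradientField

variable {d : ℕ} {Ω : Set (E d)} {Φ : L1 Ω → ℝ≥0∞} {γ : ℝ} {u₀ : L1 Ω} {u : ℝ → L1 Ω} {τ : ℕ → ℝ}
  {U : ℕ → ℕ → L1 Ω} {l : ℕ → ℕ → StrongDual ℝ (L1 Ω)} {m : ℕ → ℕ → ℝ} {𝒰 : Ultrafilter ℕ}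
  {M : ℝ → ℝ}

lemma lintegral_exp_neg_sq_lt_top :
    ∫⁻ s in Ioi (0 : ℝ), ENNReal.ofReal (Real.exp (-s)) ^ 2 < ⊤ := by
  have h1 : ∫⁻ s in Ioi (0 : ℝ), ENNReal.ofReal (Real.exp (-s)) < ⊤ := by
    rw [← ofReal_integral_eq_lintegral_ofReal (integrableOn_exp_neg_Ioi 0)
      (Eventually.of_forall fun s => (Real.exp_pos _).le)]
    exact ENNReal.ofReal_lt_top
  refine lt_of_le_of_lt (setLIntegral_mono' measurableSet_Ioi fun s hs => ?_) h1
  rw [pow_two]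
  refine mul_le_of_le_one_left' ?_
  rw [← ENNReal.ofReal_one]
  exact ENNReal.ofReal_le_ofReal (Real.exp_le_one_iff.2 (by simpa using (mem_Ioi.1 hs).le))

/-- The gradients of the limit curve are jointly measurable. -/
lemma IsApproximation.exists_gradient_field [IsFiniteMeasure (volume.restrict Ω)]
    (h : IsApproximation Φ u₀ u τ U l m) (hΦ : IsStrongEnergy γ Φ)
    (hγ : 0 < γ) (h𝒰 : (𝒰 : Filter ℕ) ≤ atTop)
    (hM : ∀ s, 0 < s → Tendsto (fun k => m k ⌊s / τ k⌋₊) 𝒰 (𝓝 (M s))) :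
    ∃ Du : ℝ × E d → E d, StronglyMeasurable Du ∧ ∀ᵐ s ∂(volume.restrict (Ioi (0 : ℝ))),
      (fun x => Du (s, x)) =ᵐ[volume.restrict Ω] grad (u s) := by
  -- The gradients are bounded in `L²(Ω)` uniformly in time; the exponential makes them square
  -- integrable on the unbounded time interval.
  have hexp : Continuous fun z : ℝ × E d => Real.exp (-z.1) := by fun_prop
  have hG : ∀ k, StronglyMeasurable fun z : ℝ × E d =>
      Real.exp (-z.1) • grad (U k (⌊z.1 / τ k⌋₊ + 1)) z.2 := fun k =>
    hexp.stronglyMeasurable.smul (stronglyMeasurable_step (fun n => grad (U k (n + 1))) (τ k))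
  have hC : (∫⁻ s in Ioi (0 : ℝ), ENNReal.ofReal (Real.exp (-s)) ^ 2) *
      ENNReal.ofReal ((Φ u₀).toReal / (γ / 2)) ≠ ⊤ :=
    ENNReal.mul_ne_top lintegral_exp_neg_sq_lt_top.ne ENNReal.ofReal_ne_top
  choose hB hBb using fun k => memLp_two_of_lintegral_le (μ := stMeasure Ω)
    (f := fun z : ℝ × E d => Real.exp (-z.1) • grad (U k (⌊z.1 / τ k⌋₊ + 1)) z.2)
    (hG k).aestronglyMeasurable hC (by
      rw [lintegral_prod _ ((hG k).enorm.pow_const 2).aemeasurable,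
        ← lintegral_mul_const' _ _ ENNReal.ofReal_ne_top]
      refine lintegral_mono fun s => ?_
      simp only [enorm_smul, mul_pow]
      rw [lintegral_const_mul' _ _ (by simp), ← enorm_sq_eq_lintegral,
        Real.enorm_of_nonneg (Real.exp_pos _).le, ← ofReal_norm,
        ← ENNReal.ofReal_pow (norm_nonneg _)]
      refine mul_le_mul_right (ENNReal.ofReal_le_ofReal ?_) _
      have h1 := hΦ.growth _ ((h.data k).fin (⌊s / τ k⌋₊ + 1))
      have h2 := ENNReal.toReal_mono ((h.data k).fin 0).ne
        ((h.data k).energy_le hΦ hγ.le (⌊s / τ k⌋₊ + 1))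
      rw [h.init] at h2
      rw [le_div_iff₀ (by positivity)]
      linarith)
  obtain ⟨B, hBw⟩ := exists_weak_limit 𝒰 hBb
  -- By coercive monotonicity the discrete gradients are eventually within `ε` of `grad (u s)`,
  -- uniformly on the slab. Weak limits preserve this closed ball condition, and thus the jointly
  -- measurable limit `B` is identified on slices without any prior measurability of `s ↦ grad (u
  -- s)`.
  have key : ∀ (r T ε : ℝ), 0 < r → 0 < ε → ∀ᵐ s ∂(volume.restrict (Ioi (0 : ℝ))), s ∈ Ioo r T →
      ∃ f : L2V Ω, f =ᵐ[volume.restrict Ω] (fun x => B (s, x)) ∧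
        dist f (Real.exp (-s) • grad (u s)) ≤ ε := by
    intro r T ε hr hε
    classical
    have hslice := ae_slice_mem_of_weak_limit hBw (K := fun s => if s ∈ Ioo r T then
      Metric.closedBall (Real.exp (-s) • grad (u s)) ε else univ) (fun s => ?_) (fun s => ?_) ?_
    · filter_upwards [hslice] with s ⟨f, hf, hf'⟩ hs
      rw [if_pos hs] at hf
      exact ⟨f, hf', hf⟩
    · split_ifs
      · exact Metric.isClosed_closedBall
      · exact isClosed_univ
    · split_ifs
      · exact convex_closedBall _ _
      · exact convex_univ
    · have hMr := h.speed_nonneg hM hr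
      -- The two subgradients have norms at most `M r + 1` and `M r`, so monotonicity bounds `γ`
      -- times the squared distance of the gradients by `γ ε²`.
      have hδ : 0 < γ * ε ^ 2 / (2 * M r + 1) := by positivity
      filter_upwards [h.eventually_norm_succ_sub_le hΦ hγ h𝒰 hM hr T hδ,
        (hM r hr).eventually (gt_mem_nhds (lt_add_one (M r)))] with k hk hk'
      filter_upwards [Measure.ae_ae_of_ae_prod (hB k).coeFn_toLp] with s hs
      refine ⟨Real.exp (-s) • grad (U k (⌊s / τ k⌋₊ + 1)), ?_, ?_⟩
      · split_ifs with hsr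
        · have hs0 := hr.trans hsr.1
          obtain ⟨L, hL, hL'⟩ := h.exists_isSubgrad hΦ hγ h𝒰 hM hs0
          have h1 := hL.monotone hΦ ((h.data k).sub ⌊s / τ k⌋₊)
          have hmk : m k ⌊s / τ k⌋₊ ≤ M r + 1 :=
            ((h.data k).antitone hΦ hγ.le (floor_div_mono (h.data k).pos hsr.1.le)).trans hk'.le
          have h2 := le_of_abs_le ((l k ⌊s / τ k⌋₊).le_of_opNorm_le
            (((h.data k).bound _).trans hmk) (U k (⌊s / τ k⌋₊ + 1) - u s))
          have h5 : M s ≤ M r := h.speed_antitoneOn hΦ hγ hM (mem_Ioi.2 hr) (mem_Ioi.2 hs0) hsr.1.le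
          have h3 := neg_le_of_abs_le (L.le_of_opNorm_le (hL'.trans h5)
            (U k (⌊s / τ k⌋₊ + 1) - u s))
          have h7 : (2 * M r + 1) * ‖U k (⌊s / τ k⌋₊ + 1) - u s‖ ≤ γ * ε ^ 2 := by
            calc _ ≤ (2 * M r + 1) * (γ * ε ^ 2 / (2 * M r + 1)) := by
                  gcongr
                  exact hk s hsr
              _ = γ * ε ^ 2 := by field_simp
          have h8 : γ * ‖grad (U k (⌊s / τ k⌋₊ + 1)) - grad (u s)‖ ^ 2 ≤ γ * ε ^ 2 := by linarith
          have h9 : ‖grad (U k (⌊s / τ k⌋₊ + 1)) - grad (u s)‖ ≤ ε :=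
            le_of_sq_le_sq (le_of_mul_le_mul_left h8 hγ) hε.le
          rw [mem_closedBall_iff_norm, ← smul_sub, norm_smul, Real.norm_of_nonneg (Real.exp_pos _).le]
          refine (mul_le_of_le_one_left (norm_nonneg _) ?_).trans h9
          exact Real.exp_le_one_iff.2 (by linarith)
        · exact mem_univ _
      · filter_upwards [hs, Lp.coeFn_smul (Real.exp (-s)) (grad (U k (⌊s / τ k⌋₊ + 1)))] with x h1 h2
        rw [h1, h2, Pi.smul_apply]
  have hall : ∀ᵐ s ∂(volume.restrict (Ioi (0 : ℝ))), ∀ (r : ℚ) (T n : ℕ), 0 < (r : ℝ) →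
      s ∈ Ioo (r : ℝ) T → ∃ f : L2V Ω, f =ᵐ[volume.restrict Ω] (fun x => B (s, x)) ∧
        dist f (Real.exp (-s) • grad (u s)) ≤ 1 / ((n : ℝ) + 1) := by
    refine ae_all_iff.2 fun r => ae_all_iff.2 fun T => ae_all_iff.2 fun n => ?_
    by_cases hr : 0 < (r : ℝ)
    · filter_upwards [key r T _ hr (Nat.one_div_pos_of_nat (n := n))] with s hs _ using hs
    · exact Eventually.of_forall fun s h' => absurd h' hr
  have hexp' : Continuous fun z : ℝ × E d => Real.exp z.1 := by fun_prop
  refine ⟨fun z => Real.exp z.1 • B z, hexp'.stronglyMeasurable.smul (Lp.stronglyMeasurable B), ?_⟩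
  filter_upwards [hall, ae_restrict_mem measurableSet_Ioi] with s hs hs0
  obtain ⟨T, hT⟩ := exists_nat_gt s
  obtain ⟨r, hr1, hr2⟩ := exists_rat_btwn (mem_Ioi.1 hs0)
  have hr0 : 0 < (r : ℝ) := by exact_mod_cast hr1
  obtain ⟨f, hf, -⟩ := hs r T 0 hr0 ⟨hr2, hT⟩
  have hfe : f = Real.exp (-s) • grad (u s) := by
    refine eq_of_forall_dist_le fun ε hε => ?_
    obtain ⟨n, hn⟩ := exists_nat_one_div_lt hε
    obtain ⟨g, hg, hg'⟩ := hs r T n hr0 ⟨hr2, hT⟩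
    have : g = f := Lp.ext (hg.trans hf.symm)
    rw [← this]
    exact hg'.trans hn.le
  filter_upwards [hf, Lp.coeFn_smul (Real.exp (-s)) (grad (u s))] with x h1 h2
  rw [← h1, hfe, h2, Pi.smul_apply, smul_smul, ← Real.exp_add, add_neg_cancel, Real.exp_zero,
    one_smul]

end GradientField

/-! ### Right derivatives and the equality case of duality. -/

section Derivative

variable {d : ℕ} {Ω : Set (E d)} {Φ : L1 Ω → ℝ≥0∞} {γ : ℝ} {u₀ : L1 Ω} {u : ℝ → L1 Ω} {τ : ℕ → ℝ}
  {U : ℕ → ℕ → L1 Ω} {l : ℕ → ℕ → StrongDual ℝ (L1 Ω)} {m : ℕ → ℕ → ℝ} {𝒰 : Ultrafilter ℕ}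
  {M : ℝ → ℝ} {v : ℝ × E d → ℝ}

/-- The limit curve is differentiable from the right in `L¹(Ω)` at almost every time. -/
lemma IsVelocity.ae_tendsto_slope [IsFiniteMeasure (volume.restrict Ω)]
    (hv : IsVelocity Ω τ U 𝒰 v) (h : IsApproximation Φ u₀ u τ U l m) :
    ∀ᵐ s ∂(volume.restrict (Ioi (0 : ℝ))), ∃ V : L1 Ω,
      V =ᵐ[volume.restrict Ω] (fun x => v (s, x)) ∧
      Tendsto (fun r => r⁻¹ • (u (s + r) - u s)) (𝓝[>] 0) (𝓝 V) := by
  have : Fact ((1 : ℝ≥0∞) ≠ ⊤) := ⟨by simp⟩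
  have hI : ∀ (w : L1 Ω) (a b : ℝ), 0 < a → a ≤ b →
      IntervalIntegrable (fun σ => ∫ x in Ω, |v (σ, x) - w x|) volume a b := fun w a b ha hab => by
    rw [intervalIntegrable_iff_integrableOn_Ioc_of_le hab]
    have := (hv.integrable_sub ha b w).abs
    rw [volume_restrict_prod] at this
    exact this.integral_prod_left
  have hle : ∀ n : ℕ, 1 / ((n : ℝ) + 1) ≤ n + 1 := fun n => by
    rw [div_le_iff₀ (by positivity)]
    nlinarith [(Nat.cast_nonneg n : (0 : ℝ) ≤ n)]
  -- Vector-valued Lebesgue points through scalar ones: the scalar differentiation theorem is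
  -- applied to `∫ |v(σ) - w|` for each `w` in a countable dense subset of `L¹(Ω)`, on intervals
  -- exhausting `(0, ∞)`.
  have hLeb : ∀ᵐ s : ℝ, ∀ n i : ℕ, s ∈ uIcc (1 / ((n : ℝ) + 1)) (n + 1) →
      ∀ c ∈ uIcc (1 / ((n : ℝ) + 1)) (n + 1),
      HasDerivAt (fun y => ∫ σ in c..y, ∫ x in Ω, |v (σ, x) - TopologicalSpace.denseSeq (L1 Ω) i x|)
        (∫ x in Ω, |v (s, x) - TopologicalSpace.denseSeq (L1 Ω) i x|) s :=
    ae_all_iff.2 fun n => ae_all_iff.2 fun i =>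
      (hI _ _ _ Nat.one_div_pos_of_nat (hle n)).ae_hasDerivAt_integral
  have hmem : ∀ᵐ s ∂(volume.restrict (Ioi (0 : ℝ))),
      Integrable (fun x => v (s, x)) (volume.restrict Ω) := by
    have h1 : ∀ᵐ s : ℝ, ∀ n : ℕ, s ∈ Ioi (1 / ((n : ℝ) + 1)) →
        MemLp (fun x => v (s, x)) 2 (volume.restrict Ω) := by
      refine ae_all_iff.2 fun n => (ae_restrict_iff' measurableSet_Ioi).1 ?_
      have := hv.memLp _ (Nat.one_div_pos_of_nat (n := n))
      rw [volume_restrict_prod] at this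
      exact ae_slice_memLp this
    filter_upwards [ae_restrict_of_ae h1, ae_restrict_mem measurableSet_Ioi] with s hs hs0
    obtain ⟨n, hn⟩ := exists_nat_one_div_lt (mem_Ioi.1 hs0)
    exact (hs n hn).integrable (by norm_num)
  filter_upwards [ae_restrict_of_ae hLeb, hmem, ae_restrict_mem measurableSet_Ioi] with s hs hs' hs0
  rw [mem_Ioi] at hs0
  refine ⟨hs'.toL1 _, hs'.coeFn_toL1, Metric.tendsto_nhds.2 fun ε hε => ?_⟩
  obtain ⟨i, hi⟩ := (TopologicalSpace.denseRange_denseSeq (L1 Ω)).exists_dist_lt (hs'.toL1 _)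
    (show 0 < ε / 3 by positivity)
  obtain ⟨n, hn⟩ : ∃ n : ℕ, s ∈ Ioo (1 / ((n : ℝ) + 1)) (n + 1) := by
    obtain ⟨n₁, h1⟩ := exists_nat_one_div_lt hs0
    obtain ⟨n₂, h2⟩ := exists_nat_gt s
    refine ⟨max n₁ n₂, (Nat.one_div_le_one_div (le_max_left _ _)).trans_lt h1, h2.trans ?_⟩
    push_cast
    linarith [le_max_right (n₁ : ℝ) n₂]
  have hsu : s ∈ uIcc (1 / ((n : ℝ) + 1)) (n + 1) := Icc_subset_uIcc (Ioo_subset_Icc_self hn)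
  set w := TopologicalSpace.denseSeq (L1 Ω) i with hw
  have h1 := (hs n i hsu s hsu).tendsto_slope_zero_right
  simp only [intervalIntegral.integral_same, sub_zero, smul_eq_mul] at h1
  have h2 : ∫ x in Ω, |v (s, x) - w x| = ‖hs'.toL1 _ - w‖ := by
    rw [L1.norm_eq_integral_norm]
    refine integral_congr_ae ?_
    filter_upwards [Lp.coeFn_sub (hs'.toL1 _) w, hs'.coeFn_toL1] with x e1 e2
    rw [e1, Pi.sub_apply, e2, Real.norm_eq_abs]
  rw [dist_eq_norm] at hi
  rw [← hw, h2] at h1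
  filter_upwards [h1.eventually (gt_mem_nhds hi), self_mem_nhdsWithin] with r hr hr0
  rw [mem_Ioi] at hr0
  have h3 := hv.norm_sub_le h hs0 (le_add_of_nonneg_right hr0.le : s ≤ s + r) w
  rw [add_sub_cancel_left] at h3
  have h4 : ‖r⁻¹ • (u (s + r) - u s) - w‖ < ε / 3 := by
    refine lt_of_le_of_lt ?_ hr
    have e : r⁻¹ • (u (s + r) - u s) - w = r⁻¹ • (u (s + r) - u s - r • w) := by
      rw [smul_sub r⁻¹ (u (s + r) - u s), inv_smul_smul₀ hr0.ne']
    rw [e, norm_smul, norm_inv, Real.norm_of_nonneg hr0.le]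
    gcongr
  rw [dist_eq_norm]
  calc _ = ‖(r⁻¹ • (u (s + r) - u s) - w) - (hs'.toL1 _ - w)‖ := by rw [sub_sub_sub_cancel_right]
    _ ≤ _ := _root_.norm_sub_le _ _
    _ < ε := by linarith

/-- The discrete energy identities yield, in the limit, the relation between the velocity and the
subgradients. -/
lemma IsVelocity.ae_eq_of_subgradient [IsFiniteMeasure (volume.restrict Ω)]
    (hv : IsVelocity Ω τ U 𝒰 v) (h : IsApproximation Φ u₀ u τ U l m) (hΦ : IsStrongEnergy γ Φ)
    (hγ : 0 < γ) (hM : ∀ s, 0 < s → Tendsto (fun k => m k ⌊s / τ k⌋₊) 𝒰 (𝓝 (M s)))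
    {Q : ℝ × E d → ℝ} (hQ : ∀ᵐ s ∂(volume.restrict (Ioi (0 : ℝ))),
      (∀ᵐ x ∂(volume.restrict Ω), |Q (s, x)| ≤ M s) ∧
      ∃ q : LInf Ω, q =ᵐ[volume.restrict Ω] (fun x => Q (s, x)) ∧ IsSubgrad Φ (u s) (pairing q)) :
    ∀ᵐ s ∂(volume.restrict (Ioi (0 : ℝ))), ∀ᵐ x ∂(volume.restrict Ω),
      |Q (s, x)| ≤ (∫ y in Ω, |v (s, y)|) ∧
      v (s, x) * -Q (s, x) = |v (s, x)| * ∫ y in Ω, |v (s, y)| := by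
  have h𝒰 := hv.le_atTop
  have hcount : ∀ᵐ s ∂(volume.restrict (Ioi (0 : ℝ))), ContinuousWithinAt M (Ioi 0) s := by
    have h1 := (h.speed_antitoneOn hΦ hγ hM).countable_not_continuousWithinAt.ae_notMem
      (volume.restrict (Ioi (0 : ℝ)))
    filter_upwards [h1, ae_restrict_mem measurableSet_Ioi] with s hs hs'
    by_contra hc
    exact hs ⟨hs', hc⟩
  filter_upwards [hQ, hv.ae_tendsto_slope h, hcount, ae_restrict_mem measurableSet_Ioi] with
    s ⟨hQb, q, hq, hqs⟩ ⟨V, hV, hlim⟩ hc hs0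
  rw [mem_Ioi] at hs0
  have hMs := h.speed_nonneg hM hs0
  have hVM : ‖V‖ ≤ M s := by
    refine le_of_tendsto hlim.norm ?_
    filter_upwards [self_mem_nhdsWithin] with r hr
    rw [mem_Ioi] at hr
    have h1 := h.norm_sub_le hΦ hγ h𝒰 hM hs0 (le_add_of_nonneg_right hr.le : s ≤ s + r)
    rw [add_sub_cancel_left] at h1
    rw [norm_smul, norm_inv, Real.norm_of_nonneg hr.le, inv_mul_le_iff₀ hr]
    exact h1
  -- The energy decreases on `(s, s + r)` by at least `r M(s + r)²`, and at most by `-q (u(s + r) -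
  -- u(s))`. Dividing by `r` and letting `r → 0` uses the continuity of `M` at `s`.
  have hdiss : M s ^ 2 ≤ -pairing q V := by
    have h1 : Tendsto (fun r => M (s + r) ^ 2) (𝓝[>] 0) (𝓝 (M s ^ 2)) := by
      refine ((ContinuousWithinAt.tendsto hc).comp (tendsto_nhdsWithin_iff.2 ⟨?_, ?_⟩)).pow 2
      · have : Tendsto (fun r : ℝ => s + r) (𝓝 0) (𝓝 (s + 0)) := tendsto_const_nhds.add tendsto_id
        rw [add_zero] at this
        exact this.mono_left nhdsWithin_le_nhds
      · filter_upwards [self_mem_nhdsWithin] with r hr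
        exact add_pos hs0 (mem_Ioi.1 hr)
    refine le_of_tendsto_of_tendsto h1 (((pairing q).continuous.tendsto V).comp hlim).neg ?_
    filter_upwards [self_mem_nhdsWithin] with r hr
    rw [mem_Ioi] at hr
    have h2 := h.dissipation hΦ hγ h𝒰 hM hs0 (lt_add_of_pos_right s hr)
    have h3 := hqs.2 (u (s + r)) ((h.energy_limit_le hΦ hγ (by linarith)).trans_lt h.energy_lt_top)
    rw [add_sub_cancel_left] at h2
    simp only [Function.comp_apply]
    rw [map_smul, smul_eq_mul, ← mul_neg, le_inv_mul_iff₀ hr]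
    linarith
  have hqV : pairing q V = ∫ x in Ω, Q (s, x) * v (s, x) := by
    rw [pairing_apply]
    refine integral_congr_ae ?_
    filter_upwards [hq, hV] with x h1 h2
    rw [h1, h2]
  have hVn : ‖V‖ = ∫ y in Ω, |v (s, y)| := by
    rw [L1.norm_eq_integral_norm]
    refine integral_congr_ae ?_
    filter_upwards [hV] with x h1
    rw [h1, Real.norm_eq_abs]
  have hvi : Integrable (fun x => v (s, x)) (volume.restrict Ω) :=
    (L1.integrable_coeFn V).congr hV
  have hQi : Integrable (fun x => Q (s, x) * v (s, x)) (volume.restrict Ω) :=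
    hvi.bdd_mul (c := M s) ((Lp.aestronglyMeasurable q).congr hq) hQb
  have hsum : ∀ᵐ x ∂(volume.restrict Ω), 0 ≤ M s * |v (s, x)| + Q (s, x) * v (s, x) := by
    filter_upwards [hQb] with x hx
    have h1 := neg_abs_le (Q (s, x) * v (s, x))
    rw [abs_mul] at h1
    have h2 := mul_le_mul_of_nonneg_right hx (abs_nonneg (v (s, x)))
    linarith
  have hint : ∫ x in Ω, (M s * |v (s, x)| + Q (s, x) * v (s, x)) = M s * ‖V‖ + pairing q V := by
    rw [integral_add (hvi.abs.const_mul _) hQi, integral_const_mul, hVn, hqV]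
  have hnn := integral_nonneg_of_ae hsum
  rw [hint] at hnn
  -- From `M² ≤ -q(V) ≤ M ‖V‖` and `‖V‖ ≤ M`.
  have hMV : M s = ‖V‖ := by
    refine le_antisymm ?_ hVM
    by_contra hlt
    rw [not_le] at hlt
    nlinarith [norm_nonneg V]
  -- Equality in the duality inequality: a nonnegative integrand with zero integral vanishes almost
  -- everywhere.
  have hzero : ∫ x in Ω, (M s * |v (s, x)| + Q (s, x) * v (s, x)) = 0 := by
    rw [hint]
    refine le_antisymm ?_ hnn
    rw [← hMV]
    nlinarith
  have hae := (integral_eq_zero_iff_of_nonneg_ae hsum ((hvi.abs.const_mul _).add hQi)).1 hzero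
  filter_upwards [hQb, hae] with x h1 h2
  rw [Pi.zero_apply] at h2
  rw [← hVn, ← hMV]
  exact ⟨h1, by linarith⟩

end Derivative

/-! ### The nonlocal equation. -/

section Conclusion

variable {d : ℕ} {Ω : Set (E d)} {γ : ℝ} {u₀ : L1 Ω} {u : ℝ → L1 Ω}

lemma _root_.MeasureTheory.LocallyIntegrableOn.congr_ae_restrict {V : Type*} [NormedAddCommGroup V]
    {f g : E d → V} (hf : LocallyIntegrableOn f Ω) (h : f =ᵐ[volume.restrict Ω] g) :
    LocallyIntegrableOn g Ω := fun x hx => by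
  obtain ⟨t, ht, ht'⟩ := hf x hx
  refine ⟨t ∩ Ω, inter_mem ht self_mem_nhdsWithin, ?_⟩
  exact (ht'.mono_set inter_subset_left).congr
    (ae_mono (Measure.restrict_mono inter_subset_right le_rfl) h)

lemma IsWeakDivergence.congr {Z Z' : E d → E d} {w w' : E d → ℝ} (h : IsWeakDivergence Ω Z w)
    (hZ : Z =ᵐ[volume.restrict Ω] Z') (hw : w =ᵐ[volume.restrict Ω] w') :
    IsWeakDivergence Ω Z' w' := by
  refine ⟨h.1.congr_ae_restrict hZ, h.2.1.congr_ae_restrict hw, fun φ hφ => ?_⟩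
  have e : ∫ x in Ω, inner ℝ (Z' x) (gradient φ x) = ∫ x in Ω, inner ℝ (Z x) (gradient φ x) :=
    integral_congr_ae (hZ.mono fun x hx => by simp only [hx])
  rw [e, h.2.2 φ hφ]
  congr 1
  exact integral_congr_ae (hw.mono fun x hx => by simp only [hx])

lemma IsLimitFlow.exists_isApproximation {Φ : L1 Ω → ℝ≥0∞} (hu : IsLimitFlow Φ u₀ u)
    (hΦ : IsStrongEnergy γ Φ) (hγ : 0 < γ) (hu₀ : Φ u₀ < ⊤) :
    ∃ τ U l m, IsApproximation Φ u₀ u τ U l m := by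
  obtain ⟨hcont, τ, U, hτ, hτ0, hU, hconv⟩ := hu
  choose l m h using fun k => (hU k).exists_isFlowData hΦ hγ.le hu₀ (hτ k)
  exact ⟨τ, U, l, m, h, fun k => (hU k).1, hτ0, hcont, hconv⟩

lemma IsApproximation.solvesNonlocalEquation {F : E d → ℝ≥0∞} {𝒜 : Set (L1 Ω)}
    [IsFiniteMeasure (volume.restrict Ω)] {τ : ℕ → ℝ} {U : ℕ → ℕ → L1 Ω}
    {l : ℕ → ℕ → StrongDual ℝ (L1 Ω)} {m : ℕ → ℕ → ℝ} {𝒰 : Ultrafilter ℕ} {v : ℝ × E d → ℝ}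
    (h : IsApproximation (constrainedEnergy F 𝒜) u₀ u τ U l m) (hv : IsVelocity Ω τ U 𝒰 v)
    (hΩ : IsOpen Ω) (hb : Bornology.IsBounded Ω) (hlip : HasLipschitzBoundary Ω)
    (hF_zero : F 0 = 0) (hF_conv : ConvexOn ℝ≥0 univ F) (hγ : 0 < γ) (hF : IsGammaConvex γ F)
    (hΦ : IsStrongEnergy γ (constrainedEnergy F 𝒜)) (hA : IsAdmissibleConstraint F 𝒜)
    (hfin : ∀ ξ, F ξ ≠ ⊤) (hC1 : ContDiff ℝ 1 fun ξ => (F ξ).toReal) :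
    SolvesNonlocalEquation (fun ξ => (F ξ).toReal) u v := by
  obtain ⟨M, hM⟩ := h.exists_speed hΦ hγ 𝒰
  obtain ⟨Q, hQm, hQ⟩ := h.exists_subgradient_field hΩ hb hlip hΦ hγ hv.le_atTop hM
  obtain ⟨Du, hDum, hDu⟩ := h.exists_gradient_field hΦ hγ hv.le_atTop hM
  refine ⟨Du, fun z => -Q z, hDum.aestronglyMeasurable, hQm.neg.aestronglyMeasurable, ?_, ?_⟩
  · filter_upwards [hQ, hDu, ae_restrict_mem measurableSet_Ioi] with s ⟨_, q, hq, hqs⟩ hs hs0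
    have hgr : IsW11Gradient Ω (u s) (grad (u s)) := hΦ.hasGrad _ hqs.1
    refine ⟨hgr.congr (ae_eq_refl _) hs.symm, ?_⟩
    refine (isWeakDivergence_of_isSubgrad hΩ hF_zero hF_conv hγ hF hA hfin hC1 hqs).congr ?_ ?_
    · filter_upwards [hs] with x hx
      rw [hx]
    · filter_upwards [hq] with x hx
      rw [hx]
  · rw [volume_restrict_prod, Measure.ae_prod_iff_ae_ae]
    -- The bound and the equality are first obtained on almost every slice; the second goal supplies
    -- the joint measurability that turns this into a statement almost everywhere in space-time.
    · have h1 := hv.ae_eq_of_subgradient h hΦ hγ hM hQ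
      simpa only [abs_neg] using h1
    · have hI : Measurable fun z : ℝ × E d => ∫ y in Ω, |v (z.1, y)| :=
        ((hv.meas.norm.integral_prod_right' (ν := volume.restrict Ω)).measurable).comp measurable_fst
      exact (measurableSet_le hQm.measurable.neg.norm hI).inter
        (measurableSet_eq_fun (hv.meas.measurable.mul hQm.measurable.neg)
          (hv.meas.measurable.norm.mul hI))

end Conclusion

end L1Flow

theorem mainTheorem3 (d : ℕ) (hd : 1 ≤ d) (Ω : Set (L1Flow.E d))
    (hΩ_open : IsOpen Ω) (hΩ_conn : IsConnected Ω) (hΩ_bdd : Bornology.IsBounded Ω)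
    (hΩ_lip : L1Flow.HasLipschitzBoundary Ω)
    (F : L1Flow.E d → ℝ≥0∞) (hF_zero : F 0 = 0) (hF_conv : ConvexOn ℝ≥0 univ F)
    (hF_lsc : LowerSemicontinuous F)
    (γ : ℝ) (hγ : 0 < γ) (hF_gamma : L1Flow.IsGammaConvex γ F)
    (Φ : L1Flow.L1 Ω → ℝ≥0∞)
    (hΦ : Φ = L1Flow.neumannEnergy F Ω ∨
      ∃ g : L1Flow.E d → ℝ, L1Flow.IsAdmissibleDatum F Ω g ∧ Φ = L1Flow.dirichletEnergy F Ω g)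
    (u₀ : L1Flow.L1 Ω) (hu₀ : Φ u₀ < ⊤)
    (u : ℝ → L1Flow.L1 Ω) (hu : L1Flow.IsLimitFlow Φ u₀ u) :
    ∃ (v : ℝ × L1Flow.E d → ℝ) (Dv : ℝ × L1Flow.E d → L1Flow.E d),
      L1Flow.IsTimeDerivative u v ∧
      (∀ t : ℝ, 0 < t →
        L1Flow.MemL2H1 Ω t v Dv ∧
        ENNReal.ofReal γ * (∫⁻ s in Ioi t, ∫⁻ x in Ω, ‖Dv (s, x)‖ₑ ^ 2) ≤
          Φ u₀ / ENNReal.ofReal t) ∧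
      ((L1Flow.subdifferential Φ u₀).Nonempty →
        ENNReal.ofReal γ * (∫⁻ s in Ioi (0 : ℝ), ∫⁻ x in Ω, ‖Dv (s, x)‖ₑ ^ 2) ≤
          1 / 2 * L1Flow.minSubgradientNorm Φ u₀ ^ 2) ∧
      ((∀ ξ, F ξ ≠ ⊤) → ContDiff ℝ 1 (fun ξ => (F ξ).toReal) →
        L1Flow.SolvesNonlocalEquation (fun ξ => (F ξ).toReal) u v) := by
  have : IsFiniteMeasure (volume.restrict Ω) := ⟨by
    rw [Measure.restrict_apply_univ]; exact hΩ_bdd.measure_lt_top⟩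
  -- The Neumann and Dirichlet energies differ only by the constraint, so both are treated at once.
  obtain ⟨𝒜, hA, rfl⟩ : ∃ 𝒜 : Set (L1Flow.L1 Ω), L1Flow.IsAdmissibleConstraint F 𝒜 ∧
      Φ = L1Flow.constrainedEnergy F 𝒜 := by
    rcases hΦ with rfl | ⟨g, hg, rfl⟩
    · exact ⟨_, L1Flow.isAdmissibleConstraint_univ hF_zero, L1Flow.neumannEnergy_eq⟩
    · exact ⟨_, L1Flow.isAdmissibleConstraint_dirichlet hΩ_open hg, L1Flow.dirichletEnergy_eq g⟩
  have hΦ := L1Flow.isStrongEnergy_constrainedEnergy hΩ_open hF_zero hF_conv hF_lsc hγ hF_gamma hA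
  obtain ⟨τ, U, l, m, h⟩ := hu.exists_isApproximation hΦ hγ hu₀
  -- All weak limits are taken along this one ultrafilter, so that the velocity, the speed, the
  -- subgradients and the gradients come from the same limit process.
  have h𝒰 : ((hyperfilter ℕ : Ultrafilter ℕ) : Filter ℕ) ≤ atTop := Nat.hyperfilter_le_atTop
  obtain ⟨v, Dv, hvm, -, hmem, hgrad, hw, hDw⟩ := L1Flow.exists_velocity hΩ_open hΩ_bdd hΩ_lip hΦ hγ
    h.data h.init (hyperfilter ℕ)
  have hv : L1Flow.IsVelocity Ω τ U (hyperfilter ℕ) v :=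
    ⟨h𝒰, fun k t ht => (h.data k).memLp_vel hΩ_open hΩ_bdd hΩ_lip hΦ hγ ht, hvm,
      fun t ht => (hmem t ht).1, hw⟩
  refine ⟨v, Dv, hv.isTimeDerivative hΩ_open h, fun t ht => ⟨⟨(hmem t ht).1, (hmem t ht).2, ?_⟩,
    h.lintegral_gradient_le_div h𝒰 hΦ hγ ht (hmem t ht).2 (hDw t ht)⟩,
    h.lintegral_gradient_le_minSubgradientNorm hΦ hγ (fun t ht => (hmem t ht).2) hDw,
    fun hfin hC1 => h.solvesNonlocalEquation hv hΩ_open hΩ_bdd hΩ_lip hF_zero hF_conv hγ hF_gamma hΦ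
      hA hfin hC1⟩
  filter_upwards [ae_mono (Measure.restrict_mono (Ioi_subset_Ioi ht.le) le_rfl) hgrad] with s hs
  exact hs.2.2
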